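/- **Setting.** Let $h\ge 0$ with $h\ne 1$, put $k=\min\{h,1\}$ and let $\alpha\in[0,\pi/2]$ be such that $\cos\alpha=k$. For $m=(m_1,m_2)\in\mathbb S^1$ let $W(m)=\frac12\,(m_1^2-2hm_1+2hk-k^2)\ge 0$. Let $\mathbb R^2_+=\mathbb R\times(0,\infty)$ and let $\dot H^1(\mathbb R^2_+)$ be the completion of $C_0^\infty(\overline{\mathbb R^2_+})$ with respect to the inner product $\int_{\mathbb R^2_+}\nabla\phi\cdot\nabla\psi\,dx$. For $m\in H^1_{\mathrm{loc}}(\mathbb R;\mathbb S^1)$ set $$E_h(m)=\frac12\int_{-\infty}^{\infty}\bigl(|m'|^2+2W(m)\bigr)\,dx_1+\frac12\int_{\mathbb R^2_+}|\nabla u|^2\,dx\in[0,\infty],$$ where $u\in\dot H^1(\mathbb R^2_+)$ is the unique solution of $$\int_{\mathbb R^2_+}\nabla u\cdot\nabla\zeta\,dx=\int_{-\infty}^{\infty}m_1'\,\zeta(\cdot,0)\,dx_1\qquad\text{for every }\zeta\in C_0^\infty(\mathbb R^2)$$ (and $E_h(m)=\infty$ if there is no such $u$). If $E_h(m)<\infty$,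 then $m=(\cos\phi,\sin\phi)$ for a continuous $\phi\colon\mathbb R\to\mathbb R$ with finite limits $\phi(\pm\infty)$ at $\pm\infty$, and the winding number of $m$ is $\deg(m)=\frac{1}{2\pi}(\phi(+\infty)-\phi(-\infty))$. Let $$\mathcal A_h(d)=\{m\in H^1_{\mathrm{loc}}(\mathbb R;\mathbb S^1): E_h(m)<\infty,\ \deg(m)=d\},\qquad \mathcal E_h(d)=\inf_{m\in\mathcal A_h(d)}E_h(m).$$ **Theorem (concentration compactness).** Let $\ell\in\mathbb N=\{1,2,\dots\}$ and $d=\ell-\alpha/\pi$. Suppose that $$\mathcal E_h(d)<2\mathcal E_h(d')+\mathcal E_h(d-2d')$$ for $d'=1-\alpha/\pi,\,1,\,2-\alpha/\pi,\,2,\,\dots,\,\ell/2-1,\,\ell/2-\alpha/\pi$ if $\ell$ is even, and for $d'=1-\alpha/\pi,\,1,\,2-\alpha/\pi,\,2,\,\dots,\,(\ell-1)/2-\alpha/\pi,\,(\ell-1)/2$ if $\ell$ is odd (no condition if $\ell=1$). That is, $d'$ runs over the numbers $j-\alpha/\pi$ with $j\in\mathbb N$, $2j\le\ell$, and the numbers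 $j\in\mathbb N$ with $2j<\ell$. Then $E_h$ attains its infimum in $\mathcal A_h(d)$: there is $m\in\mathcal A_h(d)$ with $E_h(m)=\mathcal E_h(d)$. -/

import Mathlib

open MeasureTheory Filter Topology
open scoped ENNReal ContDiff

namespace Neel

/-- The number `k = min {h, 1}`. -/
noncomputable def wellLevel (h : ℝ) : ℝ := min h 1

/-- The angle `α` with `k = cos α`; for `0 ≤ h` it lies in `[0, π / 2]`. -/
noncomputable def wellAngle (h : ℝ) : ℝ := Real.arccos (wellLevel h)

/-- The anisotropy potential `W(m) = (m₁² - 2 h m₁ + 2 h k - k²) / 2`. Points `(m₁, m₂)` of the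
plane are written as complex numbers `m₁ + i m₂`. -/
noncomputable def anisotropy (h : ℝ) (z : ℂ) : ℝ :=
  (1 / 2) * (z.re ^ 2 - 2 * h * z.re + 2 * h * wellLevel h - wellLevel h ^ 2)

/-- `m` is (the continuous representative of) an element of `H¹_loc(ℝ; 𝕊¹)`: it takes values in
the unit circle and is a primitive of a locally square integrable function. The latter is the weak
derivative of `m`, and equals the pointwise derivative `deriv m` almost everywhere. -/
def MemH1locCircle (m : ℝ → ℂ) : Prop :=
  (∀ t, ‖m t‖ = 1) ∧
    ∃ g : ℝ → ℂ, (∀ a b : ℝ, MemLp g 2 (volume.restrict (Set.Icc a b))) ∧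
      ∀ a b : ℝ, m b - m a = ∫ t in a..b, g t

/-- The open upper half-plane `ℝ²₊ = ℝ × (0, ∞)`. -/
def halfPlane : Set (ℝ × ℝ) := {x | 0 < x.2}

/-- The partial derivative in the first variable. -/
noncomputable def partial₁ (ζ : ℝ × ℝ → ℝ) (x : ℝ × ℝ) : ℝ := fderiv ℝ ζ x (1, 0)

/-- The partial derivative in the second variable. -/
noncomputable def partial₂ (ζ : ℝ × ℝ → ℝ) (x : ℝ × ℝ) : ℝ := fderiv ℝ ζ x (0, 1)

/-- `ζ ∈ C₀^∞(ℝ²)`. -/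
def IsTestFunction (ζ : ℝ × ℝ → ℝ) : Prop := ContDiff ℝ ∞ ζ ∧ HasCompactSupport ζ

/-- `(p, q)` is the gradient of an element of `Ḣ¹(ℝ²₊)`. This space is the completion of the
restrictions to the closed half-plane of functions in `C₀^∞(ℝ²)`, with respect to the Dirichlet
inner product. The gradient embeds it isometrically into `L²(ℝ²₊; ℝ²)`, with image the closure of
the set of gradients of test functions. -/
structure IsHomSobolevGradient (p q : ℝ × ℝ → ℝ) : Prop where
  memLp₁ : MemLp p 2 (volume.restrict halfPlane)
  memLp₂ : MemLp q 2 (volume.restrict halfPlane)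
  approx : ∀ ε : ℝ, 0 < ε → ∃ ζ : ℝ × ℝ → ℝ, IsTestFunction ζ ∧
    ∫⁻ x in halfPlane, ENNReal.ofReal ((p x - partial₁ ζ x) ^ 2 + (q x - partial₂ ζ x) ^ 2)
      < ENNReal.ofReal ε

/-- `(p, q) = ∇u`, where `u ∈ Ḣ¹(ℝ²₊)` is the stray field potential of the first component `f`
of the magnetisation, that is, the weak solution of `Δu = 0` in `ℝ²₊` with
`∂u/∂x₂ = -f'` on `ℝ × {0}`. -/
def IsStrayField (f : ℝ → ℝ) (p q : ℝ × ℝ → ℝ) : Prop :=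
  IsHomSobolevGradient p q ∧
    ∀ ζ : ℝ × ℝ → ℝ, IsTestFunction ζ →
      ∫ x in halfPlane, (p x * partial₁ ζ x + q x * partial₂ ζ x) = ∫ t, deriv f t * ζ (t, 0)

/-- The Dirichlet integral `∫ |∇u|²` of the stray field potential of `f`. As `∇u` is unique (up to
null sets), the infimum is over at most one value; it is `∞` if there is no solution. -/
noncomputable def strayFieldDirichlet (f : ℝ → ℝ) : ℝ≥0∞ :=
  ⨅ (p : ℝ × ℝ → ℝ) (q : ℝ × ℝ → ℝ) (_ : IsStrayField f p q),
    ∫⁻ x in halfPlane, ENNReal.ofReal (p x ^ 2 + q x ^ 2)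

/-- The energy `E_h(m) = 1/2 ∫ (|m'|² + 2 W(m)) + 1/2 ∫ |∇u|²`, with values in `[0, ∞]`. -/
noncomputable def energy (h : ℝ) (m : ℝ → ℂ) : ℝ≥0∞ :=
  2⁻¹ * (∫⁻ t, ENNReal.ofReal (‖deriv m t‖ ^ 2 + 2 * anisotropy h (m t))) +
    2⁻¹ * strayFieldDirichlet (fun t => (m t).re)

/-- `deg(m) = d`: there is a continuous lifting `φ` of `m`, so that `m = (cos φ, sin φ)`, with
limits at `±∞`, and `d = (φ(+∞) - φ(-∞)) / (2π)`. -/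
def HasWindingNumber (m : ℝ → ℂ) (d : ℝ) : Prop :=
  ∃ (φ : ℝ → ℝ) (a b : ℝ), Continuous φ ∧
    (∀ t, m t = ⟨Real.cos (φ t), Real.sin (φ t)⟩) ∧
    Tendsto φ atBot (𝓝 a) ∧ Tendsto φ atTop (𝓝 b) ∧ d = (b - a) / (2 * Real.pi)

/-- The class `𝒜_h(d)` of maps of finite energy and winding number `d`. -/
def admissible (h d : ℝ) : Set (ℝ → ℂ) :=
  {m | MemH1locCircle m ∧ energy h m < (⊤ : ℝ≥0∞) ∧ HasWindingNumber m d}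

/-- The infimum `ℰ_h(d)` of the energy over `𝒜_h(d)`. -/
noncomputable def minEnergy (h d : ℝ) : ℝ≥0∞ := ⨅ m ∈ admissible h d, energy h m

/-- The smaller winding numbers `d'` attached to `d = ℓ - α/π`. They are
`1 - α/π, 1, 2 - α/π, 2, …, ℓ/2 - 1, ℓ/2 - α/π` if `ℓ` is even, and
`1 - α/π, 1, 2 - α/π, 2, …, (ℓ - 1)/2 - α/π, (ℓ - 1)/2` if `ℓ` is odd. -/
def smallerWindingNumbers (h : ℝ) (ℓ : ℕ) : Set ℝ :=
  {d' | (∃ j : ℕ, 1 ≤ j ∧ 2 * j ≤ ℓ ∧ d' = (j : ℝ) - wellAngle h / Real.pi) ∨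
    ∃ j : ℕ, 1 ≤ j ∧ 2 * j < ℓ ∧ d' = (j : ℝ)}

end Neel

namespace Neel

/-! The energy sees a map only through its first component and through `‖m'‖`. Complex conjugation
on parts of the line is therefore free as long as the result stays continuous, and the winding
number can be traded for a count of passages. A map of degree `ℓ - α/π` can be folded (for `h = 0`
possibly after a change of sign) into the upper half-circle so that its first component takes the
values `-1, 1, -1, …` at `2ℓ - 1` successive points (`exists_alternating_of_admissible`). Conversely
every such map unfolds to a map of degree `ℓ - α/π` with no more energy
(`exists_admissible_of_alternating`).

Take a minimising sequence of folded maps and centre each at its middle passage. The energies of the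
two even reflections add up to at most twice the original energy (`energy_symmetrize`), so one of
them is no worse, and the passages may be taken symmetric about the origin
(`exists_symmetric_passages`). Along a subsequence the maps, centred at any of their passages,
converge pointwise to profiles, and the gaps between successive passages converge in `[0, ∞]`
(`exists_profiles`). The energies of profiles that drift apart add up to at most the infimum
(`sum_energy_le`).

If all gaps stay finite, a single profile carries all passages, and it unfolds to a minimiser.
Otherwise some gap is infinite, and by symmetry so is its mirror image. The passages then split into
two outer groups and a middle one, of degrees `d'`, `d - 2d'`, `d'`. Distant maps can be glued at
arbitrarily small cost, so the infimum is subadditive (`alternatingEnergy_le_add`), even when a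
group consists of several clusters. Hence `2ℰ(d') + ℰ(d - 2d') ≤ ℰ(d)`, against the hypothesis. The
symmetrisation is the reason why only splittings of this symmetric form have to be excluded.

The nonlocal term is handled by duality: `∫|∇u|²` is the supremum of `2∫f'ζ - ∫|∇ζ|²` over test
functions `ζ` (`strayFieldDirichlet_eq_iSup`). Lower bounds come from testing with well-chosen `ζ`,
such as sums of distant translates, which are orthogonal. Upper bounds come from estimating the
functional. -/

/-! ### Locally absolutely continuous functions on the line -/

/-- Absolute continuity on every compact interval. -/
def LocAC {E : Type*} [PseudoMetricSpace E] (f : ℝ → E) : Prop :=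
  ∀ a b, AbsolutelyContinuousOnInterval f a b

section LocAC

variable {E : Type*} [NormedAddCommGroup E]

theorem LocAC.continuous {f : ℝ → E} (hf : LocAC f) : Continuous f := by
  rw [continuous_iff_continuousAt]
  intro x
  refine (hf (x - 1) (x + 1)).continuousOn.continuousAt ?_
  rw [Set.uIcc_of_le (by linarith)]
  exact Icc_mem_nhds (by linarith) (by linarith)

theorem LocAC.of_dist_le {F : Type*} [NormedAddCommGroup F] {f : ℝ → E} {g : ℝ → F} (hg : LocAC g)
    (h : ∀ a b, dist (f a) (f b) ≤ dist (g a) (g b)) : LocAC f := by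
  intro a b
  refine squeeze_zero (fun _ => Finset.sum_nonneg fun _ _ => dist_nonneg) (fun _ => ?_) (hg a b)
  exact Finset.sum_le_sum fun _ _ => h _ _

theorem locallyIntegrable_iff_intervalIntegrable {f : ℝ → E} :
    LocallyIntegrable f ↔ ∀ a b, IntervalIntegrable f volume a b := by
  constructor
  · intro h a b
    exact intervalIntegrable_iff.mpr ((h.integrableOn_isCompact isCompact_uIcc).mono_set
      Set.uIoc_subset_uIcc)
  · intro h
    rw [locallyIntegrable_iff]
    intro K hK
    obtain ⟨r, hr⟩ := hK.isBounded.subset_closedBall 0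
    rw [Real.closedBall_eq_Icc] at hr
    rcases le_total (0 - r) (0 + r) with h' | h'
    · exact ((intervalIntegrable_iff_integrableOn_Icc_of_le h').1 (h _ _)).mono_set hr
    · refine IntegrableOn.mono_set (t := Set.Icc (0 + r) (0 - r)) ?_ (hr.trans ?_)
      · exact (intervalIntegrable_iff_integrableOn_Icc_of_le h').1 (h _ _)
      · intro x hx; exact ⟨by linarith [hx.1], by linarith [hx.2]⟩

theorem locallyIntegrable_norm {f : ℝ → E} (hf : LocallyIntegrable f) :
    LocallyIntegrable (fun t => ‖f t‖) :=
  locallyIntegrable_iff_intervalIntegrable.2 fun a b =>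
    (locallyIntegrable_iff_intervalIntegrable.1 hf a b).norm

theorem intervalIntegrable_ofReal {f : ℝ → ℝ} {a b : ℝ} (hf : IntervalIntegrable f volume a b) :
    IntervalIntegrable (fun t => (f t : ℂ)) volume a b :=
  ⟨hf.1.ofReal, hf.2.ofReal⟩

theorem locAC_integral {G : ℝ → ℝ} (hG : LocallyIntegrable G) :
    LocAC (fun x => ∫ t in (0 : ℝ)..x, G t) := by
  intro a b
  have hI := locallyIntegrable_iff_intervalIntegrable.1 hG
  refine ((hI (min 0 (min a b)) (max 0 (max a b))).absolutelyContinuousOnInterval_intervalIntegral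
    ?_).mono ?_
  · rw [Set.uIcc_of_le (by simp)]; simp
  · rw [Set.uIcc_of_le (a := min 0 _) (by simp)]
    exact Set.Icc_subset_Icc (by simp) (by simp)

/-- A function whose increments are bounded by the integrals of `G` is absolutely continuous. -/
theorem locAC_of_bound {f : ℝ → E} {G : ℝ → ℝ} (hG : LocallyIntegrable G)
    (h : ∀ a b, a ≤ b → ‖f b - f a‖ ≤ ∫ t in a..b, G t) : LocAC f := by
  have hI := locallyIntegrable_iff_intervalIntegrable.1 hG
  refine (locAC_integral hG).of_dist_le fun a b => ?_
  wlog hab : a ≤ b generalizing a b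
  · rw [dist_comm, dist_comm (∫ t in (0:ℝ)..a, G t)]; exact this b a (le_of_not_ge hab)
  rw [dist_comm, dist_eq_norm, dist_comm, Real.dist_eq,
    intervalIntegral.integral_interval_sub_left (hI _ _) (hI _ _)]
  exact (h a b hab).trans (le_abs_self _)

/-- By Lebesgue differentiation `G t` is a.e. the limit of the averages of `G` over `[t, t + s]`,
which dominate the difference quotients of `f`. -/
theorem norm_deriv_le_of_bound [NormedSpace ℝ E] {f : ℝ → E} {G : ℝ → ℝ} (hG : LocallyIntegrable G)
    (h : ∀ a b, a ≤ b → ‖f b - f a‖ ≤ ∫ t in a..b, G t) : ∀ᵐ t, ‖deriv f t‖ ≤ G t := by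
  have hI := locallyIntegrable_iff_intervalIntegrable.1 hG
  filter_upwards [_root_.LocallyIntegrable.ae_hasDerivAt_integral hG] with t ht
  have hP := (ht 0).tendsto_slope_zero_right
  have key : ∀ s : ℝ, 0 < s → ‖s⁻¹ • (f (t + s) - f t)‖ ≤
      s⁻¹ • ((∫ r in (0:ℝ)..t + s, G r) - ∫ r in (0:ℝ)..t, G r) := by
    intro s hs
    rw [intervalIntegral.integral_interval_sub_left (hI _ _) (hI _ _), norm_smul, smul_eq_mul,
      norm_inv, Real.norm_of_nonneg hs.le]
    exact mul_le_mul_of_nonneg_left (h _ _ (by linarith)) (by positivity)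
  by_cases hd : DifferentiableAt ℝ f t
  · refine le_of_tendsto_of_tendsto hd.hasDerivAt.tendsto_slope_zero_right.norm hP ?_
    filter_upwards [self_mem_nhdsWithin] with s hs using key s hs
  -- Here `deriv f t` is the default value `0`, and `G t` is a limit of nonnegative numbers.
  · rw [deriv_zero_of_not_differentiableAt hd, norm_zero]
    refine ge_of_tendsto hP ?_
    filter_upwards [self_mem_nhdsWithin] with s hs using (norm_nonneg _).trans (key s hs)

theorem LocAC.ae_differentiableAt {f : ℝ → ℝ} (hf : LocAC f) : ∀ᵐ t, DifferentiableAt ℝ f t := by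
  have h : ∀ n : ℕ, ∀ᵐ t, t ∈ Set.uIcc (-n : ℝ) n → DifferentiableAt ℝ f t := fun n =>
    (hf _ _).ae_differentiableAt
  filter_upwards [ae_all_iff.2 h] with t ht
  obtain ⟨n, hn⟩ := exists_nat_ge |t|
  refine ht n ?_
  rw [Set.uIcc_of_le (by linarith [abs_nonneg t])]
  exact ⟨by linarith [neg_abs_le t], by linarith [le_abs_self t]⟩

theorem LocAC.locallyIntegrable_deriv {f : ℝ → ℝ} (hf : LocAC f) : LocallyIntegrable (deriv f) :=
  locallyIntegrable_iff_intervalIntegrable.2 fun a b => (hf a b).intervalIntegrable_deriv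

theorem LocAC.add {f g : ℝ → E} (hf : LocAC f) (hg : LocAC g) : LocAC (fun t => f t + g t) :=
  fun a b => (hf a b).add (hg a b)

theorem LocAC.sub {f g : ℝ → E} (hf : LocAC f) (hg : LocAC g) : LocAC (fun t => f t - g t) :=
  fun a b => (hf a b).sub (hg a b)

theorem LocAC.neg {f : ℝ → E} (hf : LocAC f) : LocAC (fun t => - f t) :=
  fun a b => (hf a b).neg

theorem LocAC.sub_const {f : ℝ → E} (hf : LocAC f) (c : E) : LocAC (fun t => f t - c) :=
  hf.of_dist_le fun a b => by simp

theorem LocAC.re {m : ℝ → ℂ} (hm : LocAC m) : LocAC (fun t => (m t).re) :=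
  hm.of_dist_le fun a b => by
    rw [Real.dist_eq, dist_eq_norm, ← Complex.sub_re]; exact Complex.abs_re_le_norm _

theorem LocAC.im {m : ℝ → ℂ} (hm : LocAC m) : LocAC (fun t => (m t).im) :=
  hm.of_dist_le fun a b => by
    rw [Real.dist_eq, dist_eq_norm, ← Complex.sub_im]; exact Complex.abs_im_le_norm _

theorem _root_.HasDerivAt.re' {m : ℝ → ℂ} {m' : ℂ} {t : ℝ} (h : HasDerivAt m m' t) :
    HasDerivAt (fun t => (m t).re) m'.re t :=
  Complex.reCLM.hasFDerivAt.comp_hasDerivAt t h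

theorem _root_.HasDerivAt.im' {m : ℝ → ℂ} {m' : ℂ} {t : ℝ} (h : HasDerivAt m m' t) :
    HasDerivAt (fun t => (m t).im) m'.im t :=
  Complex.imCLM.hasFDerivAt.comp_hasDerivAt t h

theorem LocAC.ae_hasDerivAt {m : ℝ → ℂ} (hm : LocAC m) :
    ∀ᵐ t, HasDerivAt m (deriv m t) t := by
  filter_upwards [hm.re.ae_differentiableAt, hm.im.ae_differentiableAt] with t h1 h2
  have h := h1.hasDerivAt.ofReal_comp.add (h2.hasDerivAt.ofReal_comp.mul_const Complex.I)
  have : m = fun t => (((m t).re : ℝ) : ℂ) + ((m t).im : ℝ) * Complex.I := by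
    funext t; exact (Complex.re_add_im (m t)).symm
  have h3 : DifferentiableAt ℝ m t := by
    rw [this]; exact h.differentiableAt
  exact h3.hasDerivAt

theorem LocAC.ae_deriv_re {m : ℝ → ℂ} (hm : LocAC m) :
    ∀ᵐ t, deriv (fun t => (m t).re) t = (deriv m t).re := by
  filter_upwards [hm.ae_hasDerivAt] with t ht using ht.re'.deriv

theorem LocAC.ae_deriv_im {m : ℝ → ℂ} (hm : LocAC m) :
    ∀ᵐ t, deriv (fun t => (m t).im) t = (deriv m t).im := by
  filter_upwards [hm.ae_hasDerivAt] with t ht using ht.im'.deriv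

theorem LocAC.locallyIntegrable_deriv_complex {m : ℝ → ℂ} (hm : LocAC m) :
    LocallyIntegrable (deriv m) := by
  rw [locallyIntegrable_iff_intervalIntegrable]
  intro a b
  have h1 := (hm.re a b).intervalIntegrable_deriv
  have h2 := (hm.im a b).intervalIntegrable_deriv
  have h := (intervalIntegrable_ofReal h1).add ((intervalIntegrable_ofReal h2).mul_const Complex.I)
  refine h.congr_ae ?_
  refine ae_restrict_of_ae ?_
  filter_upwards [hm.ae_deriv_re, hm.ae_deriv_im] with t h1 h2
  simp only [h1, h2]
  exact Complex.re_add_im _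

theorem LocAC.integral_deriv_complex {m : ℝ → ℂ} (hm : LocAC m) (a b : ℝ) :
    ∫ t in a..b, deriv m t = m b - m a := by
  have hI := locallyIntegrable_iff_intervalIntegrable.1 hm.locallyIntegrable_deriv_complex a b
  apply Complex.ext
  · rw [← Complex.reCLM_apply, ← Complex.reCLM.intervalIntegral_comp_comm hI, Complex.sub_re,
      ← (hm.re a b).integral_deriv_eq_sub]
    refine intervalIntegral.integral_congr_ae ?_
    filter_upwards [hm.ae_deriv_re] with t h1 _ using h1.symm
  · rw [← Complex.imCLM_apply, ← Complex.imCLM.intervalIntegral_comp_comm hI, Complex.sub_im,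
      ← (hm.im a b).integral_deriv_eq_sub]
    refine intervalIntegral.integral_congr_ae ?_
    filter_upwards [hm.ae_deriv_im] with t h1 _ using h1.symm

theorem LocAC.norm_sub_le {m : ℝ → ℂ} (hm : LocAC m) {a b : ℝ} (hab : a ≤ b) :
    ‖m b - m a‖ ≤ ∫ t in a..b, ‖deriv m t‖ := by
  rw [← hm.integral_deriv_complex]
  exact intervalIntegral.norm_integral_le_integral_norm hab

end LocAC

/-- `H¹_loc` in terms of the pointwise derivative. -/
theorem memH1locCircle_iff {m : ℝ → ℂ} : MemH1locCircle m ↔ (∀ t, ‖m t‖ = 1) ∧ LocAC m ∧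
    ∀ a b : ℝ, ∫⁻ t in Set.Icc a b, ENNReal.ofReal (‖deriv m t‖ ^ 2) < ⊤ := by
  have hsq : ∀ g : ℝ → ℂ, ∀ a b : ℝ, AEStronglyMeasurable g (volume.restrict (Set.Icc a b)) →
      (MemLp g 2 (volume.restrict (Set.Icc a b)) ↔
        ∫⁻ t in Set.Icc a b, ENNReal.ofReal (‖g t‖ ^ 2) < ⊤) := by
    intro g a b hg
    rw [MemLp, eLpNorm_lt_top_iff_lintegral_rpow_enorm_lt_top (by simp) (by simp)]
    simp only [hg, true_and, ENNReal.toReal_ofNat]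
    refine iff_of_eq (congrArg (· < ⊤) (lintegral_congr fun t => ?_))
    rw [ENNReal.ofReal_pow (norm_nonneg _), ofReal_norm]
    norm_cast
  constructor
  · rintro ⟨h1, g, hg, hint⟩
    have hgl : LocallyIntegrable g := by
      rw [locallyIntegrable_iff_intervalIntegrable]
      intro a b
      rw [intervalIntegrable_iff]
      exact IntegrableOn.mono_set ((hg (min a b) (max a b)).integrable (by norm_num))
        (by rw [← Set.uIcc]; exact Set.uIoc_subset_uIcc)
    have hAC : LocAC m := by
      refine locAC_of_bound (locallyIntegrable_norm hgl) fun a b hab => ?_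
      rw [hint a b]
      exact intervalIntegral.norm_integral_le_integral_norm hab
    have hd : ∀ᵐ t, deriv m t = g t := by
      filter_upwards [_root_.LocallyIntegrable.ae_hasDerivAt_integral hgl] with t ht
      have : m = fun x => m 0 + ∫ t in (0:ℝ)..x, g t := by
        funext x; rw [← hint]; ring
      rw [this]
      exact ((ht 0).const_add _).deriv
    refine ⟨h1, hAC, fun a b => ?_⟩
    rw [← hsq _ _ _ (measurable_deriv m).aestronglyMeasurable]
    refine (memLp_congr_ae (ae_restrict_of_ae ?_)).2 (hg a b)
    exact hd
  · rintro ⟨h1, hAC, h2⟩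
    exact ⟨h1, deriv m, fun a b => (hsq _ _ _ (measurable_deriv m).aestronglyMeasurable).2 (h2 a b),
      fun a b => (hAC.integral_deriv_complex a b).symm⟩

theorem MemH1locCircle.locAC {m : ℝ → ℂ} (hm : MemH1locCircle m) : LocAC m :=
  (memH1locCircle_iff.1 hm).2.1

theorem MemH1locCircle.continuous {m : ℝ → ℂ} (hm : MemH1locCircle m) : Continuous m :=
  hm.locAC.continuous

theorem MemH1locCircle.of_bound {m : ℝ → ℂ} {G : ℝ → ℝ} (h1 : ∀ t, ‖m t‖ = 1)
    (hG : LocallyIntegrable G)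
    (hG2 : ∀ a b : ℝ, ∫⁻ t in Set.Icc a b, ENNReal.ofReal (G t ^ 2) < ⊤)
    (h : ∀ a b, a ≤ b → ‖m b - m a‖ ≤ ∫ t in a..b, G t) : MemH1locCircle m := by
  refine memH1locCircle_iff.2 ⟨h1, locAC_of_bound hG h, fun a b => lt_of_le_of_lt ?_ (hG2 a b)⟩
  refine lintegral_mono_ae (ae_restrict_of_ae ?_)
  filter_upwards [norm_deriv_le_of_bound hG h] with t ht
  exact ENNReal.ofReal_le_ofReal (by gcongr)

/-! ### A variational form of the Riesz representation theorem -/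

section Riesz

variable {T V : Type*} [AddCommGroup T] [Module ℝ T] [NormedAddCommGroup V] [InnerProductSpace ℝ V]

/-- Replacing `z` by `s • z` gives a quadratic polynomial in `s` that is nonnegative everywhere, so
its discriminant is at most zero. -/
theorem abs_le_of_two_mul_le (G : T →ₗ[ℝ] V) (l : T →ₗ[ℝ] ℝ) {C : ℝ} (hC : 0 ≤ C)
    (h : ∀ z, 2 * l z ≤ C + ‖G z‖ ^ 2) (z : T) : |l z| ≤ √C * ‖G z‖ := by
  have key : ∀ z, l z ≤ √C * ‖G z‖ := by
    intro z
    have hs : ∀ s : ℝ, 0 ≤ ‖G z‖ ^ 2 * (s * s) + (-(2 * l z)) * s + C := by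
      intro s
      have := h (s • z)
      simp only [map_smul, norm_smul, smul_eq_mul, mul_pow, Real.norm_eq_abs, sq_abs] at this
      nlinarith
    have hd := discrim_le_zero hs
    rw [discrim] at hd
    refine (le_abs_self _).trans (abs_le_of_sq_le_sq ?_ (by positivity))
    rw [mul_pow, Real.sq_sqrt hC]
    nlinarith
  rw [abs_le]
  refine ⟨?_, key z⟩
  have := key (-z)
  simp only [map_neg, norm_neg] at this
  linarith

/-- The bound makes `l` vanish on the kernel of `G`, so `l` descends to a bounded functional on the
range of `G`. Hahn–Banach and the Riesz theorem give the vector. -/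
theorem exists_riesz [CompleteSpace V] (G : T →ₗ[ℝ] V) (l : T →ₗ[ℝ] ℝ) {C : ℝ} (hC : 0 ≤ C)
    (h : ∀ z, 2 * l z ≤ C + ‖G z‖ ^ 2) : ∃ v : V, (∀ z, l z = inner ℝ v (G z)) ∧ ‖v‖ ^ 2 ≤ C := by
  have hb := abs_le_of_two_mul_le G l hC h
  have hker : LinearMap.ker G ≤ LinearMap.ker l := by
    intro z hz
    have := hb z
    rw [LinearMap.mem_ker.1 hz, norm_zero, mul_zero] at this
    exact LinearMap.mem_ker.2 (abs_nonpos_iff.1 this)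
  let l₀ : LinearMap.range G →ₗ[ℝ] ℝ :=
    (Submodule.liftQ (LinearMap.ker G) l hker).comp G.quotKerEquivRange.symm.toLinearMap
  have hl₀ : ∀ z, l₀ ⟨G z, LinearMap.mem_range_self G z⟩ = l z := by
    intro z
    have : G.quotKerEquivRange.symm ⟨G z, LinearMap.mem_range_self G z⟩ =
        Submodule.Quotient.mk z := by
      rw [LinearEquiv.symm_apply_eq]; ext; simp
    simp only [l₀, LinearMap.comp_apply, LinearEquiv.coe_coe, this]
    simp
  let l₁ : StrongDual ℝ (LinearMap.range G) := l₀.mkContinuous (√C) (by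
    rintro ⟨_, z, rfl⟩
    rw [hl₀]; exact hb z)
  obtain ⟨g, hg, hgn⟩ := exists_extension_norm_eq _ l₁
  refine ⟨(InnerProductSpace.toDual ℝ V).symm g, fun z => ?_, ?_⟩
  · rw [InnerProductSpace.toDual_symm_apply]
    have := hg ⟨G z, LinearMap.mem_range_self G z⟩
    rw [this]
    exact (hl₀ z).symm
  · rw [LinearIsometryEquiv.norm_map, hgn]
    have : ‖l₁‖ ≤ √C := LinearMap.mkContinuous_norm_le _ (by positivity) _
    calc ‖l₁‖ ^ 2 ≤ √C ^ 2 := by gcongr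
      _ = C := Real.sq_sqrt hC

/-- Applying `exists_riesz` inside the closure of the range places the representing vector there.
This is the approximability that `IsHomSobolevGradient` asks for. -/
theorem exists_riesz_closure [CompleteSpace V] (G : T →ₗ[ℝ] V) (l : T →ₗ[ℝ] ℝ) {C : ℝ}
    (hC : 0 ≤ C) (h : ∀ z, 2 * l z ≤ C + ‖G z‖ ^ 2) :
    ∃ v ∈ closure (Set.range G), (∀ z, l z = inner ℝ v (G z)) ∧ ‖v‖ ^ 2 ≤ C := by
  let K := (LinearMap.range G).topologicalClosure
  let G' : T →ₗ[ℝ] K := G.codRestrict K fun z =>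
    Submodule.le_topologicalClosure _ (LinearMap.mem_range_self G z)
  have : CompleteSpace K := (Submodule.isClosed_topologicalClosure _).completeSpace_coe
  obtain ⟨v, hv, hv2⟩ := exists_riesz G' l hC h
  exact ⟨v, v.2, hv, hv2⟩

end Riesz

/-! ### Test functions -/

namespace IsTestFunction

variable {ζ η : ℝ × ℝ → ℝ}

theorem add (hζ : IsTestFunction ζ) (hη : IsTestFunction η) :
    IsTestFunction (fun x => ζ x + η x) :=
  ⟨hζ.1.add hη.1, hζ.2.add hη.2⟩

theorem const_mul (hζ : IsTestFunction ζ) (c : ℝ) : IsTestFunction (fun x => c * ζ x) :=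
  ⟨contDiff_const.mul hζ.1, hζ.2.mul_left⟩

theorem zero : IsTestFunction (fun _ => 0) := ⟨contDiff_const, HasCompactSupport.zero⟩

theorem differentiable (hζ : IsTestFunction ζ) : Differentiable ℝ ζ :=
  hζ.1.differentiable (by simp)

theorem continuous (hζ : IsTestFunction ζ) : Continuous ζ := hζ.1.continuous

theorem continuous_fderiv_apply (hζ : IsTestFunction ζ) (v : ℝ × ℝ) :
    Continuous fun x => fderiv ℝ ζ x v :=
  (hζ.1.continuous_fderiv (by simp)).clm_apply continuous_const

theorem hasCompactSupport_fderiv_apply (hζ : IsTestFunction ζ) (v : ℝ × ℝ) :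
    HasCompactSupport fun x => fderiv ℝ ζ x v :=
  hζ.2.fderiv_apply ℝ v

theorem continuous_partial₁ (hζ : IsTestFunction ζ) : Continuous (partial₁ ζ) :=
  hζ.continuous_fderiv_apply _

theorem continuous_partial₂ (hζ : IsTestFunction ζ) : Continuous (partial₂ ζ) :=
  hζ.continuous_fderiv_apply _

theorem hasCompactSupport_partial₁ (hζ : IsTestFunction ζ) : HasCompactSupport (partial₁ ζ) :=
  hζ.hasCompactSupport_fderiv_apply _

theorem hasCompactSupport_partial₂ (hζ : IsTestFunction ζ) : HasCompactSupport (partial₂ ζ) :=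
  hζ.hasCompactSupport_fderiv_apply _

theorem partial₁_add (hζ : IsTestFunction ζ) (hη : IsTestFunction η) (x : ℝ × ℝ) :
    partial₁ (fun x => ζ x + η x) x = partial₁ ζ x + partial₁ η x := by
  rw [partial₁, fderiv_fun_add (hζ.differentiable x) (hη.differentiable x)]; rfl

theorem partial₂_add (hζ : IsTestFunction ζ) (hη : IsTestFunction η) (x : ℝ × ℝ) :
    partial₂ (fun x => ζ x + η x) x = partial₂ ζ x + partial₂ η x := by
  rw [partial₂, fderiv_fun_add (hζ.differentiable x) (hη.differentiable x)]; rfl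

theorem partial₁_const_mul (hζ : IsTestFunction ζ) (c : ℝ) (x : ℝ × ℝ) :
    partial₁ (fun x => c * ζ x) x = c * partial₁ ζ x := by
  rw [partial₁, fderiv_const_mul (hζ.differentiable x)]; rfl

theorem partial₂_const_mul (hζ : IsTestFunction ζ) (c : ℝ) (x : ℝ × ℝ) :
    partial₂ (fun x => c * ζ x) x = c * partial₂ ζ x := by
  rw [partial₂, fderiv_const_mul (hζ.differentiable x)]; rfl

/-- The support of a test function lies in a square. -/
theorem exists_bound_support (hζ : IsTestFunction ζ) :
    ∃ R : ℝ, 0 < R ∧ ∀ x : ℝ × ℝ, R ≤ |x.1| ∨ R ≤ |x.2| →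
      ζ x = 0 ∧ partial₁ ζ x = 0 ∧ partial₂ ζ x = 0 := by
  obtain ⟨r, hr⟩ := (hζ.2.isCompact).isBounded.subset_closedBall 0
  refine ⟨max r 0 + 1, by positivity, fun x hx => ?_⟩
  have hx' : x ∉ tsupport ζ := by
    intro h
    have := hr h
    rw [mem_closedBall_zero_iff, Prod.norm_def, max_le_iff] at this
    have h2 := le_max_left r 0
    simp only [Real.norm_eq_abs] at this
    rcases hx with hx | hx <;> linarith [this.1, this.2]
  have hd : fderiv ℝ ζ x = 0 := by
    have := tsupport_fderiv_subset ℝ (f := ζ)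
    exact image_eq_zero_of_notMem_tsupport fun h => hx' (this h)
  exact ⟨image_eq_zero_of_notMem_tsupport hx', by simp [partial₁, hd], by simp [partial₂, hd]⟩

theorem contDiff_slice (hζ : IsTestFunction ζ) (y : ℝ) : ContDiff ℝ ∞ fun t => ζ (t, y) :=
  hζ.1.comp (contDiff_id.prodMk contDiff_const)

theorem hasCompactSupport_slice {E : Type*} [Zero E] {ζ : ℝ × ℝ → E} (hζ : HasCompactSupport ζ)
    (y : ℝ) : HasCompactSupport fun t => ζ (t, y) := by
  refine HasCompactSupport.intro (hζ.isCompact.image continuous_fst) fun t ht => ?_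
  refine image_eq_zero_of_notMem_tsupport fun h => ht ⟨(t, y), h, rfl⟩

theorem hasDerivAt_slice (hζ : IsTestFunction ζ) (t y : ℝ) :
    HasDerivAt (fun t => ζ (t, y)) (partial₁ ζ (t, y)) t :=
  (hζ.differentiable (t, y)).hasFDerivAt.comp_hasDerivAt t
    ((hasDerivAt_id t).prodMk (hasDerivAt_const t y))

theorem hasDerivAt_slice' (hζ : IsTestFunction ζ) (t y : ℝ) :
    HasDerivAt (fun y => ζ (t, y)) (partial₂ ζ (t, y)) y :=
  (hζ.differentiable (t, y)).hasFDerivAt.comp_hasDerivAt y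
    ((hasDerivAt_const y t).prodMk (hasDerivAt_id y))

end IsTestFunction

/-- The space of test functions. -/
def testSpace : Submodule ℝ (ℝ × ℝ → ℝ) where
  carrier := {ζ | IsTestFunction ζ}
  add_mem' h h' := h.add h'
  zero_mem' := IsTestFunction.zero
  smul_mem' c _ h := h.const_mul c

/-! ### The Dirichlet form and the source term -/

/-- The Dirichlet form on the half-plane. -/
noncomputable def dirichletForm (ζ η : ℝ × ℝ → ℝ) : ℝ :=
  ∫ x in halfPlane, (partial₁ ζ x * partial₁ η x + partial₂ ζ x * partial₂ η x)

/-- The work `∫ f' ζ(·, 0)` of the magnetic charge `f'` against `ζ`. -/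
noncomputable def sourceTerm (f : ℝ → ℝ) (ζ : ℝ × ℝ → ℝ) : ℝ := ∫ t, deriv f t * ζ (t, 0)

/-- The gradient as a complex-valued function. -/
noncomputable def complexGrad (ζ : ℝ × ℝ → ℝ) (x : ℝ × ℝ) : ℂ := ⟨partial₁ ζ x, partial₂ ζ x⟩

theorem continuous_complex_mk {X : Type*} [TopologicalSpace X] {p q : X → ℝ} (hp : Continuous p)
    (hq : Continuous q) : Continuous fun x => (⟨p x, q x⟩ : ℂ) := by
  have : (fun x => (⟨p x, q x⟩ : ℂ)) = fun x => (p x : ℂ) + (q x : ℂ) * Complex.I := by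
    funext x; exact Complex.mk_eq_add_mul_I _ _
  rw [this]; fun_prop

theorem IsTestFunction.memLp_complexGrad {ζ : ℝ × ℝ → ℝ} (hζ : IsTestFunction ζ) :
    MemLp (complexGrad ζ) 2 (volume.restrict halfPlane) := by
  have hc : Continuous (complexGrad ζ) :=
    continuous_complex_mk hζ.continuous_partial₁ hζ.continuous_partial₂
  refine (hc.memLp_of_hasCompactSupport (μ := volume) ?_).restrict _
  obtain ⟨R, hR, h⟩ := hζ.exists_bound_support
  refine HasCompactSupport.intro (isCompact_closedBall 0 R) fun x hx => ?_
  rw [mem_closedBall_zero_iff, Prod.norm_def, max_le_iff, not_and_or] at hx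
  simp only [Real.norm_eq_abs, not_le] at hx
  have := h x (hx.imp le_of_lt le_of_lt)
  simp [complexGrad, this.2.1, this.2.2, Complex.ext_iff]

theorem MemLp.complex_mk {X : Type*} [MeasurableSpace X] {μ : Measure X} {p q : X → ℝ}
    (hp : MemLp p 2 μ) (hq : MemLp q 2 μ) : MemLp (fun x => (⟨p x, q x⟩ : ℂ)) 2 μ := by
  have : (fun x => (⟨p x, q x⟩ : ℂ)) = fun x => (p x : ℂ) + (q x : ℂ) * Complex.I := by
    funext x; exact Complex.mk_eq_add_mul_I _ _
  rw [this]
  have h1 : MemLp (fun x => (p x : ℂ)) 2 μ := hp.ofReal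
  have h2 : MemLp (fun x => (q x : ℂ)) 2 μ := hq.ofReal
  have h3 : MemLp (fun x => (q x : ℂ) * Complex.I) 2 μ := by
    simp_rw [mul_comm _ Complex.I]
    exact h2.const_mul Complex.I
  exact h1.add h3

theorem complexGrad_add {ζ η : ℝ × ℝ → ℝ} (hζ : IsTestFunction ζ) (hη : IsTestFunction η) :
    complexGrad (fun x => ζ x + η x) = complexGrad ζ + complexGrad η :=
  funext fun x => Complex.ext (hζ.partial₁_add hη x) (hζ.partial₂_add hη x)

theorem complexGrad_const_mul {ζ : ℝ × ℝ → ℝ} (hζ : IsTestFunction ζ) (c : ℝ) :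
    complexGrad (fun x => c * ζ x) = c • complexGrad ζ := by
  funext x
  refine Complex.ext ((hζ.partial₁_const_mul c x).trans ?_) ((hζ.partial₂_const_mul c x).trans ?_)
  · rw [Pi.smul_apply, Complex.real_smul, Complex.re_ofReal_mul]; rfl
  · rw [Pi.smul_apply, Complex.real_smul, Complex.im_ofReal_mul]; rfl

/-- The gradient as a linear map into `L²` of the half-plane. -/
noncomputable def gradLp : testSpace →ₗ[ℝ] Lp ℂ 2 (volume.restrict halfPlane) where
  toFun ζ := MemLp.toLp (complexGrad ζ) (IsTestFunction.memLp_complexGrad ζ.2)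
  map_add' ζ η := by
    have h := complexGrad_add ζ.2 η.2
    have h2 := (IsTestFunction.memLp_complexGrad ζ.2).add (IsTestFunction.memLp_complexGrad η.2)
    rw [← MemLp.toLp_add (IsTestFunction.memLp_complexGrad ζ.2)
      (IsTestFunction.memLp_complexGrad η.2)]
    exact MemLp.toLp_congr _ h2 (Eventually.of_forall (congrFun h))
  map_smul' c ζ := by
    have h := complexGrad_const_mul ζ.2 c
    have h2 := (IsTestFunction.memLp_complexGrad ζ.2).const_smul c
    rw [RingHom.id_apply, ← MemLp.toLp_const_smul c (IsTestFunction.memLp_complexGrad ζ.2)]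
    exact MemLp.toLp_congr _ h2 (Eventually.of_forall (congrFun h))

theorem inner_eq_integral {v w : Lp ℂ 2 (volume.restrict halfPlane)} {p q r s : ℝ × ℝ → ℝ}
    (hv : v =ᵐ[volume.restrict halfPlane] fun x => ⟨p x, q x⟩)
    (hw : w =ᵐ[volume.restrict halfPlane] fun x => ⟨r x, s x⟩) :
    inner ℝ v w = ∫ x in halfPlane, (p x * r x + q x * s x) := by
  rw [L2.inner_def]
  refine integral_congr_ae ?_
  filter_upwards [hv, hw] with x h1 h2
  rw [h1, h2, Complex.inner]
  simp
  ring

theorem gradLp_ae (ζ : testSpace) :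
    gradLp ζ =ᵐ[volume.restrict halfPlane] fun x => ⟨partial₁ ζ x, partial₂ ζ x⟩ :=
  MemLp.coeFn_toLp (IsTestFunction.memLp_complexGrad ζ.2)

theorem inner_gradLp (ζ η : testSpace) : inner ℝ (gradLp ζ) (gradLp η) = dirichletForm ζ η :=
  inner_eq_integral (gradLp_ae ζ) (gradLp_ae η)

theorem norm_sq_gradLp (ζ : testSpace) : ‖gradLp ζ‖ ^ 2 = dirichletForm ζ ζ := by
  rw [← inner_gradLp, real_inner_self_eq_norm_sq]

theorem dirichletForm_self_nonneg (ζ : ℝ × ℝ → ℝ) : 0 ≤ dirichletForm ζ ζ :=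
  integral_nonneg fun _ => add_nonneg (mul_self_nonneg _) (mul_self_nonneg _)

theorem integrable_source {f : ℝ → ℝ} (hf : LocallyIntegrable (deriv f)) {ζ : ℝ × ℝ → ℝ}
    (hζ : IsTestFunction ζ) : Integrable fun t => deriv f t * ζ (t, 0) := by
  have := hf.integrable_smul_right_of_hasCompactSupport (g := fun t => ζ (t, 0))
    (hζ.contDiff_slice 0).continuous (IsTestFunction.hasCompactSupport_slice hζ.2 0)
  simpa [mul_comm] using this

/-- The source term as a linear functional. -/
noncomputable def sourceLin {f : ℝ → ℝ} (hf : LocallyIntegrable (deriv f)) : testSpace →ₗ[ℝ] ℝ where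
  toFun ζ := sourceTerm f ζ
  map_add' ζ η := by
    rw [sourceTerm, sourceTerm, sourceTerm, ← integral_add (integrable_source hf ζ.2)
      (integrable_source hf η.2)]
    refine integral_congr_ae (Eventually.of_forall fun t => ?_)
    exact mul_add _ _ _
  map_smul' c ζ := by
    rw [sourceTerm, sourceTerm, RingHom.id_apply, smul_eq_mul, ← integral_const_mul]
    refine integral_congr_ae (Eventually.of_forall fun t => ?_)
    exact mul_left_comm _ _ _

/-! ### The stray field: existence and the dual variational principle -/

theorem lintegral_norm_sq {v : Lp ℂ 2 (volume.restrict halfPlane)} {p q : ℝ × ℝ → ℝ}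
    (hv : v =ᵐ[volume.restrict halfPlane] fun x => ⟨p x, q x⟩) :
    ∫⁻ x in halfPlane, ENNReal.ofReal (p x ^ 2 + q x ^ 2) = ENNReal.ofReal (‖v‖ ^ 2) := by
  have h := real_inner_self_eq_norm_sq v
  rw [inner_eq_integral hv hv] at h
  have h2 : Integrable (fun x => p x * p x + q x * q x) (volume.restrict halfPlane) := by
    have h3 := L2.integrable_inner (𝕜 := ℝ) v v
    refine h3.congr ?_
    filter_upwards [hv] with x hx
    rw [hx, Complex.inner]; simp
  rw [← h, ofReal_integral_eq_lintegral_ofReal h2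
    (Eventually.of_forall fun _ => add_nonneg (mul_self_nonneg _) (mul_self_nonneg _))]
  simp only [sq]

/-- A bounded source has a stray field. -/
theorem exists_isStrayField {f : ℝ → ℝ} (hf : LocallyIntegrable (deriv f)) {C : ℝ} (hC : 0 ≤ C)
    (h : ∀ ζ, IsTestFunction ζ → 2 * sourceTerm f ζ ≤ C + dirichletForm ζ ζ) :
    ∃ p q, IsStrayField f p q ∧
      ∫⁻ x in halfPlane, ENNReal.ofReal (p x ^ 2 + q x ^ 2) ≤ ENNReal.ofReal C := by
  obtain ⟨v, hv, hl, hn⟩ := exists_riesz_closure gradLp (sourceLin hf) hC (fun z => by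
    rw [norm_sq_gradLp]; exact h z z.2)
  have hvae : v =ᵐ[volume.restrict halfPlane] fun x => ⟨(v x).re, (v x).im⟩ :=
    Eventually.of_forall fun x => rfl
  refine ⟨fun x => (v x).re, fun x => (v x).im, ⟨⟨(Lp.memLp v).re, (Lp.memLp v).im, ?_⟩, ?_⟩, ?_⟩
  · intro ε hε
    obtain ⟨_, ⟨ζ, rfl⟩, hζ⟩ := Metric.mem_closure_iff.1 hv (√ε) (by positivity)
    refine ⟨ζ, ζ.2, ?_⟩
    have hsub : ((v - gradLp ζ : Lp ℂ 2 (volume.restrict halfPlane)) : ℝ × ℝ → ℂ)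
        =ᵐ[volume.restrict halfPlane]
        fun x => ⟨(v x).re - partial₁ ζ x, (v x).im - partial₂ ζ x⟩ := by
      filter_upwards [Lp.coeFn_sub v (gradLp ζ), gradLp_ae ζ] with x h1 h2
      rw [h1, Pi.sub_apply, h2]; rfl
    rw [lintegral_norm_sq hsub]
    refine (ENNReal.ofReal_lt_ofReal_iff hε).2 ?_
    rw [dist_eq_norm] at hζ
    calc ‖v - gradLp ζ‖ ^ 2 < √ε ^ 2 := by gcongr
      _ = ε := Real.sq_sqrt hε.le
  · intro ζ hζ
    have := hl ⟨ζ, hζ⟩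
    rw [inner_eq_integral hvae (gradLp_ae ⟨ζ, hζ⟩)] at this
    exact this.symm
  · rw [lintegral_norm_sq hvae]
    exact ENNReal.ofReal_le_ofReal hn

/-- This is `0 ≤ ‖∇u - ∇ζ‖²` with the square expanded and the weak equation inserted. -/
theorem IsStrayField.le_lintegral {f : ℝ → ℝ} {p q : ℝ × ℝ → ℝ} (h : IsStrayField f p q)
    {ζ : ℝ × ℝ → ℝ} (hζ : IsTestFunction ζ) :
    ENNReal.ofReal (2 * sourceTerm f ζ - dirichletForm ζ ζ) ≤
      ∫⁻ x in halfPlane, ENNReal.ofReal (p x ^ 2 + q x ^ 2) := by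
  have hm := MemLp.complex_mk h.1.memLp₁ h.1.memLp₂
  have hvae := hm.coeFn_toLp
  rw [lintegral_norm_sq hvae]
  refine ENNReal.ofReal_le_ofReal ?_
  have h1 := h.2 ζ hζ
  rw [← inner_eq_integral hvae (gradLp_ae ⟨ζ, hζ⟩)] at h1
  have h2 := norm_sub_sq_real hm.toLp (gradLp ⟨ζ, hζ⟩)
  rw [h1, norm_sq_gradLp] at h2
  have h3 := sq_nonneg ‖hm.toLp - gradLp ⟨ζ, hζ⟩‖
  change _ = _ - 2 * sourceTerm f ζ + dirichletForm ζ ζ at h2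
  linarith

theorem ofReal_le_strayFieldDirichlet (f : ℝ → ℝ) {ζ : ℝ × ℝ → ℝ} (hζ : IsTestFunction ζ) :
    ENNReal.ofReal (2 * sourceTerm f ζ - dirichletForm ζ ζ) ≤ strayFieldDirichlet f :=
  le_iInf fun _ => le_iInf fun _ => le_iInf fun h => h.le_lintegral hζ

/-- Upper bounds for the stray field energy, including its finiteness, reduce to an inequality
against test functions. -/
theorem strayFieldDirichlet_le {f : ℝ → ℝ} (hf : LocallyIntegrable (deriv f)) {C : ℝ} (hC : 0 ≤ C)
    (h : ∀ ζ, IsTestFunction ζ → 2 * sourceTerm f ζ ≤ C + dirichletForm ζ ζ) :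
    strayFieldDirichlet f ≤ ENNReal.ofReal C := by
  obtain ⟨p, q, h1, h2⟩ := exists_isStrayField hf hC h
  exact (iInf₂_le_of_le p q (iInf_le _ h1)).trans h2

/-- The dual variational principle for the stray field energy. -/
theorem strayFieldDirichlet_eq_iSup {f : ℝ → ℝ} (hf : LocallyIntegrable (deriv f)) :
    strayFieldDirichlet f =
      ⨆ ζ : testSpace, ENNReal.ofReal (2 * sourceTerm f ζ - dirichletForm ζ ζ) := by
  refine le_antisymm ?_ (iSup_le fun ζ => ofReal_le_strayFieldDirichlet f ζ.2)
  by_cases hS : (⨆ ζ : testSpace, ENNReal.ofReal (2 * sourceTerm f ζ - dirichletForm ζ ζ)) = ⊤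
  · rw [hS]; exact le_top
  rw [← ENNReal.ofReal_toReal hS]
  refine strayFieldDirichlet_le hf ENNReal.toReal_nonneg fun ζ hζ => ?_
  have := le_iSup (fun ζ : testSpace =>
    ENNReal.ofReal (2 * sourceTerm f ζ - dirichletForm ζ ζ)) ⟨ζ, hζ⟩
  have h2 := (ENNReal.ofReal_le_iff_le_toReal hS).1 this
  simp only at h2
  linarith

theorem exists_seq_tendsto_strayFieldDirichlet {f : ℝ → ℝ} (hf : LocallyIntegrable (deriv f)) :
    ∃ ζ : ℕ → ℝ × ℝ → ℝ, (∀ n, IsTestFunction (ζ n)) ∧ Tendsto (fun n => ENNReal.ofReal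
      (2 * sourceTerm f (ζ n) - dirichletForm (ζ n) (ζ n))) atTop (𝓝 (strayFieldDirichlet f)) := by
  rw [strayFieldDirichlet_eq_iSup hf]
  obtain ⟨u, -, hu, hmem⟩ := exists_seq_tendsto_sSup (Set.range_nonempty fun ζ : testSpace =>
    ENNReal.ofReal (2 * sourceTerm f ζ - dirichletForm ζ ζ)) (OrderTop.bddAbove _)
  choose ζ hζ using hmem
  refine ⟨fun n => ζ n, fun n => (ζ n).2, ?_⟩
  simp only at hζ
  simp_rw [hζ]
  exact hu

/-- A source of finite energy is approximated by the gradients of test functions. -/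
theorem exists_approx_potential {f : ℝ → ℝ} (hf : LocallyIntegrable (deriv f)) {C : ℝ} (hC : 0 ≤ C)
    (h : strayFieldDirichlet f ≤ ENNReal.ofReal C) {ε : ℝ} (hε : 0 < ε) :
    ∃ η, IsTestFunction η ∧ dirichletForm η η ≤ (√C + ε) ^ 2 ∧ ∀ ζ, IsTestFunction ζ →
      |sourceTerm f ζ - dirichletForm η ζ| ≤ ε * √(dirichletForm ζ ζ) := by
  obtain ⟨v, hv, hl, hn⟩ := exists_riesz_closure gradLp (sourceLin hf) hC (fun z => by
    rw [norm_sq_gradLp]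
    have := (ENNReal.ofReal_le_ofReal_iff hC).1 ((ofReal_le_strayFieldDirichlet f z.2).trans h)
    change 2 * sourceTerm f z ≤ _
    linarith)
  obtain ⟨_, ⟨η, rfl⟩, hη⟩ := Metric.mem_closure_iff.1 hv ε hε
  refine ⟨η, η.2, ?_, fun ζ hζ => ?_⟩
  · rw [← norm_sq_gradLp]
    have h1 : ‖v‖ ≤ √C := Real.le_sqrt_of_sq_le hn
    have h2 : ‖gradLp η‖ ≤ ‖v‖ + ‖v - gradLp η‖ := by
      have := norm_sub_le v (v - gradLp η)
      simpa using this
    rw [dist_eq_norm] at hη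
    have : ‖gradLp η‖ ≤ √C + ε := by linarith
    gcongr
  · have h1 : sourceTerm f ζ - dirichletForm η ζ = inner ℝ (v - gradLp η) (gradLp ⟨ζ, hζ⟩) := by
      rw [inner_sub_left, inner_gradLp, ← hl]; rfl
    have h2 : √(dirichletForm ζ ζ) = ‖gradLp ⟨ζ, hζ⟩‖ := by
      rw [← norm_sq_gradLp ⟨ζ, hζ⟩, Real.sqrt_sq (norm_nonneg _)]
    rw [h1, h2]
    refine (abs_real_inner_le_norm _ _).trans ?_
    rw [dist_eq_norm] at hη
    gcongr

theorem abs_dirichletForm_le {ζ η : ℝ × ℝ → ℝ} (hζ : IsTestFunction ζ) (hη : IsTestFunction η) :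
    |dirichletForm ζ η| ≤ √(dirichletForm ζ ζ) * √(dirichletForm η η) := by
  rw [← norm_sq_gradLp ⟨ζ, hζ⟩, ← norm_sq_gradLp ⟨η, hη⟩, Real.sqrt_sq (norm_nonneg _),
    Real.sqrt_sq (norm_nonneg _)]
  exact (inner_gradLp ⟨ζ, hζ⟩ ⟨η, hη⟩) ▸ abs_real_inner_le_norm _ _

theorem dirichletForm_add_add {ζ η : ℝ × ℝ → ℝ} (hζ : IsTestFunction ζ) (hη : IsTestFunction η) :
    dirichletForm (fun x => ζ x + η x) (fun x => ζ x + η x) =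
      dirichletForm ζ ζ + 2 * dirichletForm ζ η + dirichletForm η η := by
  have := norm_add_sq_real (gradLp ⟨ζ, hζ⟩) (gradLp ⟨η, hη⟩)
  rwa [← map_add, norm_sq_gradLp, norm_sq_gradLp, norm_sq_gradLp, inner_gradLp] at this

theorem dirichletForm_add_left {ζ η ξ : ℝ × ℝ → ℝ} (hζ : IsTestFunction ζ) (hη : IsTestFunction η)
    (hξ : IsTestFunction ξ) : dirichletForm (fun x => ζ x + η x) ξ =
      dirichletForm ζ ξ + dirichletForm η ξ := by
  have := inner_add_left (𝕜 := ℝ) (gradLp ⟨ζ, hζ⟩) (gradLp ⟨η, hη⟩) (gradLp ⟨ξ, hξ⟩)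
  rwa [← map_add, inner_gradLp, inner_gradLp, inner_gradLp] at this

/-! ### Elementary properties of the stray field energy -/

theorem LocAC.of_contDiff {φ : ℝ → ℝ} (hφ : ContDiff ℝ 1 φ) : LocAC φ := fun _ _ =>
  hφ.contDiffOn.absolutelyContinuousOnInterval

/-- Integration by parts against a compactly supported function. -/
theorem LocAC.integral_deriv_mul {f : ℝ → ℝ} (hf : LocAC f) {φ : ℝ → ℝ} (hφ : ContDiff ℝ 1 φ)
    (hs : HasCompactSupport φ) : ∫ t, deriv f t * φ t = - ∫ t, f t * deriv φ t := by
  obtain ⟨r, hr⟩ := hs.isCompact.isBounded.subset_closedBall 0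
  have hz : ∀ t, t ∉ Set.Ioc (-(|r| + 1)) (|r| + 1) → φ t = 0 ∧ deriv φ t = 0 := by
    intro t ht
    have ht' : t ∉ tsupport φ := by
      intro h
      have := hr h
      rw [mem_closedBall_zero_iff, Real.norm_eq_abs] at this
      have h2 := abs_le.1 (this.trans (le_abs_self r))
      exact ht ⟨by linarith [h2.1], by linarith [h2.2]⟩
    refine ⟨image_eq_zero_of_notMem_tsupport ht', ?_⟩
    by_contra h
    exact ht' (support_deriv_subset h)
  have h1 : ∫ t, deriv f t * φ t = ∫ t in (-(|r| + 1))..(|r| + 1), deriv f t * φ t := by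
    rw [intervalIntegral.integral_of_le (by linarith [abs_nonneg r]),
      setIntegral_eq_integral_of_forall_compl_eq_zero]
    intro t ht; rw [(hz t ht).1, mul_zero]
  have h2 : ∫ t, f t * deriv φ t = ∫ t in (-(|r| + 1))..(|r| + 1), f t * deriv φ t := by
    rw [intervalIntegral.integral_of_le (by linarith [abs_nonneg r]),
      setIntegral_eq_integral_of_forall_compl_eq_zero]
    intro t ht; rw [(hz t ht).2, mul_zero]
  have h3 := (hf (-(|r| + 1)) (|r| + 1)).integral_mul_deriv_eq_deriv_mul
    (LocAC.of_contDiff hφ (-(|r| + 1)) (|r| + 1))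
  rw [(hz (-(|r| + 1)) (by simp)).1] at h3
  have h4 : φ (|r| + 1) = 0 := by
    refine image_eq_zero_of_notMem_tsupport fun h => ?_
    have := hr h
    rw [mem_closedBall_zero_iff, Real.norm_eq_abs, abs_of_nonneg (by positivity)] at this
    linarith [le_abs_self r]
  rw [h4] at h3
  rw [h1, h2, h3]; ring

theorem IsTestFunction.deriv_trace {ζ : ℝ × ℝ → ℝ} (hζ : IsTestFunction ζ) (y : ℝ) :
    deriv (fun t => ζ (t, y)) = fun t => partial₁ ζ (t, y) :=
  funext fun t => (hζ.hasDerivAt_slice t y).deriv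

theorem sourceTerm_eq {f : ℝ → ℝ} (hf : LocAC f) {ζ : ℝ × ℝ → ℝ} (hζ : IsTestFunction ζ) :
    sourceTerm f ζ = - ∫ t, f t * partial₁ ζ (t, 0) := by
  rw [sourceTerm, hf.integral_deriv_mul ((hζ.contDiff_slice 0).of_le (by simp))
    (IsTestFunction.hasCompactSupport_slice hζ.2 0), hζ.deriv_trace]

/-- Horizontal translation of a function in the plane. -/
def hshift (τ : ℝ) (ζ : ℝ × ℝ → ℝ) (x : ℝ × ℝ) : ℝ := ζ (x.1 - τ, x.2)

theorem IsTestFunction.hshift {ζ : ℝ × ℝ → ℝ} (hζ : IsTestFunction ζ) (τ : ℝ) :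
    IsTestFunction (hshift τ ζ) := by
  refine ⟨hζ.1.comp ((contDiff_fst.sub contDiff_const).prodMk contDiff_snd), ?_⟩
  obtain ⟨R, hR, h⟩ := hζ.exists_bound_support
  refine HasCompactSupport.intro (K := Set.Icc (τ - R) (τ + R) ×ˢ Set.Icc (-R) R)
    (isCompact_Icc.prod isCompact_Icc) fun x hx => ?_
  refine (h (x.1 - τ, x.2) ?_).1
  by_contra hcon
  push Not at hcon
  refine hx ⟨⟨?_, ?_⟩, ⟨?_, ?_⟩⟩ <;> have h1 := abs_lt.1 hcon.1 <;> have h2 := abs_lt.1 hcon.2 <;>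
    simp only at h1 h2 <;> linarith [h1.1, h1.2, h2.1, h2.2]

theorem fderiv_hshift (τ : ℝ) (ζ : ℝ × ℝ → ℝ) (x : ℝ × ℝ) :
    fderiv ℝ (hshift τ ζ) x = fderiv ℝ ζ (x.1 - τ, x.2) := by
  have : hshift τ ζ = fun x => ζ (x + (-τ, 0)) := by
    funext x; simp [hshift, Prod.add_def, sub_eq_add_neg]
  rw [this, fderiv_comp_add_right]
  simp [Prod.add_def, sub_eq_add_neg]

theorem partial₁_hshift (τ : ℝ) (ζ : ℝ × ℝ → ℝ) (x : ℝ × ℝ) :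
    partial₁ (hshift τ ζ) x = partial₁ ζ (x.1 - τ, x.2) := by
  rw [partial₁, fderiv_hshift]; rfl

theorem partial₂_hshift (τ : ℝ) (ζ : ℝ × ℝ → ℝ) (x : ℝ × ℝ) :
    partial₂ (hshift τ ζ) x = partial₂ ζ (x.1 - τ, x.2) := by
  rw [partial₂, fderiv_hshift]; rfl

theorem setIntegral_halfPlane_comp_sub (F : ℝ × ℝ → ℝ) (τ : ℝ) :
    ∫ x in halfPlane, F (x.1 - τ, x.2) = ∫ x in halfPlane, F x := by
  have h := (measurePreserving_sub_right (volume : Measure (ℝ × ℝ)) (τ, 0)).setIntegral_preimage_emb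
    (MeasurableEquiv.subRight ((τ, 0) : ℝ × ℝ)).measurableEmbedding F halfPlane
  have h2 : (fun x : ℝ × ℝ => x - (τ, 0)) ⁻¹' halfPlane = halfPlane := by
    ext x; simp [halfPlane]
  rw [h2] at h
  rw [← h]
  simp [Prod.sub_def]

theorem dirichletForm_hshift (τ : ℝ) (ζ η : ℝ × ℝ → ℝ) :
    dirichletForm (hshift τ ζ) (hshift τ η) = dirichletForm ζ η := by
  simp only [dirichletForm, partial₁_hshift, partial₂_hshift]
  exact setIntegral_halfPlane_comp_sub
    (fun x => partial₁ ζ x * partial₁ η x + partial₂ ζ x * partial₂ η x) τ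

theorem sourceTerm_hshift (τ : ℝ) (f : ℝ → ℝ) (ζ : ℝ × ℝ → ℝ) :
    sourceTerm f (hshift τ ζ) = sourceTerm (fun t => f (t + τ)) ζ := by
  simp only [sourceTerm, hshift, deriv_comp_add_const]
  rw [← integral_add_right_eq_self _ τ]
  simp

theorem hshift_hshift (σ τ : ℝ) (ζ : ℝ × ℝ → ℝ) : hshift σ (hshift τ ζ) = hshift (σ + τ) ζ := by
  funext x; simp [hshift, sub_sub]

theorem hshift_zero (ζ : ℝ × ℝ → ℝ) : hshift 0 ζ = ζ := by
  funext x; simp [hshift]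

theorem LocAC.comp_add_const {E : Type*} [NormedAddCommGroup E] {f : ℝ → E} (hf : LocAC f) (τ : ℝ) :
    LocAC (fun t => f (t + τ)) := by
  intro a b
  rw [absolutelyContinuousOnInterval_iff]
  intro ε hε
  obtain ⟨δ, hδ, h⟩ := (absolutelyContinuousOnInterval_iff _ _ _).1 (hf (a + τ) (b + τ)) ε hε
  refine ⟨δ, hδ, fun I hI hs => ?_⟩
  have := h (I.1, fun i => ((I.2 i).1 + τ, (I.2 i).2 + τ)) ?_ (by simpa using hs)
  · exact this
  · obtain ⟨h1, h2⟩ := hI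
    have him : ∀ u v : ℝ, Set.uIoc (u + τ) (v + τ) = (fun t => t + τ) '' Set.uIoc u v := by
      intro u v
      simp [Set.uIoc, min_add_add_right, max_add_add_right]
    refine ⟨fun i hi => ?_, fun i hi j hj hij => ?_⟩
    · obtain ⟨h3, h4⟩ := h1 i hi
      rw [Set.mem_uIcc] at h3 h4
      exact ⟨Set.mem_uIcc.2 (by simpa using h3), Set.mem_uIcc.2 (by simpa using h4)⟩
    · have := h2 hi hj hij
      simp only [Function.onFun, him]
      exact (Set.disjoint_image_iff (add_left_injective τ)).2 this

theorem strayFieldDirichlet_comp_add {f : ℝ → ℝ} (hf : LocAC f) (τ : ℝ) :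
    strayFieldDirichlet (fun t => f (t + τ)) = strayFieldDirichlet f := by
  have key : ∀ {f : ℝ → ℝ} (_ : LocAC f) (τ : ℝ),
      strayFieldDirichlet (fun t => f (t + τ)) ≤ strayFieldDirichlet f := by
    intro f hf τ
    rw [strayFieldDirichlet_eq_iSup (hf.comp_add_const τ).locallyIntegrable_deriv]
    refine iSup_le fun ζ => ?_
    rw [← sourceTerm_hshift, ← dirichletForm_hshift τ]
    exact ofReal_le_strayFieldDirichlet f (IsTestFunction.hshift ζ.2 τ)
  refine le_antisymm (key hf τ) ?_
  have := key (hf.comp_add_const τ) (-τ)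
  simpa using this

/-- Replacing `ζ` by `-ζ` leaves the dual functional unchanged. -/
theorem strayFieldDirichlet_neg_le {f : ℝ → ℝ} (hf : LocAC f) :
    strayFieldDirichlet (fun t => - f t) ≤ strayFieldDirichlet f := by
  rw [strayFieldDirichlet_eq_iSup hf.neg.locallyIntegrable_deriv]
  refine iSup_le fun ζ => ?_
  have h := ofReal_le_strayFieldDirichlet f (IsTestFunction.const_mul ζ.2 (-1))
  have h1 : sourceTerm f (fun x => -1 * (ζ : ℝ × ℝ → ℝ) x) = sourceTerm (fun t => - f t) ζ := by
    rw [sourceTerm, sourceTerm]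
    refine integral_congr_ae (Eventually.of_forall fun t => ?_)
    have : deriv (fun t => - f t) t = - deriv f t := deriv.neg
    simp only [this]; ring
  have h2 : dirichletForm (fun x => -1 * (ζ : ℝ × ℝ → ℝ) x) (fun x => -1 * (ζ : ℝ × ℝ → ℝ) x) =
      dirichletForm ζ ζ := by
    simp only [dirichletForm, IsTestFunction.partial₁_const_mul ζ.2,
      IsTestFunction.partial₂_const_mul ζ.2]
    congr 1; funext x; ring
  rwa [h1, h2] at h

theorem abs_sourceTerm_le {f : ℝ → ℝ} (hf : LocallyIntegrable (deriv f)) {C : ℝ} (hC : 0 ≤ C)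
    (h : strayFieldDirichlet f ≤ ENNReal.ofReal C) {ζ : ℝ × ℝ → ℝ} (hζ : IsTestFunction ζ) :
    |sourceTerm f ζ| ≤ √C * √(dirichletForm ζ ζ) := by
  have h2 := abs_le_of_two_mul_le gradLp (sourceLin hf) hC (fun z => by
    rw [norm_sq_gradLp]
    have := (ENNReal.ofReal_le_ofReal_iff hC).1 ((ofReal_le_strayFieldDirichlet f z.2).trans h)
    change 2 * sourceTerm f z ≤ _
    linarith) ⟨ζ, hζ⟩
  rw [← norm_sq_gradLp ⟨ζ, hζ⟩, Real.sqrt_sq (norm_nonneg _)]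
  exact h2

/-- Since `2Ks ≤ K² + s²` with `s² = ∫|∇ζ|²`, a dual-norm bound is enough; `abs_sourceTerm_le` is
the converse. -/
theorem strayFieldDirichlet_le_of_abs_le {f : ℝ → ℝ} (hf : LocallyIntegrable (deriv f)) {K : ℝ}
    (h : ∀ ζ, IsTestFunction ζ → sourceTerm f ζ ≤ K * √(dirichletForm ζ ζ)) :
    strayFieldDirichlet f ≤ ENNReal.ofReal (K ^ 2) := by
  refine strayFieldDirichlet_le hf (sq_nonneg _) fun ζ hζ => ?_
  have h1 := h ζ hζ
  have h2 := Real.sq_sqrt (dirichletForm_self_nonneg ζ)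
  nlinarith [sq_nonneg (K - √(dirichletForm ζ ζ))]

/-- Test functions with horizontally distant supports are orthogonal. -/
theorem exists_dist_dirichletForm_eq_zero {ζ η : ℝ × ℝ → ℝ} (hζ : IsTestFunction ζ)
    (hη : IsTestFunction η) : ∃ R : ℝ, ∀ σ τ : ℝ, R ≤ |σ - τ| →
      dirichletForm (hshift σ ζ) (hshift τ η) = 0 := by
  obtain ⟨R, hR, h⟩ := hζ.exists_bound_support
  obtain ⟨S, hS, h'⟩ := hη.exists_bound_support
  refine ⟨R + S, fun σ τ hστ => ?_⟩
  rw [dirichletForm, integral_eq_zero_of_ae]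
  refine Eventually.of_forall fun x => ?_
  simp only [partial₁_hshift, partial₂_hshift, Pi.zero_apply]
  rcases le_total R |x.1 - σ| with hx | hx
  · have := h (x.1 - σ, x.2) (Or.inl hx)
    rw [this.2.1, this.2.2]; ring
  · have := h' (x.1 - τ, x.2) (Or.inl ?_)
    · rw [this.2.1, this.2.2]; ring
    · have h3 : |σ - τ| ≤ |x.1 - σ| + |x.1 - τ| := by
        have := abs_sub (x.1 - τ) (x.1 - σ)
        rw [show x.1 - τ - (x.1 - σ) = σ - τ by ring] at this
        linarith
      simp only; linarith

theorem sourceTerm_add {f : ℝ → ℝ} (hf : LocallyIntegrable (deriv f)) {ζ η : ℝ × ℝ → ℝ}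
    (hζ : IsTestFunction ζ) (hη : IsTestFunction η) :
    sourceTerm f (fun x => ζ x + η x) = sourceTerm f ζ + sourceTerm f η :=
  (sourceLin hf).map_add ⟨ζ, hζ⟩ ⟨η, hη⟩

/-- Stray field energy of a superposition of two distant profiles, up to a small error. -/
theorem exists_strayFieldDirichlet_superposition_le {f₁ f₂ : ℝ → ℝ} (hf₁ : LocAC f₁)
    (hf₂ : LocAC f₂) {C₁ C₂ : ℝ} (hC₁ : 0 ≤ C₁) (hC₂ : 0 ≤ C₂)
    (h₁ : strayFieldDirichlet f₁ ≤ ENNReal.ofReal C₁)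
    (h₂ : strayFieldDirichlet f₂ ≤ ENNReal.ofReal C₂) {δ : ℝ} (hδ : 0 < δ) :
    ∃ ε > 0, ∃ T₀ : ℝ, ∀ T ≥ T₀, ∀ (F e : ℝ → ℝ) (c : ℝ), LocAC F → LocAC e →
      (∀ t, F t = f₁ (t + T) + f₂ (t + -T) - c - e t) →
      strayFieldDirichlet e ≤ ENNReal.ofReal (ε ^ 2) →
      strayFieldDirichlet F ≤ ENNReal.ofReal (C₁ + C₂ + δ) := by
  -- At `ε = 0` the left side equals `C₁ + C₂`, so continuity provides `ε`. The term `3 * ε` pays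
  -- for the two approximate potentials and for the remainder `e`.
  obtain ⟨ε, hε, hεδ⟩ : ∃ ε > 0, (√((√C₁ + ε) ^ 2 + (√C₂ + ε) ^ 2) + 3 * ε) ^ 2 ≤ C₁ + C₂ + δ := by
    have hcont : Continuous fun ε : ℝ => (√((√C₁ + ε) ^ 2 + (√C₂ + ε) ^ 2) + 3 * ε) ^ 2 := by
      fun_prop
    have h0 := hcont.tendsto 0
    simp only [add_zero, mul_zero, Real.sq_sqrt hC₁, Real.sq_sqrt hC₂,
      Real.sq_sqrt (add_nonneg hC₁ hC₂)] at h0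
    have h1 := h0.eventually (ge_mem_nhds (show C₁ + C₂ < C₁ + C₂ + δ by linarith))
    have h2 := (h1.filter_mono nhdsWithin_le_nhds).and
      (self_mem_nhdsWithin : Set.Ioi (0 : ℝ) ∈ 𝓝[>] 0)
    obtain ⟨ε, hε1, hε2⟩ := h2.exists
    exact ⟨ε, hε2, hε1⟩
  obtain ⟨η₁, hη₁, hd₁, ha₁⟩ := exists_approx_potential hf₁.locallyIntegrable_deriv hC₁ h₁ hε
  obtain ⟨η₂, hη₂, hd₂, ha₂⟩ := exists_approx_potential hf₂.locallyIntegrable_deriv hC₂ h₂ hε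
  -- Once translated far apart the two potentials are orthogonal, so the squares of their norms add.
  -- This gives `C₁ + C₂` instead of `(√C₁ + √C₂)²`.
  obtain ⟨R, hR⟩ := exists_dist_dirichletForm_eq_zero hη₁ hη₂
  refine ⟨ε, hε, |R|, fun T hT F e c hF he hFe hN => ?_⟩
  refine le_trans ?_ (ENNReal.ofReal_le_ofReal hεδ)
  refine strayFieldDirichlet_le_of_abs_le hF.locallyIntegrable_deriv fun ζ hζ => ?_
  have hg₁ := hη₁.hshift (-T)
  have hg₂ := hη₂.hshift (- -T)
  have hsum : sourceTerm F ζ = sourceTerm f₁ (hshift T ζ) + sourceTerm f₂ (hshift (-T) ζ) -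
      sourceTerm e ζ := by
    have i1 := integrable_source (hf₁.comp_add_const T).locallyIntegrable_deriv hζ
    have i2 := integrable_source (hf₂.comp_add_const (-T)).locallyIntegrable_deriv hζ
    have i3 := integrable_source he.locallyIntegrable_deriv hζ
    rw [sourceTerm_hshift, sourceTerm_hshift, sourceTerm, sourceTerm, sourceTerm, sourceTerm,
      ← integral_add i1 i2]
    have i12 : Integrable (fun t => deriv (fun t => f₁ (t + T)) t * ζ (t, 0) +
      deriv (fun t => f₂ (t + -T)) t * ζ (t, 0)) := i1.add i2
    rw [← integral_sub i12 i3]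
    refine integral_congr_ae ?_
    filter_upwards [(hf₁.comp_add_const T).ae_differentiableAt,
      (hf₂.comp_add_const (-T)).ae_differentiableAt, he.ae_differentiableAt] with t d1 d2 d3
    have := ((d1.hasDerivAt.add d2.hasDerivAt).sub_const c).sub d3.hasDerivAt
    rw [show F = fun t => f₁ (t + T) + f₂ (t + -T) - c - e t from funext hFe]
    refine (congrArg (· * ζ (t, 0)) this.deriv).trans ?_
    ring
  have hb₁ := ha₁ _ (hζ.hshift T)
  have hb₂ := ha₂ _ (hζ.hshift (-T))
  have hb₃ := abs_sourceTerm_le he.locallyIntegrable_deriv (sq_nonneg ε) hN hζ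
  rw [Real.sqrt_sq hε.le] at hb₃
  rw [dirichletForm_hshift] at hb₁ hb₂
  rw [← dirichletForm_hshift (-T), hshift_hshift, neg_add_cancel, hshift_zero] at hb₁
  rw [← dirichletForm_hshift (- -T), hshift_hshift, neg_add_cancel, hshift_zero] at hb₂
  -- Cauchy–Schwarz is applied once to the sum of the two translated potentials; applying it to each
  -- of them separately would lose the orthogonality.
  have hc := abs_dirichletForm_le (hg₁.add hg₂) hζ
  rw [dirichletForm_add_left hg₁ hg₂ hζ, dirichletForm_add_add hg₁ hg₂, dirichletForm_hshift,
    dirichletForm_hshift, hR _ _ ?_] at hc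
  · have hA : √(dirichletForm η₁ η₁ + 2 * 0 + dirichletForm η₂ η₂) ≤
        √((√C₁ + ε) ^ 2 + (√C₂ + ε) ^ 2) := Real.sqrt_le_sqrt (by linarith)
    have hA' := mul_le_mul_of_nonneg_right hA (Real.sqrt_nonneg (dirichletForm ζ ζ))
    have e1 := (abs_le.1 hb₁).2
    have e2 := (abs_le.1 hb₂).2
    have e3 := (abs_le.1 hb₃).1
    have e4 := (abs_le.1 hc).2
    rw [hsum]
    nlinarith
  · have h4 : 0 ≤ T := (abs_nonneg R).trans hT
    rw [show -T - - -T = -(2 * T) by ring, abs_neg, abs_of_nonneg (by linarith)]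
    linarith [le_abs_self R]

/-- The stray field energies of finitely many profiles that separate from one another are
recovered in the limit. -/
theorem sum_strayFieldDirichlet_le {ι : Type*} (J : Finset ι) {f : ℕ → ℝ → ℝ}
    (hf : ∀ n, LocAC (f n)) {M : ℝ} (hM : ∀ n t, |f n t| ≤ M) {x : ℕ → ι → ℝ}
    {μ : ι → ℝ → ℝ} (hμ : ∀ j ∈ J, LocAC (μ j))
    (hlim : ∀ j ∈ J, ∀ t, Tendsto (fun n => f n (t + x n j)) atTop (𝓝 (μ j t)))
    (hsep : ∀ i ∈ J, ∀ j ∈ J, i ≠ j → Tendsto (fun n => |x n i - x n j|) atTop atTop)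
    {N₀ : ℝ≥0∞} (hN : Tendsto (fun n => strayFieldDirichlet (f n)) atTop (𝓝 N₀)) :
    ∑ j ∈ J, strayFieldDirichlet (μ j) ≤ N₀ := by
  classical
  -- Integration by parts moves the derivative onto `ζ`, so pointwise convergence and the uniform
  -- bound `M` suffice for dominated convergence.
  have hsource : ∀ j ∈ J, ∀ ζ, IsTestFunction ζ →
      Tendsto (fun n => sourceTerm (f n) (hshift (x n j) ζ)) atTop (𝓝 (sourceTerm (μ j) ζ)) := by
    intro j hj ζ hζ
    simp_rw [sourceTerm_hshift]
    rw [sourceTerm_eq (hμ j hj) hζ]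
    simp_rw [sourceTerm_eq ((hf _).comp_add_const _) hζ]
    refine Tendsto.neg (tendsto_integral_of_dominated_convergence
      (fun t => M * |partial₁ ζ (t, 0)|) (fun n => ?_) ?_ (fun n => ?_) ?_)
    · exact (((hf n).comp_add_const _).continuous.mul (hζ.continuous_partial₁.comp
        (by fun_prop))).aestronglyMeasurable
    · refine Integrable.const_mul (Integrable.abs ?_) _
      exact (hζ.continuous_partial₁.comp (by fun_prop)).integrable_of_hasCompactSupport
        (IsTestFunction.hasCompactSupport_slice hζ.hasCompactSupport_partial₁ 0)
    · refine Eventually.of_forall fun t => ?_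
      rw [Real.norm_eq_abs, abs_mul]
      exact mul_le_mul_of_nonneg_right (hM _ _) (abs_nonneg _)
    · exact Eventually.of_forall fun t => (hlim j hj t).mul_const _
  have key : ∀ z : ι → testSpace, (∀ j ∈ J, 0 ≤ 2 * sourceTerm (μ j) (z j) -
      dirichletForm (z j) (z j)) → ∑ j ∈ J, ENNReal.ofReal (2 * sourceTerm (μ j) (z j) -
      dirichletForm (z j) (z j)) ≤ N₀ := by
    intro z hz
    rw [← ENNReal.ofReal_sum_of_nonneg hz]
    -- The test function for `f n` is the sum of the individual ones, each moved to its own centre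
    -- `x n j`. For large `n` the cross terms of its Dirichlet form vanish.
    let w : ℕ → testSpace := fun n => ∑ j ∈ J,
      ⟨hshift (x n j) (z j), IsTestFunction.hshift (z j).2 _⟩
    have hw1 : Tendsto (fun n => sourceTerm (f n) (w n)) atTop
        (𝓝 (∑ j ∈ J, sourceTerm (μ j) (z j))) := by
      have : ∀ n, sourceTerm (f n) (w n) = ∑ j ∈ J, sourceTerm (f n) (hshift (x n j) (z j)) :=
        fun n => map_sum (sourceLin (hf n).locallyIntegrable_deriv) _ _
      simp_rw [this]
      exact tendsto_finsetSum _ fun j hj => hsource j hj _ (z j).2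
    have hw2 : ∀ᶠ n in atTop, dirichletForm (w n) (w n) =
        ∑ j ∈ J, dirichletForm (z j) (z j) := by
      have hev : ∀ᶠ n in atTop, ∀ i ∈ J, ∀ j ∈ J, i ≠ j →
          dirichletForm (hshift (x n i) (z i)) (hshift (x n j) (z j)) = 0 := by
        simp only [Filter.eventually_all_finset]
        intro i hi j hj
        by_cases hij : i = j
        · simp [hij]
        obtain ⟨R, hR⟩ := exists_dist_dirichletForm_eq_zero (z i).2 (z j).2
        filter_upwards [(hsep i hi j hj hij).eventually_ge_atTop R] with n hn _ using hR _ _ hn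
      filter_upwards [hev] with n hn
      rw [← inner_gradLp, map_sum, sum_inner]
      refine Finset.sum_congr rfl fun i hi => ?_
      rw [inner_sum, Finset.sum_eq_single i]
      · rw [inner_gradLp]; exact dirichletForm_hshift _ _ _
      · intro j hj hij
        rw [inner_gradLp]; exact hn i hi j hj (Ne.symm hij)
      · exact fun h => absurd hi h
    have hw3 : Tendsto (fun n => ENNReal.ofReal (2 * sourceTerm (f n) (w n) -
        dirichletForm (w n) (w n))) atTop (𝓝 (ENNReal.ofReal (∑ j ∈ J,
          (2 * sourceTerm (μ j) (z j) - dirichletForm (z j) (z j))))) := by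
      refine ENNReal.tendsto_ofReal ?_
      rw [Finset.sum_sub_distrib, ← Finset.mul_sum]
      refine (hw1.const_mul 2).sub (tendsto_const_nhds.congr' ?_)
      filter_upwards [hw2] with n hn using hn.symm
    exact le_of_tendsto_of_tendsto' hw3 hN fun n => ofReal_le_strayFieldDirichlet _ (w n).2
  choose! ζ hζ hζlim using fun j (hj : j ∈ J) =>
    exists_seq_tendsto_strayFieldDirichlet (hμ j hj).locallyIntegrable_deriv
  refine le_of_tendsto' (tendsto_finsetSum J hζlim) fun n => ?_
  -- `ENNReal.ofReal` is additive only on nonnegative numbers, so a test function with negative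
  -- value is replaced by `0`. This leaves each summand unchanged.
  let z : ι → testSpace := fun j => if h : j ∈ J ∧ 0 ≤ 2 * sourceTerm (μ j) (ζ j n) -
    dirichletForm (ζ j n) (ζ j n) then ⟨ζ j n, hζ j h.1 n⟩ else 0
  have hzero : ∀ g, 2 * sourceTerm g ((0 : testSpace) : ℝ × ℝ → ℝ) -
      dirichletForm (0 : testSpace) (0 : testSpace) = 0 := by
    intro g
    rw [← norm_sq_gradLp]; simp [sourceTerm]
  have hzval : ∀ j ∈ J, ENNReal.ofReal (2 * sourceTerm (μ j) (ζ j n) -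
      dirichletForm (ζ j n) (ζ j n)) = ENNReal.ofReal (2 * sourceTerm (μ j) (z j) -
      dirichletForm (z j) (z j)) := by
    intro j hj
    by_cases h : 0 ≤ 2 * sourceTerm (μ j) (ζ j n) - dirichletForm (ζ j n) (ζ j n)
    · have : z j = ⟨ζ j n, hζ j hj n⟩ := dif_pos ⟨hj, h⟩
      rw [this]
    · have : z j = 0 := dif_neg fun h' => h h'.2
      rw [this, hzero, ENNReal.ofReal_of_nonpos (le_of_not_ge h), ENNReal.ofReal_zero]
  rw [Finset.sum_congr rfl hzval]
  refine key z fun j hj => ?_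
  by_cases h : 0 ≤ 2 * sourceTerm (μ j) (ζ j n) - dirichletForm (ζ j n) (ζ j n)
  · have : z j = ⟨ζ j n, hζ j hj n⟩ := dif_pos ⟨hj, h⟩
    rw [this]; exact h
  · have : z j = 0 := dif_neg fun h' => h h'.2
    rw [this, hzero]

/-! ### The stray field energy is controlled by the `H¹` norm -/

theorem volume_restrict_halfPlane : (volume : Measure (ℝ × ℝ)).restrict halfPlane =
    (volume : Measure ℝ).prod (volume.restrict (Set.Ioi (0 : ℝ))) := by
  have : halfPlane = Set.univ ×ˢ Set.Ioi (0 : ℝ) := by ext x; simp [halfPlane]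
  rw [this, Measure.volume_eq_prod, ← Measure.prod_restrict, Measure.restrict_univ]

theorem integrable_exp_neg_two : Integrable (fun y : ℝ => Real.exp (-2 * y))
    (volume.restrict (Set.Ioi (0 : ℝ))) := exp_neg_integrableOn_Ioi 0 (by norm_num)

theorem integral_exp_neg_two : ∫ y in Set.Ioi (0 : ℝ), Real.exp (-2 * y) = 2⁻¹ := by
  have := integral_exp_mul_Ioi (a := -2) (by norm_num) 0
  simpa using this

/-- Products of a locally integrable function of the first variable with a test function. -/
theorem integrable_mul_of_test {g : ℝ → ℝ} (hg : LocallyIntegrable g) {ψ : ℝ × ℝ → ℝ}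
    (hψ : Continuous ψ) (hs : HasCompactSupport ψ) :
    Integrable (fun x : ℝ × ℝ => g x.1 * ψ x) (volume.restrict halfPlane) := by
  obtain ⟨r, hr⟩ := hs.isCompact.isBounded.subset_closedBall 0
  obtain ⟨M, hM⟩ := hψ.bounded_above_of_compact_support hs
  have hI : Integrable (fun x : ℝ × ℝ => (Set.indicator (Metric.closedBall 0 r) g x.1) *
      (Set.indicator (Metric.closedBall 0 r) (fun _ => M) x.2)) := by
    refine Integrable.mul_prod ((integrable_indicator_iff measurableSet_closedBall).2
      (hg.integrableOn_isCompact (isCompact_closedBall 0 r)))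
      ((integrable_indicator_iff measurableSet_closedBall).2 ?_)
    exact integrableOn_const (measure_closedBall_lt_top).ne
  refine Integrable.restrict (hI.mono ?_ ?_)
  · exact (hg.aestronglyMeasurable.comp_quasiMeasurePreserving
      Measure.quasiMeasurePreserving_fst).mul hψ.aestronglyMeasurable
  · refine Eventually.of_forall fun x => ?_
    by_cases hx : x ∈ tsupport ψ
    · have := hr hx
      rw [mem_closedBall_zero_iff, Prod.norm_def, max_le_iff] at this
      rw [Set.indicator_of_mem (mem_closedBall_zero_iff.2 this.1),
        Set.indicator_of_mem (mem_closedBall_zero_iff.2 this.2), norm_mul, norm_mul]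
      exact mul_le_mul_of_nonneg_left ((hM x).trans (le_abs_self M)) (norm_nonneg _)
    · rw [image_eq_zero_of_notMem_tsupport hx, mul_zero, norm_zero]; exact norm_nonneg _

theorem IsTestFunction.hasCompactSupport_slice' {E : Type*} [Zero E] {ζ : ℝ × ℝ → E}
    (hζ : HasCompactSupport ζ) (t : ℝ) : HasCompactSupport fun y => ζ (t, y) := by
  refine HasCompactSupport.intro (hζ.isCompact.image continuous_snd) fun y hy => ?_
  refine image_eq_zero_of_notMem_tsupport fun h => hy ⟨(t, y), h, rfl⟩

theorem IsTestFunction.integral_exp_neg_mul {ζ : ℝ × ℝ → ℝ} (hζ : IsTestFunction ζ) (t : ℝ) :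
    ∫ y in Set.Ioi (0 : ℝ), Real.exp (-y) * (partial₂ ζ (t, y) - ζ (t, y)) = - ζ (t, 0) := by
  have hd : ∀ y, HasDerivAt (fun y => Real.exp (-y) * ζ (t, y))
      (Real.exp (-y) * (partial₂ ζ (t, y) - ζ (t, y))) y := by
    intro y
    have h1 : HasDerivAt (fun y : ℝ => Real.exp (-y)) (-Real.exp (-y)) y := by
      simpa using (hasDerivAt_neg y).exp
    refine (h1.mul (hζ.hasDerivAt_slice' t y)).congr_deriv ?_
    ring
  have hcs := IsTestFunction.hasCompactSupport_slice' hζ.2 t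
  have hcs2 := IsTestFunction.hasCompactSupport_slice' hζ.hasCompactSupport_partial₂ t
  have hint : Integrable fun y => Real.exp (-y) * (partial₂ ζ (t, y) - ζ (t, y)) := by
    refine Continuous.integrable_of_hasCompactSupport ?_ (HasCompactSupport.mul_left
      (hcs2.sub hcs))
    have := hζ.continuous_partial₂
    have := hζ.continuous
    fun_prop
  have hlim : Tendsto (fun y => Real.exp (-y) * ζ (t, y)) atTop (𝓝 0) := by
    have h2 : HasCompactSupport fun y => Real.exp (-y) * ζ (t, y) := hcs.mul_left
    refine tendsto_nhds_of_eventually_eq ?_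
    obtain ⟨r, hr⟩ := h2.isCompact.isBounded.subset_closedBall 0
    filter_upwards [eventually_gt_atTop |r|] with y hy
    refine image_eq_zero_of_notMem_tsupport (f := fun y => Real.exp (-y) * ζ (t, y)) fun h => ?_
    have := hr h
    rw [mem_closedBall_zero_iff, Real.norm_eq_abs] at this
    linarith [le_abs_self y, le_abs_self r]
  have := integral_Ioi_of_hasDerivAt_of_tendsto' (a := 0) (fun y _ => hd y) hint.integrableOn hlim
  rw [this]; simp

/-- The field `(e(t) exp(-y), e'(t) exp(-y))` is divergence-free and has second component `e'` on
the boundary. Its pairing with `∇ζ` is therefore minus the source term. -/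
theorem sourceTerm_eq_integral_halfPlane {e : ℝ → ℝ} (he : LocAC e) {ζ : ℝ × ℝ → ℝ}
    (hζ : IsTestFunction ζ) : sourceTerm e ζ = - ∫ x in halfPlane,
      (e x.1 * Real.exp (-x.2) * partial₁ ζ x + deriv e x.1 * Real.exp (-x.2) * partial₂ ζ x) := by
  have hexp : Continuous fun x : ℝ × ℝ => Real.exp (-x.2) := by fun_prop
  have hel : LocallyIntegrable e := he.continuous.locallyIntegrable
  have hdl := he.locallyIntegrable_deriv
  have i1 : Integrable (fun x : ℝ × ℝ => e x.1 * (Real.exp (-x.2) * partial₁ ζ x))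
      (volume.restrict halfPlane) := integrable_mul_of_test hel (hexp.mul hζ.continuous_partial₁)
    hζ.hasCompactSupport_partial₁.mul_left
  have i2 : Integrable (fun x : ℝ × ℝ => deriv e x.1 * (Real.exp (-x.2) * partial₂ ζ x))
      (volume.restrict halfPlane) := integrable_mul_of_test hdl (hexp.mul hζ.continuous_partial₂)
    hζ.hasCompactSupport_partial₂.mul_left
  have i3 : Integrable (fun x : ℝ × ℝ => deriv e x.1 * (Real.exp (-x.2) * ζ x))
      (volume.restrict halfPlane) := integrable_mul_of_test hdl (hexp.mul hζ.continuous) hζ.2.mul_left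
  rw [volume_restrict_halfPlane] at i1 i2 i3
  have e1 : ∫ x in halfPlane, e x.1 * (Real.exp (-x.2) * partial₁ ζ x) =
      - ∫ x in halfPlane, deriv e x.1 * (Real.exp (-x.2) * ζ x) := by
    rw [volume_restrict_halfPlane, integral_prod_symm _ i1, integral_prod_symm _ i3, ← integral_neg]
    congr 1; funext y
    have h1 := he.integral_deriv_mul ((hζ.contDiff_slice y).of_le (by simp))
      (IsTestFunction.hasCompactSupport_slice hζ.2 y)
    rw [hζ.deriv_trace] at h1
    calc ∫ t, e t * (Real.exp (-y) * partial₁ ζ (t, y))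
        = Real.exp (-y) * ∫ t, e t * partial₁ ζ (t, y) := by
          rw [← integral_const_mul]; congr 1; funext t; ring
      _ = - (Real.exp (-y) * ∫ t, deriv e t * ζ (t, y)) := by rw [h1]; ring
      _ = - ∫ t, deriv e t * (Real.exp (-y) * ζ (t, y)) := by
          rw [← integral_const_mul]; congr 2; funext t; ring
  have e2 : ∫ x in halfPlane, deriv e x.1 * (Real.exp (-x.2) * partial₂ ζ x) -
      deriv e x.1 * (Real.exp (-x.2) * ζ x) = - sourceTerm e ζ := by
    rw [volume_restrict_halfPlane]
    refine (integral_prod _ (i2.sub i3)).trans ?_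
    rw [sourceTerm, ← integral_neg]
    congr 1; funext t
    simp only [Pi.sub_apply]
    rw [← mul_neg, ← hζ.integral_exp_neg_mul t, ← integral_const_mul]
    congr 1; funext y; ring
  rw [← volume_restrict_halfPlane] at i1 i2 i3
  rw [integral_sub i2 i3] at e2
  simp_rw [mul_assoc]
  rw [integral_add i1 i2]
  linarith

/-- Young's inequality is applied to the explicit field of `sourceTerm_eq_integral_halfPlane`. The
factor `2⁻¹` is the integral of `exp(-2y)` over `(0, ∞)`. -/
theorem strayFieldDirichlet_le_sobolev {e : ℝ → ℝ} (he : LocAC e) (h0 : Integrable fun t => e t ^ 2)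
    (h1 : Integrable fun t => deriv e t ^ 2) :
    strayFieldDirichlet e ≤ ENNReal.ofReal (2⁻¹ * ∫ t, (e t ^ 2 + deriv e t ^ 2)) := by
  refine strayFieldDirichlet_le he.locallyIntegrable_deriv
    (mul_nonneg (by norm_num) (integral_nonneg fun t => by positivity)) fun ζ hζ => ?_
  rw [sourceTerm_eq_integral_halfPlane he hζ, ← integral_neg, ← integral_const_mul]
  have hJ : Integrable (fun x : ℝ × ℝ => (e x.1 ^ 2 + deriv e x.1 ^ 2) * Real.exp (-2 * x.2))
      (volume.restrict halfPlane) := by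
    rw [volume_restrict_halfPlane]
    exact (h0.add h1).mul_prod integrable_exp_neg_two
  have hJv : ∫ x in halfPlane, (e x.1 ^ 2 + deriv e x.1 ^ 2) * Real.exp (-2 * x.2) =
      2⁻¹ * ∫ t, (e t ^ 2 + deriv e t ^ 2) := by
    rw [volume_restrict_halfPlane, integral_prod_mul (fun t => e t ^ 2 + deriv e t ^ 2)
      (fun y => Real.exp (-2 * y)), integral_exp_neg_two, mul_comm]
  have hD : Integrable (fun x => partial₁ ζ x * partial₁ ζ x + partial₂ ζ x * partial₂ ζ x)
      (volume.restrict halfPlane) := by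
    refine Integrable.restrict (Continuous.integrable_of_hasCompactSupport ?_ ?_)
    · have := hζ.continuous_partial₁
      have := hζ.continuous_partial₂
      fun_prop
    · exact hζ.hasCompactSupport_partial₁.mul_left.add hζ.hasCompactSupport_partial₂.mul_left
  rw [dirichletForm, ← hJv, ← integral_add hJ hD]
  have hexp : Continuous fun x : ℝ × ℝ => Real.exp (-x.2) := by fun_prop
  have i1 := integrable_mul_of_test he.continuous.locallyIntegrable
    (hexp.mul hζ.continuous_partial₁) hζ.hasCompactSupport_partial₁.mul_left
  have i2 := integrable_mul_of_test he.locallyIntegrable_deriv (hexp.mul hζ.continuous_partial₂)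
    hζ.hasCompactSupport_partial₂.mul_left
  refine integral_mono ?_ (hJ.add hD) fun x => ?_
  · refine (((i1.add i2).neg).const_mul 2).congr (Eventually.of_forall fun x => ?_)
    simp only [Pi.neg_apply, Pi.add_apply, Pi.mul_apply, mul_assoc]
  · have h2 : Real.exp (-2 * x.2) = Real.exp (-x.2) ^ 2 := by
      rw [← Real.exp_nat_mul]; push_cast; ring_nf
    simp only [h2]
    nlinarith [sq_nonneg (e x.1 * Real.exp (-x.2) + partial₁ ζ x),
      sq_nonneg (deriv e x.1 * Real.exp (-x.2) + partial₂ ζ x)]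

/-! ### Reflection -/

/-- Reflection at the vertical axis. -/
def hreflect (ζ : ℝ × ℝ → ℝ) (x : ℝ × ℝ) : ℝ := ζ (-x.1, x.2)

theorem setIntegral_halfPlane_comp_neg (F : ℝ × ℝ → ℝ) :
    ∫ x in halfPlane, F (-x.1, x.2) = ∫ x in halfPlane, F x := by
  rw [volume_restrict_halfPlane]
  exact ((Measure.measurePreserving_neg volume).prod (MeasurePreserving.id _)).integral_comp
    ((MeasurableEquiv.neg ℝ).prodCongr (MeasurableEquiv.refl ℝ)).measurableEmbedding F

theorem IsTestFunction.hreflect {ζ : ℝ × ℝ → ℝ} (hζ : IsTestFunction ζ) :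
    IsTestFunction (hreflect ζ) := by
  refine ⟨hζ.1.comp (contDiff_fst.neg.prodMk contDiff_snd), ?_⟩
  obtain ⟨R, hR, h⟩ := hζ.exists_bound_support
  refine HasCompactSupport.intro (K := Set.Icc (-R) R ×ˢ Set.Icc (-R) R)
    (isCompact_Icc.prod isCompact_Icc) fun x hx => ?_
  refine (h (-x.1, x.2) ?_).1
  by_contra hcon
  push Not at hcon
  have h1 := abs_lt.1 hcon.1
  have h2 := abs_lt.1 hcon.2
  exact hx ⟨⟨by linarith, by linarith⟩, ⟨h2.1.le, h2.2.le⟩⟩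

theorem partial_hreflect {ζ : ℝ × ℝ → ℝ} (hζ : IsTestFunction ζ) (x : ℝ × ℝ) :
    partial₁ (hreflect ζ) x = - partial₁ ζ (-x.1, x.2) ∧
      partial₂ (hreflect ζ) x = partial₂ ζ (-x.1, x.2) := by
  have h1 := hζ.hreflect.hasDerivAt_slice x.1 x.2
  have h2 := hζ.hreflect.hasDerivAt_slice' x.1 x.2
  have h3 := (hζ.hasDerivAt_slice (-x.1) x.2).scomp x.1 (hasDerivAt_neg x.1)
  have h4 := hζ.hasDerivAt_slice' (-x.1) x.2
  exact ⟨(h1.unique h3).trans (by rw [smul_eq_mul, neg_one_mul]), h2.unique h4⟩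

/-- The part of `ζ` that is odd in the first variable. -/
noncomputable def oddPart (ζ : ℝ × ℝ → ℝ) (x : ℝ × ℝ) : ℝ :=
  (1 / 2) * ζ x + (-(1 / 2)) * hreflect ζ x

theorem IsTestFunction.oddPart {ζ : ℝ × ℝ → ℝ} (hζ : IsTestFunction ζ) :
    IsTestFunction (oddPart ζ) :=
  (hζ.const_mul _).add (hζ.hreflect.const_mul _)

theorem oddPart_neg (ζ : ℝ × ℝ → ℝ) (s y : ℝ) : oddPart ζ (-s, y) = - oddPart ζ (s, y) := by
  simp [oddPart, hreflect]

theorem partial_oddPart {ζ : ℝ × ℝ → ℝ} (hζ : IsTestFunction ζ) (x : ℝ × ℝ) :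
    partial₁ (oddPart ζ) x = (partial₁ ζ x + partial₁ ζ (-x.1, x.2)) / 2 ∧
      partial₂ (oddPart ζ) x = (partial₂ ζ x - partial₂ ζ (-x.1, x.2)) / 2 := by
  have h := partial_hreflect hζ x
  constructor
  · refine ((hζ.const_mul _).partial₁_add (hζ.hreflect.const_mul _) x).trans ?_
    rw [hζ.partial₁_const_mul, hζ.hreflect.partial₁_const_mul, h.1]; ring
  · refine ((hζ.const_mul _).partial₂_add (hζ.hreflect.const_mul _) x).trans ?_
    rw [hζ.partial₂_const_mul, hζ.hreflect.partial₂_const_mul, h.2]; ring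

theorem IsTestFunction.integrable_dirichlet {ζ : ℝ × ℝ → ℝ} (hζ : IsTestFunction ζ) :
    Integrable (fun x => partial₁ ζ x * partial₁ ζ x + partial₂ ζ x * partial₂ ζ x)
      (volume.restrict halfPlane) := by
  refine Integrable.restrict (Continuous.integrable_of_hasCompactSupport ?_ ?_)
  · have := hζ.continuous_partial₁
    have := hζ.continuous_partial₂
    fun_prop
  · exact hζ.hasCompactSupport_partial₁.mul_left.add hζ.hasCompactSupport_partial₂.mul_left

theorem two_mul_dirichletForm {ζ : ℝ × ℝ → ℝ} (hζ : IsTestFunction ζ) :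
    2 * dirichletForm ζ ζ = ∫ x in halfPlane,
      (partial₁ ζ x * partial₁ ζ x + partial₂ ζ x * partial₂ ζ x +
      (partial₁ (hreflect ζ) x * partial₁ (hreflect ζ) x +
        partial₂ (hreflect ζ) x * partial₂ (hreflect ζ) x)) := by
  rw [integral_add hζ.integrable_dirichlet hζ.hreflect.integrable_dirichlet]
  have : ∫ x in halfPlane, (partial₁ (hreflect ζ) x * partial₁ (hreflect ζ) x +
        partial₂ (hreflect ζ) x * partial₂ (hreflect ζ) x) = dirichletForm ζ ζ := by
    rw [dirichletForm, ← setIntegral_halfPlane_comp_neg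
      (fun x => partial₁ ζ x * partial₁ ζ x + partial₂ ζ x * partial₂ ζ x)]
    congr 1; funext x
    rw [(partial_hreflect hζ x).1, (partial_hreflect hζ x).2]; ring
  rw [this, dirichletForm]; ring

/-- Pointwise, the squared norm of an average is at most the average of the squared norms. The
reflection preserves the Dirichlet integral. -/
theorem dirichletForm_oddPart_le {ζ : ℝ × ℝ → ℝ} (hζ : IsTestFunction ζ) :
    dirichletForm (oddPart ζ) (oddPart ζ) ≤ dirichletForm ζ ζ := by
  have h := two_mul_dirichletForm hζ
  suffices dirichletForm (oddPart ζ) (oddPart ζ) ≤ 2⁻¹ * (2 * dirichletForm ζ ζ) by linarith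
  rw [h, ← integral_const_mul]
  refine integral_mono hζ.oddPart.integrable_dirichlet
    ((hζ.integrable_dirichlet.add hζ.hreflect.integrable_dirichlet).const_mul _) fun x => ?_
  simp only [(partial_oddPart hζ x).1, (partial_oddPart hζ x).2, (partial_hreflect hζ x).1,
    (partial_hreflect hζ x).2]
  nlinarith [sq_nonneg (partial₁ ζ x - partial₁ ζ (-x.1, x.2)),
    sq_nonneg (partial₂ ζ x + partial₂ ζ (-x.1, x.2))]

theorem deriv_neg_of_even {f : ℝ → ℝ} (hf : ∀ t, f (-t) = f t) (t : ℝ) :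
    deriv f (-t) = - deriv f t := by
  have : (fun t => f (-t)) = f := funext hf
  have h := deriv_comp_neg (f := f) (x := t)
  rw [this] at h; linarith

/-- The derivative of an even function is odd and annihilates the even part of `ζ`. Hence even
profiles need only be tested with odd functions. These vanish on the axis and can be glued there. -/
theorem sourceTerm_oddPart {f : ℝ → ℝ} (hf : LocAC f) (he : ∀ t, f (-t) = f t) {ζ : ℝ × ℝ → ℝ}
    (hζ : IsTestFunction ζ) : sourceTerm f (oddPart ζ) = sourceTerm f ζ := by
  have hl := hf.locallyIntegrable_deriv
  have h1 : sourceTerm f (hreflect ζ) = - sourceTerm f ζ := by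
    rw [sourceTerm, sourceTerm, ← integral_neg_eq_self, ← integral_neg]
    congr 1; funext t
    rw [deriv_neg_of_even he]; simp [hreflect]
  have h2 : sourceTerm f (oddPart ζ) = _ := sourceTerm_add hl (hζ.const_mul (1 / 2))
    (hζ.hreflect.const_mul (-(1 / 2)))
  have h3 : ∀ (c : ℝ) (η), IsTestFunction η → sourceTerm f (fun x => c * η x) =
      c * sourceTerm f η := fun c η hη => (sourceLin hl).map_smul c ⟨η, hη⟩
  rw [h2, h3 _ _ hζ, h3 _ _ hζ.hreflect, h1]; ring

/-! ### Symmetrization and the stray field energy -/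

/-- A smooth odd truncation that removes the values in `[-1, 1]`. -/
noncomputable def softCut (s : ℝ) : ℝ := ∫ r in (0 : ℝ)..s, Real.smoothTransition (r ^ 2 - 1)

theorem continuous_cutDensity : Continuous fun r : ℝ => Real.smoothTransition (r ^ 2 - 1) :=
  Real.smoothTransition.continuous.comp (by fun_prop)

theorem hasDerivAt_softCut (s : ℝ) :
    HasDerivAt softCut (Real.smoothTransition (s ^ 2 - 1)) s :=
  intervalIntegral.integral_hasDerivAt_right (continuous_cutDensity.intervalIntegrable _ _)
    (continuous_cutDensity.stronglyMeasurableAtFilter _ _) continuous_cutDensity.continuousAt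

theorem contDiff_softCut : ContDiff ℝ ∞ softCut := by
  rw [contDiff_infty_iff_deriv]
  refine ⟨fun s => (hasDerivAt_softCut s).differentiableAt, ?_⟩
  rw [show deriv softCut = fun s => Real.smoothTransition (s ^ 2 - 1) from
    funext fun s => (hasDerivAt_softCut s).deriv]
  exact Real.smoothTransition.contDiff.comp (by fun_prop)

theorem softCut_neg (s : ℝ) : softCut (-s) = - softCut s := by
  have h := intervalIntegral.integral_comp_neg (a := 0) (b := s)
    (fun r : ℝ => Real.smoothTransition (r ^ 2 - 1))
  simp only [even_two, Even.neg_pow, neg_zero] at h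
  rw [softCut, softCut, h, ← intervalIntegral.integral_symm]

theorem softCut_eq_zero {s : ℝ} (hs : |s| ≤ 1) : softCut s = 0 := by
  rw [softCut, intervalIntegral.integral_congr (g := fun _ => (0 : ℝ)), intervalIntegral.integral_zero]
  intro r hr
  refine Real.smoothTransition.zero_of_nonpos ?_
  have : |r| ≤ 1 := by
    rw [Set.mem_uIcc] at hr
    have := abs_le.1 hs
    rw [abs_le]
    rcases hr with hr | hr <;> constructor <;> linarith [hr.1, hr.2, this.1, this.2]
  nlinarith [sq_abs r, abs_nonneg r]

theorem abs_softCut_le (s : ℝ) : |softCut s| ≤ |s| := by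
  have := intervalIntegral.norm_integral_le_of_norm_le_const (a := 0) (b := s) (C := 1)
    (f := fun r : ℝ => Real.smoothTransition (r ^ 2 - 1)) (fun r _ => by
      rw [Real.norm_of_nonneg (Real.smoothTransition.nonneg _)]
      exact Real.smoothTransition.le_one _)
  simpa [softCut] using this

theorem abs_softCut_sub_le (s : ℝ) : |softCut s - s| ≤ 2 := by
  have hpos : ∀ s, 0 ≤ s → |softCut s - s| ≤ 2 := by
    intro s hs
    rcases le_total s 2 with h2 | h2
    · have h0 : 0 ≤ softCut s := intervalIntegral.integral_nonneg hs fun r _ =>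
        Real.smoothTransition.nonneg _
      have h1 := (le_abs_self _).trans (abs_softCut_le s)
      rw [abs_of_nonneg hs] at h1
      rw [abs_le]; constructor <;> linarith
    · have h0 : 0 ≤ softCut 2 := intervalIntegral.integral_nonneg (by norm_num) fun r _ =>
        Real.smoothTransition.nonneg _
      have h1 := (le_abs_self _).trans (abs_softCut_le 2)
      rw [abs_of_nonneg (by norm_num)] at h1
      have h3 : softCut s = softCut 2 + (s - 2) := by
        rw [softCut, softCut, ← intervalIntegral.integral_add_adjacent_intervals
          (continuous_cutDensity.intervalIntegrable 0 2)
          (continuous_cutDensity.intervalIntegrable 2 s)]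
        congr 1
        rw [intervalIntegral.integral_congr (g := fun _ => (1 : ℝ)), intervalIntegral.integral_const]
        · simp
        · intro r hr
          rw [Set.uIcc_of_le h2] at hr
          exact Real.smoothTransition.one_of_one_le (by nlinarith [hr.1])
      rw [h3, abs_le]; constructor <;> linarith
  rcases le_total 0 s with h | h
  · exact hpos s h
  · have := hpos (-s) (by linarith)
    rw [softCut_neg] at this
    rwa [show softCut s - s = -(-softCut s - -s) by ring, abs_neg]

/-- The truncation at scale `ε`. -/
noncomputable def softCutAt (ε s : ℝ) : ℝ := ε * softCut (ε⁻¹ * s)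

theorem contDiff_softCutAt (ε : ℝ) : ContDiff ℝ ∞ (softCutAt ε) :=
  contDiff_const.mul (contDiff_softCut.comp (by fun_prop))

theorem softCutAt_neg (ε s : ℝ) : softCutAt ε (-s) = - softCutAt ε s := by
  simp [softCutAt, softCut_neg]

theorem softCutAt_eq_zero {ε s : ℝ} (hε : 0 < ε) (hs : |s| ≤ ε) : softCutAt ε s = 0 := by
  rw [softCutAt, softCut_eq_zero, mul_zero]
  rw [abs_mul, abs_inv, abs_of_pos hε, inv_mul_le_iff₀ hε]; linarith

theorem abs_softCutAt_le {ε : ℝ} (hε : 0 < ε) (s : ℝ) : |softCutAt ε s| ≤ |s| := by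
  rw [softCutAt, abs_mul, abs_of_pos hε]
  calc ε * |softCut (ε⁻¹ * s)| ≤ ε * |ε⁻¹ * s| := mul_le_mul_of_nonneg_left (abs_softCut_le _) hε.le
    _ = |s| := by rw [abs_mul, abs_inv, abs_of_pos hε]; field_simp

theorem abs_softCutAt_sub_le {ε : ℝ} (hε : 0 < ε) (s : ℝ) : |softCutAt ε s - s| ≤ 2 * ε := by
  have : softCutAt ε s - s = ε * (softCut (ε⁻¹ * s) - ε⁻¹ * s) := by
    rw [softCutAt]; field_simp
  rw [this, abs_mul, abs_of_pos hε, mul_comm]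
  gcongr; exact abs_softCut_sub_le _

/-- The slope of the truncation lies in `[0, 1]`, so composition with it cannot increase a gradient.
-/
theorem exists_hasDerivAt_softCutAt {ε : ℝ} (hε : 0 < ε) (s : ℝ) :
    ∃ c, HasDerivAt (softCutAt ε) c s ∧ c ^ 2 ≤ 1 := by
  have h1 : HasDerivAt (fun s : ℝ => ε⁻¹ * s) ε⁻¹ s := by
    simpa using (hasDerivAt_id s).const_mul ε⁻¹
  have h2 := ((hasDerivAt_softCut (ε⁻¹ * s)).comp s h1).const_mul ε
  refine ⟨Real.smoothTransition ((ε⁻¹ * s) ^ 2 - 1), h2.congr_deriv (by field_simp), ?_⟩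
  have := Real.smoothTransition.nonneg ((ε⁻¹ * s) ^ 2 - 1)
  have := Real.smoothTransition.le_one ((ε⁻¹ * s) ^ 2 - 1)
  nlinarith

/-- Two functions, odd in the first variable, truncated and glued along the vertical axis. -/
noncomputable def glueOdd (ε : ℝ) (ζ η : ℝ × ℝ → ℝ) (x : ℝ × ℝ) : ℝ :=
  if x.1 < 0 then softCutAt ε (ζ x) else softCutAt ε (η x)

section glueOdd

variable {ε : ℝ} {ζ η : ℝ × ℝ → ℝ}

theorem glueOdd_eventuallyEq_left {x : ℝ × ℝ} (hx : x.1 < 0) :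
    glueOdd ε ζ η =ᶠ[𝓝 x] fun x => softCutAt ε (ζ x) := by
  filter_upwards [(isOpen_lt continuous_fst continuous_const).mem_nhds hx] with y hy
  exact if_pos hy

theorem glueOdd_eventuallyEq_right {x : ℝ × ℝ} (hx : 0 < x.1) :
    glueOdd ε ζ η =ᶠ[𝓝 x] fun x => softCutAt ε (η x) := by
  filter_upwards [(isOpen_lt continuous_const continuous_fst).mem_nhds hx] with y hy
  exact if_neg (not_lt.2 (le_of_lt hy))

/-- Odd functions are small near the axis, so the truncation makes both of them vanish in a
neighbourhood of each axis point. The two halves then fit together smoothly. -/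
theorem isTestFunction_glueOdd (hε : 0 < ε) (hζ : IsTestFunction ζ) (hη : IsTestFunction η)
    (oζ : ∀ s y, ζ (-s, y) = - ζ (s, y)) (oη : ∀ s y, η (-s, y) = - η (s, y)) :
    IsTestFunction (glueOdd ε ζ η) := by
  refine ⟨contDiff_iff_contDiffAt.2 fun x => ?_, ?_⟩
  · rcases lt_trichotomy x.1 0 with hx | hx | hx
    · exact ((contDiff_softCutAt ε).comp hζ.1).contDiffAt.congr_of_eventuallyEq
        (glueOdd_eventuallyEq_left hx)
    · have hz : ∀ {ζ : ℝ × ℝ → ℝ}, IsTestFunction ζ → (∀ s y, ζ (-s, y) = - ζ (s, y)) →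
          ∀ᶠ y in 𝓝 x, softCutAt ε (ζ y) = 0 := by
        intro ζ hζ oζ
        have h0 : ζ x = 0 := by
          have := oζ 0 x.2
          rw [neg_zero, ← hx] at this
          have h2 : ζ x = - ζ x := this
          linarith
        have h1 := hζ.continuous.abs.tendsto x
        rw [h0, abs_zero] at h1
        filter_upwards [h1.eventually (ge_mem_nhds hε)] with y hy using softCutAt_eq_zero hε hy
      refine (contDiffAt_const (c := (0 : ℝ))).congr_of_eventuallyEq ?_
      filter_upwards [hz hζ oζ, hz hη oη] with y h1 h2
      rw [glueOdd]; split_ifs <;> assumption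
    · exact ((contDiff_softCutAt ε).comp hη.1).contDiffAt.congr_of_eventuallyEq
        (glueOdd_eventuallyEq_right hx)
  · refine HasCompactSupport.intro (hζ.2.isCompact.union hη.2.isCompact) fun x hx => ?_
    rw [Set.mem_union, not_or] at hx
    have h0 : softCutAt ε 0 = 0 := softCutAt_eq_zero hε (by simpa using hε.le)
    rw [glueOdd, image_eq_zero_of_notMem_tsupport hx.1, image_eq_zero_of_notMem_tsupport hx.2, h0,
      ite_self]

theorem gradSq_softCutAt_le (hε : 0 < ε) (hζ : IsTestFunction ζ) {F : ℝ × ℝ → ℝ} {x : ℝ × ℝ}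
    (hF : F =ᶠ[𝓝 x] fun x => softCutAt ε (ζ x)) :
    partial₁ F x * partial₁ F x + partial₂ F x * partial₂ F x ≤
      partial₁ ζ x * partial₁ ζ x + partial₂ ζ x * partial₂ ζ x := by
  obtain ⟨c, hc, hc1⟩ := exists_hasDerivAt_softCutAt hε (ζ x)
  have h := hc.comp_hasFDerivAt x (hζ.differentiable x).hasFDerivAt
  have h2 : fderiv ℝ F x = c • fderiv ℝ ζ x := by
    rw [hF.fderiv_eq]; exact h.fderiv
  have h3 : ∀ v, fderiv ℝ F x v = c * fderiv ℝ ζ x v := fun v => by rw [h2]; rfl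
  simp only [partial₁, partial₂, h3]
  nlinarith [mul_self_nonneg (fderiv ℝ ζ x (1, 0)), mul_self_nonneg (fderiv ℝ ζ x (0, 1))]

theorem gradSq_odd (hζ : IsTestFunction ζ) (oζ : ∀ s y, ζ (-s, y) = - ζ (s, y)) (x : ℝ × ℝ) :
    partial₁ ζ (-x.1, x.2) * partial₁ ζ (-x.1, x.2) +
      partial₂ ζ (-x.1, x.2) * partial₂ ζ (-x.1, x.2) =
      partial₁ ζ x * partial₁ ζ x + partial₂ ζ x * partial₂ ζ x := by
  have h : hreflect ζ = fun x => -1 * ζ x := by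
    funext x; rw [neg_one_mul]; exact oζ _ _
  have h1 := (partial_hreflect hζ x).1
  have h2 := (partial_hreflect hζ x).2
  rw [h, hζ.partial₁_const_mul] at h1
  rw [h, hζ.partial₂_const_mul] at h2
  rw [← h2, show partial₁ ζ (-x.1, x.2) = partial₁ ζ x by linarith]; ring

/-- The squared gradient of an odd function is even, so each half-space carries half of its
Dirichlet integral. The glued function uses one half from `ζ` and one from `η`. -/
theorem two_mul_dirichletForm_glueOdd_le (hε : 0 < ε) (hζ : IsTestFunction ζ)
    (hη : IsTestFunction η) (oζ : ∀ s y, ζ (-s, y) = - ζ (s, y))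
    (oη : ∀ s y, η (-s, y) = - η (s, y)) :
    2 * dirichletForm (glueOdd ε ζ η) (glueOdd ε ζ η) ≤
      dirichletForm ζ ζ + dirichletForm η η := by
  have hg := isTestFunction_glueOdd hε hζ hη oζ oη
  rw [two_mul_dirichletForm hg, dirichletForm, dirichletForm,
    ← integral_add hζ.integrable_dirichlet hη.integrable_dirichlet]
  refine integral_mono_ae (hg.integrable_dirichlet.add hg.hreflect.integrable_dirichlet)
    (hζ.integrable_dirichlet.add hη.integrable_dirichlet) ?_
  have hae : ∀ᵐ x : ℝ × ℝ ∂(volume.restrict halfPlane), x.1 ≠ 0 := by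
    refine ae_restrict_of_ae ?_
    rw [Measure.volume_eq_prod]
    exact Measure.quasiMeasurePreserving_fst.ae (p := fun t : ℝ => t ≠ 0) (by simp [ae_iff])
  filter_upwards [hae] with x hx
  simp only [(partial_hreflect hg x).1, (partial_hreflect hg x).2, neg_mul_neg]
  rcases lt_or_gt_of_ne hx with h | h
  · have h1 := gradSq_softCutAt_le hε hζ (glueOdd_eventuallyEq_left (ζ := ζ) (η := η) (ε := ε) h)
    have h2 := gradSq_softCutAt_le hε hη (glueOdd_eventuallyEq_right (ζ := ζ) (η := η) (ε := ε)
      (x := (-x.1, x.2)) (by simpa using h))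
    rw [gradSq_odd hη oη] at h2
    linarith
  · have h1 := gradSq_softCutAt_le hε hη (glueOdd_eventuallyEq_right (ζ := ζ) (η := η) (ε := ε) h)
    have h2 := gradSq_softCutAt_le hε hζ (glueOdd_eventuallyEq_left (ζ := ζ) (η := η) (ε := ε)
      (x := (-x.1, x.2)) (by simpa using h))
    rw [gradSq_odd hζ oζ] at h2
    linarith

end glueOdd

theorem deriv_evenRight {E : Type*} [NormedAddCommGroup E] [NormedSpace ℝ E] (f : ℝ → E) {t : ℝ} (ht : 0 < t) :
    deriv (fun t => f |t|) t = deriv f t :=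
  Filter.EventuallyEq.deriv_eq (by
    filter_upwards [lt_mem_nhds ht] with s hs; rw [abs_of_pos hs])

theorem deriv_evenLeft {E : Type*} [NormedAddCommGroup E] [NormedSpace ℝ E] (f : ℝ → E) {t : ℝ} (ht : 0 < t) :
    deriv (fun t => f (-|t|)) t = - deriv f (-t) := by
  rw [← deriv_comp_neg]
  exact Filter.EventuallyEq.deriv_eq (by
    filter_upwards [lt_mem_nhds ht] with s hs; rw [abs_of_pos hs])

/-- Each even reflection tested with an odd function produces the same contribution on both
half-lines: the sign change of the derivative cancels that of the test function. -/
theorem two_mul_sourceTerm_glueOdd {f : ℝ → ℝ} (hf : LocAC f) (hR : LocAC fun t => f |t|)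
    (hL : LocAC fun t => f (-|t|)) {ε : ℝ} (hε : 0 < ε) {ζ η : ℝ × ℝ → ℝ}
    (hζ : IsTestFunction ζ) (hη : IsTestFunction η)
    (oζ : ∀ s y, ζ (-s, y) = - ζ (s, y)) (oη : ∀ s y, η (-s, y) = - η (s, y)) :
    2 * sourceTerm f (glueOdd ε ζ η) = sourceTerm (fun t => f (-|t|)) (fun x => softCutAt ε (ζ x)) +
      sourceTerm (fun t => f |t|) (fun x => softCutAt ε (η x)) := by
  have h0 : softCutAt ε 0 = 0 := softCutAt_eq_zero hε (by simpa using hε.le)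
  have tζ : IsTestFunction (fun x => softCutAt ε (ζ x)) :=
    ⟨(contDiff_softCutAt ε).comp hζ.1, hζ.2.comp_left h0⟩
  have tη : IsTestFunction (fun x => softCutAt ε (η x)) :=
    ⟨(contDiff_softCutAt ε).comp hη.1, hη.2.comp_left h0⟩
  have hi := integrable_source hf.locallyIntegrable_deriv (isTestFunction_glueOdd hε hζ hη oζ oη)
  have h1 : 2 * sourceTerm f (glueOdd ε ζ η) = ∫ t, (deriv f t * glueOdd ε ζ η (t, 0) +
      deriv f (-t) * glueOdd ε ζ η (-t, 0)) := by
    rw [integral_add hi hi.comp_neg, sourceTerm,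
      integral_neg_eq_self (fun t => deriv f t * glueOdd ε ζ η (t, 0))]; ring
  rw [h1, sourceTerm, sourceTerm, ← integral_add
    (integrable_source hL.locallyIntegrable_deriv tζ)
    (integrable_source hR.locallyIntegrable_deriv tη)]
  have hpos : ∀ t : ℝ, 0 < t → deriv f t * glueOdd ε ζ η (t, 0) +
      deriv f (-t) * glueOdd ε ζ η (-t, 0) =
      deriv (fun t => f (-|t|)) t * softCutAt ε (ζ (t, 0)) +
      deriv (fun t => f |t|) t * softCutAt ε (η (t, 0)) := by
    intro t ht
    rw [deriv_evenRight f ht, deriv_evenLeft f ht, glueOdd, glueOdd, if_neg (by simpa using ht.le),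
      if_pos (by simpa using ht), oζ, softCutAt_neg]
    ring
  refine integral_congr_ae ?_
  have hae : ∀ᵐ t : ℝ, t ≠ 0 := by simp [ae_iff]
  filter_upwards [hae] with t ht
  rcases lt_or_gt_of_ne ht with h | h
  · have := hpos (-t) (by linarith)
    rw [neg_neg] at this
    rw [add_comm, this, deriv_neg_of_even (fun s => by rw [abs_neg]),
      deriv_neg_of_even (fun s => by rw [abs_neg]), oζ, oη, softCutAt_neg, softCutAt_neg]
    ring
  · exact hpos t h

theorem tendsto_sourceTerm_softCutAt {f : ℝ → ℝ} (hf : LocAC f) {ζ : ℝ × ℝ → ℝ}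
    (hζ : IsTestFunction ζ) : Tendsto (fun ε => sourceTerm f (fun x => softCutAt ε (ζ x)))
      (𝓝[>] 0) (𝓝 (sourceTerm f ζ)) := by
  refine tendsto_integral_filter_of_dominated_convergence (fun t => |deriv f t * ζ (t, 0)|) ?_ ?_
    (integrable_source hf.locallyIntegrable_deriv hζ).abs ?_
  · refine Eventually.of_forall fun ε => ?_
    exact (measurable_deriv f).aestronglyMeasurable.mul (((contDiff_softCutAt ε).continuous.comp
      (hζ.continuous.comp (by fun_prop))).aestronglyMeasurable)
  · filter_upwards [self_mem_nhdsWithin] with ε hε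
    refine Eventually.of_forall fun t => ?_
    rw [Real.norm_eq_abs, abs_mul, abs_mul]
    exact mul_le_mul_of_nonneg_left (abs_softCutAt_le hε _) (abs_nonneg _)
  · refine Eventually.of_forall fun t => Tendsto.const_mul _ ?_
    rw [tendsto_iff_norm_sub_tendsto_zero]
    have h2 : Tendsto (fun ε : ℝ => 2 * ε) (𝓝[>] 0) (𝓝 0) := by
      have : Continuous fun ε : ℝ => 2 * ε := by fun_prop
      simpa using (this.tendsto 0).mono_left nhdsWithin_le_nhds
    refine tendsto_of_tendsto_of_tendsto_of_le_of_le' tendsto_const_nhds h2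
      (Eventually.of_forall fun _ => norm_nonneg _) ?_
    filter_upwards [self_mem_nhdsWithin] with ε hε using abs_softCutAt_sub_le hε _

/-- Even reflection of the two halves of a profile does not increase the total stray field
energy. -/
theorem strayFieldDirichlet_symmetrize {f : ℝ → ℝ} (hf : LocAC f) (hR : LocAC fun t => f |t|)
    (hL : LocAC fun t => f (-|t|)) :
    strayFieldDirichlet (fun t => f (-|t|)) + strayFieldDirichlet (fun t => f |t|) ≤
      2 * strayFieldDirichlet f := by
  by_cases hN : strayFieldDirichlet f = ⊤
  · rw [hN]; simp
  obtain ⟨C, hC⟩ : ∃ C, C = (strayFieldDirichlet f).toReal := ⟨_, rfl⟩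
  have hC0 : 0 ≤ C := hC ▸ ENNReal.toReal_nonneg
  have hCN : strayFieldDirichlet f = ENNReal.ofReal C := by rw [hC, ENNReal.ofReal_toReal hN]
  -- Test functions for the two reflections are replaced by their odd parts, truncated and glued.
  -- The result is a test function for `f` itself, and the truncation is removed by letting `ε → 0`.
  have key : ∀ ζ η : testSpace, (2 * sourceTerm (fun t => f (-|t|)) ζ - dirichletForm ζ ζ) +
      (2 * sourceTerm (fun t => f |t|) η - dirichletForm η η) ≤ 2 * C := by
    intro ζ η
    have tζ := IsTestFunction.oddPart ζ.2
    have tη := IsTestFunction.oddPart η.2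
    have oζ := oddPart_neg ζ
    have oη := oddPart_neg η
    have h1 : ∀ ε > 0, (2 * sourceTerm (fun t => f (-|t|)) (fun x => softCutAt ε (oddPart ζ x)) -
        dirichletForm (oddPart ζ) (oddPart ζ)) + (2 * sourceTerm (fun t => f |t|)
        (fun x => softCutAt ε (oddPart η x)) - dirichletForm (oddPart η) (oddPart η)) ≤ 2 * C := by
      intro ε hε
      have h2 := two_mul_dirichletForm_glueOdd_le hε tζ tη oζ oη
      have h3 := two_mul_sourceTerm_glueOdd hf hR hL hε tζ tη oζ oη
      have h4 := ofReal_le_strayFieldDirichlet f (isTestFunction_glueOdd hε tζ tη oζ oη)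
      rw [hCN, ENNReal.ofReal_le_ofReal_iff hC0] at h4
      linarith
    have h5 := le_of_tendsto ((((tendsto_sourceTerm_softCutAt hL tζ).const_mul 2).sub_const _).add
      (((tendsto_sourceTerm_softCutAt hR tη).const_mul 2).sub_const _))
      (by filter_upwards [self_mem_nhdsWithin] with ε hε using h1 ε hε)
    rw [sourceTerm_oddPart hL (fun t => by rw [abs_neg]) ζ.2,
      sourceTerm_oddPart hR (fun t => by rw [abs_neg]) η.2] at h5
    have h6 := dirichletForm_oddPart_le ζ.2
    have h7 := dirichletForm_oddPart_le η.2
    linarith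
  have hzero : ∀ g, 2 * sourceTerm g ((0 : testSpace) : ℝ × ℝ → ℝ) -
      dirichletForm (0 : testSpace) (0 : testSpace) = 0 := by
    intro g
    rw [← norm_sq_gradLp]; simp [sourceTerm]
  rw [strayFieldDirichlet_eq_iSup hL.locallyIntegrable_deriv,
    strayFieldDirichlet_eq_iSup hR.locallyIntegrable_deriv, hCN,
    show (2 : ℝ≥0∞) * ENNReal.ofReal C = ENNReal.ofReal (2 * C) by
      rw [ENNReal.ofReal_mul (by norm_num)]; simp]
  refine ENNReal.iSup_add_iSup_le fun ζ η => ?_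
  -- A negative value is rounded up to `0` by `ENNReal.ofReal`; in that case `key` is used with the
  -- zero test function instead.
  rcases le_total 0 (2 * sourceTerm (fun t => f (-|t|)) ζ - dirichletForm ζ ζ) with a | a <;>
  rcases le_total 0 (2 * sourceTerm (fun t => f |t|) η - dirichletForm η η) with b | b
  · rw [← ENNReal.ofReal_add a b]
    exact ENNReal.ofReal_le_ofReal (key ζ η)
  · rw [ENNReal.ofReal_of_nonpos b, add_zero]
    have := key ζ 0
    rw [hzero, add_zero] at this
    exact ENNReal.ofReal_le_ofReal this
  · rw [ENNReal.ofReal_of_nonpos a, zero_add]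
    have := key 0 η
    rw [hzero, zero_add] at this
    exact ENNReal.ofReal_le_ofReal this
  · rw [ENNReal.ofReal_of_nonpos a, ENNReal.ofReal_of_nonpos b, add_zero]
    exact zero_le

/-! ### The local energy -/

theorem wellLevel_nonneg {h : ℝ} (h0 : 0 ≤ h) : 0 ≤ wellLevel h := le_min h0 zero_le_one

theorem wellLevel_le_one (h : ℝ) : wellLevel h ≤ 1 := min_le_right _ _

/-- The difference of the two sides is `(h - k)(k - z.re)`. It vanishes for `h ≤ 1`, and for `h ≥ 1`
both factors are nonnegative because `k = 1`. -/
theorem half_sq_le_anisotropy (h : ℝ) {z : ℂ} (hz : ‖z‖ = 1) :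
    (z.re - wellLevel h) ^ 2 / 2 ≤ anisotropy h z := by
  have hre : z.re ≤ 1 := hz ▸ Complex.re_le_norm z
  have h1 : 0 ≤ (h - wellLevel h) * (wellLevel h - z.re) := by
    rcases le_total h 1 with hh | hh
    · simp [wellLevel, min_eq_left hh]
    · rw [wellLevel, min_eq_right hh]; exact mul_nonneg (by linarith) (by linarith)
  rw [anisotropy]; nlinarith

theorem anisotropy_nonneg (h : ℝ) {z : ℂ} (hz : ‖z‖ = 1) : 0 ≤ anisotropy h z :=
  le_trans (by positivity) (half_sq_le_anisotropy h hz)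

theorem continuous_anisotropy (h : ℝ) : Continuous (anisotropy h) := by
  unfold anisotropy; fun_prop

theorem anisotropy_congr (h : ℝ) {z w : ℂ} (hzw : z.re = w.re) : anisotropy h z = anisotropy h w := by
  rw [anisotropy, anisotropy, hzw]

/-- The density of the local energy. -/
noncomputable def localDensity (h : ℝ) (m : ℝ → ℂ) (t : ℝ) : ℝ :=
  ‖deriv m t‖ ^ 2 + 2 * anisotropy h (m t)

/-- The local part of the energy. -/
noncomputable def localEnergy (h : ℝ) (m : ℝ → ℂ) : ℝ≥0∞ :=
  ∫⁻ t, ENNReal.ofReal (localDensity h m t)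

theorem energy_eq (h : ℝ) (m : ℝ → ℂ) :
    energy h m = 2⁻¹ * localEnergy h m + 2⁻¹ * strayFieldDirichlet (fun t => (m t).re) := rfl

section

variable {h : ℝ} {m : ℝ → ℂ}

theorem measurable_localDensity (h : ℝ) (hm : Continuous m) : Measurable (localDensity h m) :=
  ((measurable_deriv m).norm.pow_const 2).add
    (((continuous_anisotropy h).comp hm).measurable.const_mul 2)

theorem localDensity_nonneg (hm : ∀ t, ‖m t‖ = 1) (t : ℝ) : 0 ≤ localDensity h m t :=
  add_nonneg (sq_nonneg _) (mul_nonneg zero_le_two (anisotropy_nonneg h (hm t)))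

theorem norm_deriv_sq_le_localDensity (hm : ∀ t, ‖m t‖ = 1) (t : ℝ) :
    ‖deriv m t‖ ^ 2 ≤ localDensity h m t :=
  le_add_of_nonneg_right (mul_nonneg zero_le_two (anisotropy_nonneg h (hm t)))

theorem sq_re_sub_le_localDensity (hm : ∀ t, ‖m t‖ = 1) (t : ℝ) :
    ((m t).re - wellLevel h) ^ 2 ≤ localDensity h m t := by
  have := half_sq_le_anisotropy h (hm t)
  rw [localDensity]; nlinarith [sq_nonneg ‖deriv m t‖]

theorem integrable_localDensity (hm : ∀ t, ‖m t‖ = 1) (hc : Continuous m)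
    (hE : localEnergy h m < ⊤) : Integrable (localDensity h m) := by
  refine ⟨(measurable_localDensity h hc).aestronglyMeasurable, ?_⟩
  rw [hasFiniteIntegral_iff_ofReal (Eventually.of_forall (localDensity_nonneg hm))]
  exact hE

theorem localEnergy_lt_top (hE : energy h m < ⊤) : localEnergy h m < ⊤ := by
  rw [energy_eq, ENNReal.add_lt_top] at hE
  have := hE.1
  by_contra hcon
  rw [not_lt, top_le_iff] at hcon
  simp [hcon] at this

theorem strayField_lt_top (hE : energy h m < ⊤) :
    strayFieldDirichlet (fun t => (m t).re) < ⊤ := by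
  rw [energy_eq, ENNReal.add_lt_top] at hE
  have := hE.2
  by_contra hcon
  rw [not_lt, top_le_iff] at hcon
  simp [hcon] at this

theorem integrable_norm_deriv_sq (hm : ∀ t, ‖m t‖ = 1) (hc : Continuous m)
    (hE : localEnergy h m < ⊤) : Integrable (fun t => ‖deriv m t‖ ^ 2) := by
  refine (integrable_localDensity hm hc hE).mono'
    ((measurable_deriv m).norm.pow_const 2).aestronglyMeasurable
    (Eventually.of_forall fun t => ?_)
  rw [Real.norm_of_nonneg (sq_nonneg _)]
  exact norm_deriv_sq_le_localDensity hm t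

theorem integrable_sq_re_sub (hm : ∀ t, ‖m t‖ = 1) (hc : Continuous m)
    (hE : localEnergy h m < ⊤) : Integrable (fun t => ((m t).re - wellLevel h) ^ 2) := by
  refine (integrable_localDensity hm hc hE).mono' (by fun_prop)
    (Eventually.of_forall fun t => ?_)
  rw [Real.norm_of_nonneg (sq_nonneg _)]
  exact sq_re_sub_le_localDensity hm t

/-- Maps of finite local energy are uniformly continuous, with a modulus that only depends on the
energy. -/
theorem LocAC.norm_sub_le_of_sq (hm : LocAC m) (hI : Integrable fun t => ‖deriv m t‖ ^ 2) {r : ℝ}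
    (hr : 0 < r) {a b : ℝ} (hab : a ≤ b) :
    ‖m b - m a‖ ≤ r * (∫ t in Set.Ioc a b, ‖deriv m t‖ ^ 2) + r⁻¹ * (b - a) := by
  refine (hm.norm_sub_le hab).trans ?_
  have hi := locallyIntegrable_iff_intervalIntegrable.1
    (locallyIntegrable_norm hm.locallyIntegrable_deriv_complex) a b
  have hi2 : IntervalIntegrable (fun t => ‖deriv m t‖ ^ 2) volume a b := hI.intervalIntegrable
  calc ∫ t in a..b, ‖deriv m t‖ ≤ ∫ t in a..b, (r * ‖deriv m t‖ ^ 2 + r⁻¹) := by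
        refine intervalIntegral.integral_mono_on hab hi
          ((hi2.const_mul r).add intervalIntegrable_const) fun t _ => ?_
        have h1 : r * r⁻¹ = 1 := mul_inv_cancel₀ hr.ne'
        have h2 : 0 < r⁻¹ := inv_pos.2 hr
        -- The expanded square gives `2‖m'‖ ≤ r‖m'‖² + r⁻¹`, which is more than is needed.
        have h3 : 0 ≤ r⁻¹ * (r * ‖deriv m t‖ - 1) ^ 2 := by positivity
        have h4 : r⁻¹ * (r * ‖deriv m t‖ - 1) ^ 2 = (r * r⁻¹) * (r * ‖deriv m t‖ ^ 2) -
          2 * (r * r⁻¹) * ‖deriv m t‖ + r⁻¹ := by ring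
        rw [h4, h1] at h3
        nlinarith [norm_nonneg (deriv m t)]
    _ = _ := by
        rw [intervalIntegral.integral_add (hi2.const_mul r) intervalIntegrable_const,
          intervalIntegral.integral_const_mul, intervalIntegral.integral_const,
          intervalIntegral.integral_of_le hab, smul_eq_mul, mul_comm (b - a)]

theorem LocAC.norm_sub_le_of_energy (hm : LocAC m) (hI : Integrable fun t => ‖deriv m t‖ ^ 2)
    {C : ℝ} (hC : ∫ t, ‖deriv m t‖ ^ 2 ≤ C) {r : ℝ} (hr : 0 < r) (a b : ℝ) :
    ‖m b - m a‖ ≤ r * C + r⁻¹ * |b - a| := by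
  wlog hab : a ≤ b generalizing a b
  · rw [norm_sub_rev, abs_sub_comm]; exact this b a (le_of_not_ge hab)
  refine (hm.norm_sub_le_of_sq hI hr hab).trans ?_
  rw [abs_of_nonneg (by linarith)]
  have : ∫ t in Set.Ioc a b, ‖deriv m t‖ ^ 2 ≤ C :=
    (setIntegral_le_integral hI (Eventually.of_forall fun t => sq_nonneg _)).trans hC
  gcongr

/-- Pointwise limits of maps of uniformly bounded energy are absolutely continuous. -/
theorem locAC_of_tendsto {m : ℕ → ℝ → ℂ} {μ : ℝ → ℂ} (hm : ∀ n, LocAC (m n))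
    (hI : ∀ n, Integrable fun t => ‖deriv (m n) t‖ ^ 2) {C : ℝ}
    (hC : ∀ n, ∫ t, ‖deriv (m n) t‖ ^ 2 ≤ C)
    (hlim : ∀ t, Tendsto (fun n => m n t) atTop (𝓝 (μ t))) : LocAC μ := by
  intro a b
  rw [absolutelyContinuousOnInterval_iff]
  intro ε hε
  have hC0 : 0 ≤ C := (integral_nonneg fun t => sq_nonneg _).trans (hC 0)
  obtain ⟨r, hr, hrC⟩ : ∃ r > 0, r * C < ε / 2 := by
    refine ⟨ε / (2 * (C + 1)), by positivity, ?_⟩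
    rw [div_mul_eq_mul_div, div_lt_div_iff₀ (by positivity) (by positivity)]
    nlinarith
  -- The factor `r` in this `δ` absorbs the `r⁻¹` of the increment estimate.
  refine ⟨r * (ε / 2), by positivity, fun I hI' hs => ?_⟩
  have hsum : ∀ n, ∑ i ∈ Finset.range I.1, dist (m n (I.2 i).1) (m n (I.2 i).2) ≤
      r * C + r⁻¹ * ∑ i ∈ Finset.range I.1, dist (I.2 i).1 (I.2 i).2 := by
    intro n
    have h1 : ∀ i ∈ Finset.range I.1, dist (m n (I.2 i).1) (m n (I.2 i).2) ≤
        r * (∫ t in Set.uIoc (I.2 i).1 (I.2 i).2, ‖deriv (m n) t‖ ^ 2) +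
          r⁻¹ * dist (I.2 i).1 (I.2 i).2 := by
      intro i _
      rcases le_total (I.2 i).1 (I.2 i).2 with h | h
      · rw [dist_comm, dist_eq_norm, Set.uIoc_of_le h, dist_comm, Real.dist_eq,
          abs_of_nonneg (by linarith)]
        exact (hm n).norm_sub_le_of_sq (hI n) hr h
      · rw [dist_eq_norm, Set.uIoc_of_ge h, Real.dist_eq, abs_of_nonneg (by linarith)]
        exact (hm n).norm_sub_le_of_sq (hI n) hr h
    refine (Finset.sum_le_sum h1).trans ?_
    rw [Finset.sum_add_distrib, ← Finset.mul_sum, ← Finset.mul_sum,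
      ← integral_biUnion_finset _ (fun _ _ => measurableSet_uIoc) hI'.2
        (fun _ _ => (hI n).integrableOn)]
    gcongr
    exact (setIntegral_le_integral (hI n) (Eventually.of_forall fun t => sq_nonneg _)).trans (hC n)
  have h2 : ∑ i ∈ Finset.range I.1, dist (μ (I.2 i).1) (μ (I.2 i).2) ≤
      r * C + r⁻¹ * ∑ i ∈ Finset.range I.1, dist (I.2 i).1 (I.2 i).2 :=
    le_of_tendsto' (tendsto_finsetSum _ fun i _ => (hlim _).dist (hlim _)) hsum
  have h3 : r⁻¹ * ∑ i ∈ Finset.range I.1, dist (I.2 i).1 (I.2 i).2 < ε / 2 := by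
    rw [inv_mul_lt_iff₀ hr]; exact hs
  linarith

/-! ### Difference quotients -/

/-- This is Jensen's inequality for the average of `m'`. Difference quotients, unlike derivatives,
pass to the limit under pointwise convergence, which is how lower semicontinuity is obtained in
`sum_localEnergy_le`. -/
theorem sq_diffQuotient_le (hm : LocAC m)
    (hI : ∀ a b : ℝ, IntervalIntegrable (fun t => ‖deriv m t‖ ^ 2) volume a b) {s : ℝ} (hs : 0 < s)
    (t : ℝ) : ‖m (t + s) - m t‖ ^ 2 / s ^ 2 ≤ s⁻¹ * ∫ u in t..t + s, ‖deriv m u‖ ^ 2 := by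
  have hab : t ≤ t + s := by linarith
  obtain ⟨A, hA⟩ : ∃ A, A = ‖m (t + s) - m t‖ / s := ⟨_, rfl⟩
  have hA0 : 0 ≤ A := hA ▸ by positivity
  have h1 : A * s ≤ ∫ u in t..t + s, ‖deriv m u‖ := by
    rw [hA, div_mul_cancel₀ _ hs.ne']; exact hm.norm_sub_le hab
  have hi := locallyIntegrable_iff_intervalIntegrable.1
    (locallyIntegrable_norm hm.locallyIntegrable_deriv_complex) t (t + s)
  -- With `A` the size of the difference quotient, the integrated inequality `2A‖m'‖ ≤ A² + ‖m'‖²`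
  -- yields `2A²s ≤ A²s + ∫‖m'‖²`.
  have h2 : ∫ u in t..t + s, 2 * A * ‖deriv m u‖ ≤
      ∫ u in t..t + s, (A ^ 2 + ‖deriv m u‖ ^ 2) := by
    refine intervalIntegral.integral_mono_on hab (hi.const_mul _)
      (intervalIntegrable_const.add (hI _ _)) fun u _ => ?_
    nlinarith [sq_nonneg (A - ‖deriv m u‖)]
  rw [intervalIntegral.integral_const_mul, intervalIntegral.integral_add intervalIntegrable_const
    (hI _ _), intervalIntegral.integral_const, smul_eq_mul] at h2
  have h3 : A ^ 2 ≤ s⁻¹ * ∫ u in t..t + s, ‖deriv m u‖ ^ 2 := by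
    rw [le_inv_mul_iff₀ hs]
    nlinarith
  rwa [hA, div_pow] at h3

theorem MemH1locCircle.intervalIntegrable_sq (hm : MemH1locCircle m) (a b : ℝ) :
    IntervalIntegrable (fun t => ‖deriv m t‖ ^ 2) volume a b := by
  rw [intervalIntegrable_iff]
  refine IntegrableOn.mono_set ?_ Set.uIoc_subset_uIcc
  refine ⟨((measurable_deriv m).norm.pow_const 2).aestronglyMeasurable, ?_⟩
  rw [hasFiniteIntegral_iff_ofReal (Eventually.of_forall fun t => sq_nonneg _)]
  exact (memH1locCircle_iff.1 hm).2.2 _ _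

/-- The pointwise bound is integrated and the order of integration exchanged. Each shift `u ≤ s ≤ 1`
keeps the window inside the enlargement by `1`. -/
theorem lintegral_diffQuotient_le (hm : MemH1locCircle m) {s : ℝ} (hs : 0 < s) (hs1 : s ≤ 1)
    (a b : ℝ) :
    ∫⁻ t in Set.Icc a b, ENNReal.ofReal (‖m (t + s) - m t‖ ^ 2 / s ^ 2) ≤
      ∫⁻ t in Set.Icc (a - 1) (b + 1), ENNReal.ofReal (‖deriv m t‖ ^ 2) := by
  have hmeas : Measurable fun t => ENNReal.ofReal (‖deriv m t‖ ^ 2) :=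
    ((measurable_deriv m).norm.pow_const 2).ennreal_ofReal
  have h1 : ∀ t, ENNReal.ofReal (‖m (t + s) - m t‖ ^ 2 / s ^ 2) ≤ ENNReal.ofReal s⁻¹ *
      ∫⁻ u in Set.Ioc 0 s, ENNReal.ofReal (‖deriv m (t + u)‖ ^ 2) := by
    intro t
    refine (ENNReal.ofReal_le_ofReal
      (sq_diffQuotient_le hm.locAC hm.intervalIntegrable_sq hs t)).trans ?_
    rw [ENNReal.ofReal_mul (by positivity)]
    gcongr
    have h2 := intervalIntegral.integral_comp_add_left (a := 0) (b := s)
      (fun u => ‖deriv m u‖ ^ 2) t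
    rw [add_zero] at h2
    rw [← h2, intervalIntegral.integral_of_le hs.le]
    have h3 := (hm.intervalIntegrable_sq t (t + s)).comp_add_left t
    simp only [sub_self, add_sub_cancel_left] at h3
    rw [ofReal_integral_eq_lintegral_ofReal h3.1 (Eventually.of_forall fun _ => sq_nonneg _)]
  have hswap : ∫⁻ t in Set.Icc a b, ∫⁻ u in Set.Ioc 0 s, ENNReal.ofReal (‖deriv m (t + u)‖ ^ 2) =
      ∫⁻ u in Set.Ioc 0 s, ∫⁻ t in Set.Icc a b, ENNReal.ofReal (‖deriv m (t + u)‖ ^ 2) :=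
    lintegral_lintegral_swap (hmeas.comp measurable_add).aemeasurable
  have hmeas2 : Measurable fun t => ∫⁻ u in Set.Ioc 0 s,
      ENNReal.ofReal (‖deriv m (t + u)‖ ^ 2) :=
    Measurable.lintegral_prod_right (hmeas.comp measurable_add)
  refine (lintegral_mono h1).trans ?_
  rw [lintegral_const_mul _ hmeas2, hswap]
  have h4 : ∀ u ∈ Set.Ioc 0 s, ∫⁻ t in Set.Icc a b, ENNReal.ofReal (‖deriv m (t + u)‖ ^ 2) ≤
      ∫⁻ t in Set.Icc (a - 1) (b + 1), ENNReal.ofReal (‖deriv m t‖ ^ 2) := by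
    intro u hu
    have h5 := (measurePreserving_add_right (volume : Measure ℝ) u).setLIntegral_comp_preimage_emb
      (MeasurableEquiv.addRight u).measurableEmbedding
      (fun t => ENNReal.ofReal (‖deriv m t‖ ^ 2)) (Set.Icc (a + u) (b + u))
    have h6 : (fun x => x + u) ⁻¹' Set.Icc (a + u) (b + u) = Set.Icc a b := by ext; simp
    rw [h6] at h5
    rw [h5]
    exact lintegral_mono_set (Set.Icc_subset_Icc (by linarith [hu.1]) (by linarith [hu.2]))
  calc ENNReal.ofReal s⁻¹ * ∫⁻ u in Set.Ioc 0 s, ∫⁻ t in Set.Icc a b,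
        ENNReal.ofReal (‖deriv m (t + u)‖ ^ 2)
      ≤ ENNReal.ofReal s⁻¹ * ∫⁻ u in Set.Ioc 0 s, ∫⁻ t in Set.Icc (a - 1) (b + 1),
        ENNReal.ofReal (‖deriv m t‖ ^ 2) := by
        gcongr 1
        exact setLIntegral_mono' measurableSet_Ioc h4
    _ = _ := by
        rw [lintegral_const, Measure.restrict_apply_univ, Real.volume_Ioc, sub_zero, mul_left_comm,
          ← ENNReal.ofReal_mul (by positivity), inv_mul_cancel₀ hs.ne', ENNReal.ofReal_one, mul_one]

theorem tendsto_sq_diffQuotient {t : ℝ} (h : HasDerivAt m (deriv m t) t) :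
    Tendsto (fun s : ℝ => ‖m (t + s) - m t‖ ^ 2 / s ^ 2) (𝓝[>] 0) (𝓝 (‖deriv m t‖ ^ 2)) := by
  refine (h.tendsto_slope_zero_right.norm.pow 2).congr fun s => ?_
  rw [norm_smul, norm_inv, mul_pow, inv_pow, Real.norm_eq_abs, sq_abs, inv_mul_eq_div]

/-- The local energies of finitely many profiles that separate from one another are recovered in
the limit. -/
theorem sum_localEnergy_le {ι : Type*} (J : Finset ι) {m : ℕ → ℝ → ℂ}
    (hm : ∀ n, MemH1locCircle (m n)) {x : ℕ → ι → ℝ} {μ : ι → ℝ → ℂ} (hμ : ∀ j ∈ J, LocAC (μ j))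
    (hlim : ∀ j ∈ J, ∀ t, Tendsto (fun n => m n (t + x n j)) atTop (𝓝 (μ j t)))
    (hsep : ∀ i ∈ J, ∀ j ∈ J, i ≠ j → Tendsto (fun n => |x n i - x n j|) atTop atTop)
    {L₀ : ℝ≥0∞} (hL : Tendsto (fun n => localEnergy h (m n)) atTop (𝓝 L₀)) :
    ∑ j ∈ J, localEnergy h (μ j) ≤ L₀ := by
  have hG : ∀ (μ : ℝ → ℂ) (s : ℝ), Continuous μ → Continuous fun t =>
      ‖μ (t + s) - μ t‖ ^ 2 / s ^ 2 + 2 * anisotropy h (μ t) := by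
    intro μ s hμ
    have := continuous_anisotropy h
    fun_prop
  -- For fixed `s` the integrands with difference quotients converge pointwise as `n → ∞`, so
  -- Fatou's lemma applies.
  have step1 : ∀ R s : ℝ, 0 < s → s ≤ 1 → ∫⁻ t in Set.Icc (-R) R, ∑ j ∈ J,
      ENNReal.ofReal (‖μ j (t + s) - μ j t‖ ^ 2 / s ^ 2 + 2 * anisotropy h (μ j t)) ≤ L₀ := by
    intro R s hs hs1
    let F : ℕ → ℝ → ℝ≥0∞ := fun n t => ∑ j ∈ J,
      ENNReal.ofReal (‖m n (t + s + x n j) - m n (t + x n j)‖ ^ 2 / s ^ 2 +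
        2 * anisotropy h (m n (t + x n j)))
    have hFm : ∀ n j, Measurable fun t =>
        ENNReal.ofReal (‖m n (t + s + x n j) - m n (t + x n j)‖ ^ 2 / s ^ 2 +
        2 * anisotropy h (m n (t + x n j))) := by
      intro n j
      have := hG (fun t => m n (t + x n j)) s ((hm n).continuous.comp (by fun_prop))
      exact this.measurable.ennreal_ofReal
    have hFlim : ∀ t, Tendsto (fun n => F n t) atTop (𝓝 (∑ j ∈ J,
        ENNReal.ofReal (‖μ j (t + s) - μ j t‖ ^ 2 / s ^ 2 + 2 * anisotropy h (μ j t)))) := by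
      intro t
      refine tendsto_finsetSum _ fun j hj => ENNReal.tendsto_ofReal ?_
      refine ((((hlim j hj (t + s)).sub (hlim j hj t)).norm.pow 2).div_const _).add ?_
      exact (((continuous_anisotropy h).tendsto _).comp (hlim j hj t)).const_mul 2
    have hFle : ∀ᶠ n in atTop, ∫⁻ t in Set.Icc (-R) R, F n t ≤ localEnergy h (m n) := by
      -- This distance makes the windows of half-width `R + 1` around the centres disjoint, so their
      -- energies add.
      have hdisj : ∀ᶠ n in atTop, ∀ i ∈ J, ∀ j ∈ J, i ≠ j →
          2 * (R + 1) < |x n i - x n j| := by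
        simp only [Filter.eventually_all_finset]
        intro i hi j hj
        by_cases hij : i = j
        · simp [hij]
        · filter_upwards [(hsep i hi j hj hij).eventually_gt_atTop (2 * (R + 1))] with n hn _
            using hn
      filter_upwards [hdisj] with n hn
      have hone : ∀ j, ∫⁻ t in Set.Icc (-R) R,
          ENNReal.ofReal (‖m n (t + s + x n j) - m n (t + x n j)‖ ^ 2 / s ^ 2 +
            2 * anisotropy h (m n (t + x n j))) ≤
          ∫⁻ t in Set.Icc (x n j - R - 1) (x n j + R + 1),
            ENNReal.ofReal (localDensity h (m n) t) := by
        intro j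
        have e1 := (measurePreserving_add_right (volume : Measure ℝ)
          (x n j)).setLIntegral_comp_preimage_emb
          (MeasurableEquiv.addRight (x n j)).measurableEmbedding
          (fun t => ENNReal.ofReal (‖m n (t + s) - m n t‖ ^ 2 / s ^ 2 +
            2 * anisotropy h (m n t))) (Set.Icc (x n j - R) (x n j + R))
        have e2 : (fun y => y + x n j) ⁻¹' Set.Icc (x n j - R) (x n j + R) = Set.Icc (-R) R := by
          ext y; simp only [Set.mem_preimage, Set.mem_Icc]
          constructor <;> rintro ⟨p, q⟩ <;> constructor <;> linarith
        rw [e2] at e1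
        simp only [add_right_comm _ (x n j) s] at e1
        rw [e1]
        have hW : ∀ t, 0 ≤ 2 * anisotropy h (m n t) := fun t =>
          mul_nonneg zero_le_two (anisotropy_nonneg h ((hm n).1 t))
        have hWm : Measurable fun t => ENNReal.ofReal (2 * anisotropy h (m n t)) :=
          (((continuous_anisotropy h).comp (hm n).continuous).measurable.const_mul 2).ennreal_ofReal
        simp_rw [localDensity, fun t => ENNReal.ofReal_add (sq_nonneg ‖deriv (m n) t‖) (hW t),
          fun t => ENNReal.ofReal_add (div_nonneg (sq_nonneg ‖m n (t + s) - m n t‖) (sq_nonneg s))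
            (hW t)]
        rw [lintegral_add_right _ hWm, lintegral_add_right _ hWm]
        refine add_le_add (lintegral_diffQuotient_le (hm n) hs hs1 _ _) ?_
        exact lintegral_mono_set (Set.Icc_subset_Icc (by linarith) (by linarith))
      rw [lintegral_finsetSum _ fun j _ => hFm n j]
      refine (Finset.sum_le_sum fun j _ => hone j).trans ?_
      rw [← lintegral_biUnion_finset _ fun _ _ => measurableSet_Icc]
      · exact setLIntegral_le_lintegral _ _
      · intro i hi j hj hij
        rw [Function.onFun, Set.disjoint_left]
        rintro y ⟨h1, h2⟩ ⟨h3, h4⟩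
        have h5 := hn i hi j hj hij
        have : |x n i - x n j| ≤ 2 * (R + 1) := abs_le.2 ⟨by linarith, by linarith⟩
        linarith
    have hfat := lintegral_liminf_le (μ := volume.restrict (Set.Icc (-R) R)) (u := atTop)
      (f := F) fun n => Finset.measurable_fun_sum _ fun j _ => hFm n j
    simp_rw [fun t => (hFlim t).liminf_eq] at hfat
    refine hfat.trans ?_
    rw [← hL.liminf_eq]
    exact liminf_le_liminf hFle
  -- A second use of Fatou's lemma, now for `s → 0`, turns the difference quotients of the profiles
  -- into derivatives.
  have step2 : ∀ R : ℝ, ∫⁻ t in Set.Icc (-R) R, ∑ j ∈ J, ENNReal.ofReal (localDensity h (μ j) t)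
      ≤ L₀ := by
    intro R
    let s : ℕ → ℝ := fun k => 1 / ((k : ℝ) + 1)
    have hs : ∀ k, 0 < s k ∧ s k ≤ 1 := fun k => ⟨by positivity, by
      simp only [s]; rw [div_le_one (by positivity)]; linarith [Nat.cast_nonneg (α := ℝ) k]⟩
    have hslim : Tendsto s atTop (𝓝[>] 0) :=
      tendsto_nhdsWithin_iff.2 ⟨tendsto_one_div_add_atTop_nhds_zero_nat,
        Eventually.of_forall fun k => (hs k).1⟩
    let F : ℕ → ℝ → ℝ≥0∞ := fun k t => ∑ j ∈ J, ENNReal.ofReal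
      (‖μ j (t + s k) - μ j t‖ ^ 2 / s k ^ 2 + 2 * anisotropy h (μ j t))
    have hfat := lintegral_liminf_le (μ := volume.restrict (Set.Icc (-R) R)) (u := atTop)
      (f := F) fun k => Finset.measurable_fun_sum _ fun j hj =>
        (hG (μ j) (s k) (hμ j hj).continuous).measurable.ennreal_ofReal
    refine le_trans (le_of_eq ?_) (hfat.trans ?_)
    · refine lintegral_congr_ae (ae_restrict_of_ae ?_)
      have hae : ∀ᵐ t, ∀ j ∈ J, HasDerivAt (μ j) (deriv (μ j) t) t :=
        (Filter.eventually_all_finset J).2 fun j hj => (hμ j hj).ae_hasDerivAt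
      filter_upwards [hae] with t ht
      refine (Tendsto.liminf_eq ?_).symm
      refine tendsto_finsetSum _ fun j hj => ENNReal.tendsto_ofReal (Tendsto.add_const _ ?_)
      exact (tendsto_sq_diffQuotient (ht j hj)).comp hslim
    · refine (liminf_le_liminf (Eventually.of_forall fun k => step1 R (s k) (hs k).1 (hs k).2)).trans
        ?_
      rw [liminf_const]
  have hmeas : ∀ j ∈ J, Measurable fun t => ENNReal.ofReal (localDensity h (μ j) t) := fun j hj =>
    (measurable_localDensity h (hμ j hj).continuous).ennreal_ofReal
  rw [show ∑ j ∈ J, localEnergy h (μ j) = ∫⁻ t, ∑ j ∈ J, ENNReal.ofReal (localDensity h (μ j) t)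
    from (lintegral_finsetSum' _ fun j hj => (hmeas j hj).aemeasurable).symm,
    ← setLIntegral_univ]
  have hU : (Set.univ : Set ℝ) = ⋃ n : ℕ, Set.Icc (-(n : ℝ)) n := by
    symm; rw [Set.eq_univ_iff_forall]
    intro t
    obtain ⟨n, hn⟩ := exists_nat_ge |t|
    exact Set.mem_iUnion.2 ⟨n, abs_le.1 hn⟩
  rw [hU, setLIntegral_iUnion_of_directed]
  · exact iSup_le fun n => step2 n
  · refine directed_of_isDirected_le fun a b hab => ?_
    have : (a : ℝ) ≤ b := by exact_mod_cast hab
    exact Set.Icc_subset_Icc (by linarith) this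

end

/-! ### Operations on maps of finite energy -/

section Bounds

variable {E : Type*} [NormedAddCommGroup E]

/-- An integral bound on increments may be checked on both sides of a point. -/
theorem bound_of_split {f : ℝ → E} {G : ℝ → ℝ} (hG : LocallyIntegrable G) (c : ℝ)
    (h1 : ∀ a b, a ≤ b → b ≤ c → ‖f b - f a‖ ≤ ∫ t in a..b, G t)
    (h2 : ∀ a b, c ≤ a → a ≤ b → ‖f b - f a‖ ≤ ∫ t in a..b, G t) (a b : ℝ) (hab : a ≤ b) :
    ‖f b - f a‖ ≤ ∫ t in a..b, G t := by
  have hI := locallyIntegrable_iff_intervalIntegrable.1 hG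
  rcases le_total b c with hb | hb
  · exact h1 a b hab hb
  rcases le_total c a with ha | ha
  · exact h2 a b ha hab
  rw [← intervalIntegral.integral_add_adjacent_intervals (hI a c) (hI c b)]
  calc ‖f b - f a‖ = ‖(f c - f a) + (f b - f c)‖ := by congr 1; abel
    _ ≤ _ := (norm_add_le _ _).trans (add_le_add (h1 a c ha le_rfl) (h2 c b le_rfl hb))

theorem LocAC.comp_neg {m : ℝ → ℂ} (hm : LocAC m) : LocAC fun t => m (-t) := by
  have hl := locallyIntegrable_norm hm.locallyIntegrable_deriv_complex
  have hl' : LocallyIntegrable fun t => ‖deriv m (-t)‖ := by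
    rw [locallyIntegrable_iff_intervalIntegrable]
    intro a b
    have := (locallyIntegrable_iff_intervalIntegrable.1 hl (-a) (-b))
    simpa using (IntervalIntegrable.iff_comp_neg).1 this
  refine locAC_of_bound hl' fun a b hab => ?_
  rw [intervalIntegral.integral_comp_neg (fun t => ‖deriv m t‖), norm_sub_rev]
  exact hm.norm_sub_le (by linarith)

theorem LocAC.comp_max {m : ℝ → ℂ} (hm : LocAC m) (c : ℝ) : LocAC fun t => m (max t c) := by
  have hl := locallyIntegrable_norm hm.locallyIntegrable_deriv_complex
  refine locAC_of_bound hl (bound_of_split hl c (fun a b hab hb => ?_) fun a b ha hab => ?_)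
  · rw [max_eq_right hb, max_eq_right (hab.trans hb), sub_self, norm_zero]
    exact intervalIntegral.integral_nonneg hab fun _ _ => norm_nonneg _
  · rw [max_eq_left ha, max_eq_left (ha.trans hab)]
    exact hm.norm_sub_le hab

theorem LocAC.evenRight {m : ℝ → ℂ} (hm : LocAC m) : LocAC fun t => m |t| := by
  have h := ((hm.comp_max 0).add (hm.comp_max 0).comp_neg).sub_const (m 0)
  have heq : (fun t => m |t|) = fun t => m (max t 0) + m (max (-t) 0) - m 0 := by
    funext t
    rcases le_total 0 t with ht | ht
    · simp [abs_of_nonneg ht, max_eq_left ht, max_eq_right (neg_nonpos.2 ht)]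
    · simp [abs_of_nonpos ht, max_eq_right ht, max_eq_left (neg_nonneg.2 ht)]
  rw [heq]; exact h

theorem LocAC.evenLeft {m : ℝ → ℂ} (hm : LocAC m) : LocAC fun t => m (-|t|) :=
  hm.comp_neg.evenRight

end Bounds

section

variable {h : ℝ} {m m' : ℝ → ℂ}

theorem memH1locCircle_of_localEnergy (h1 : ∀ t, ‖m t‖ = 1) (hAC : LocAC m)
    (hE : localEnergy h m < ⊤) : MemH1locCircle m := by
  refine memH1locCircle_iff.2 ⟨h1, hAC, fun a b => lt_of_le_of_lt ?_ hE⟩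
  refine (setLIntegral_le_lintegral _ _).trans (lintegral_mono fun t => ?_)
  exact ENNReal.ofReal_le_ofReal (norm_deriv_sq_le_localDensity h1 t)

theorem energy_le_of_norm_deriv_le (hre : ∀ t, (m' t).re = (m t).re)
    (hd : ∀ᵐ t, ‖deriv m' t‖ ≤ ‖deriv m t‖) : energy h m' ≤ energy h m := by
  have : (fun t => (m' t).re) = fun t => (m t).re := funext hre
  rw [energy_eq, energy_eq, this]
  gcongr 2⁻¹ * ?_ + _
  refine lintegral_mono_ae ?_
  filter_upwards [hd] with t ht
  refine ENNReal.ofReal_le_ofReal ?_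
  rw [localDensity, localDensity, anisotropy_congr h (hre t)]
  gcongr

/-- Folding: a continuous map that agrees with `m` up to complex conjugation at each point. -/
theorem LocAC.fold_bound (hm : LocAC m) (hc : Continuous m')
    (hmm : ∀ t, m' t = m t ∨ m' t = (starRingEnd ℂ) (m t)) (a b : ℝ) (hab : a ≤ b) :
    ‖m' b - m' a‖ ≤ ∫ t in a..b, ‖deriv m t‖ := by
  have hI := locallyIntegrable_iff_intervalIntegrable.1
    (locallyIntegrable_norm hm.locallyIntegrable_deriv_complex)
  have conjb : ∀ {a b : ℝ}, a ≤ b → ‖(starRingEnd ℂ) (m b) - (starRingEnd ℂ) (m a)‖ ≤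
      ∫ t in a..b, ‖deriv m t‖ := by
    intro a b hab
    rw [← map_sub, RCLike.norm_conj]; exact hm.norm_sub_le hab
  have hclosed1 : IsClosed {t | m' t = m t} := isClosed_eq hc hm.continuous
  have hclosed2 : IsClosed {t | m' t = (starRingEnd ℂ) (m t)} :=
    isClosed_eq hc (Complex.continuous_conj.comp hm.continuous)
  -- The two alternatives hold on closed sets that cover the interval. If different ones hold at the
  -- two ends, connectedness gives a point where both hold, and the increment is split there.
  have hconn := isPreconnected_closed_iff.1 (isPreconnected_Icc (a := a) (b := b)) _ _ hclosed1
    hclosed2 (fun t _ => hmm t)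
  have ha : a ∈ Set.Icc a b := ⟨le_rfl, hab⟩
  have hb : b ∈ Set.Icc a b := ⟨hab, le_rfl⟩
  have tri : ∀ c, ‖m' b - m' a‖ ≤ ‖m' c - m' a‖ + ‖m' b - m' c‖ := by
    intro c
    calc ‖m' b - m' a‖ = ‖(m' c - m' a) + (m' b - m' c)‖ := by congr 1; abel
      _ ≤ _ := norm_add_le _ _
  rcases hmm a with h1 | h1 <;> rcases hmm b with h2 | h2
  · rw [h1, h2]; exact hm.norm_sub_le hab
  · obtain ⟨c, hc, h3, h4⟩ := hconn ⟨a, ha, h1⟩ ⟨b, hb, h2⟩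
    rw [← intervalIntegral.integral_add_adjacent_intervals (hI a c) (hI c b)]
    refine (tri c).trans (add_le_add ?_ ?_)
    · rw [show m' c = m c from h3, h1]; exact hm.norm_sub_le hc.1
    · rw [show m' c = _ from h4, h2]; exact conjb hc.2
  · obtain ⟨c, hc, h3, h4⟩ := hconn ⟨b, hb, h2⟩ ⟨a, ha, h1⟩
    rw [← intervalIntegral.integral_add_adjacent_intervals (hI a c) (hI c b)]
    refine (tri c).trans (add_le_add ?_ ?_)
    · rw [show m' c = _ from h4, h1]; exact conjb hc.1
    · rw [show m' c = m c from h3, h2]; exact hm.norm_sub_le hc.2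
  · rw [h1, h2]; exact conjb hab

/-- Conjugation preserves the first component, and `fold_bound` controls the derivative. The lemma
serves both for folding into the upper half-circle and for unfolding by a phase. -/
theorem MemH1locCircle.fold (hm : MemH1locCircle m) (hc : Continuous m')
    (hmm : ∀ t, m' t = m t ∨ m' t = (starRingEnd ℂ) (m t)) :
    MemH1locCircle m' ∧ energy h m' ≤ energy h m := by
  have hl := locallyIntegrable_norm hm.locAC.locallyIntegrable_deriv_complex
  have hb := hm.locAC.fold_bound hc hmm
  refine ⟨MemH1locCircle.of_bound (fun t => ?_) hl ((memH1locCircle_iff.1 hm).2.2) hb,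
    energy_le_of_norm_deriv_le (fun t => ?_) (norm_deriv_le_of_bound hl hb)⟩
  · rcases hmm t with h | h
    · rw [h, hm.1]
    · rw [h, RCLike.norm_conj, hm.1]
  · rcases hmm t with h | h
    · rw [h]
    · rw [h, Complex.conj_re]

theorem eq_or_eq_conj {z w : ℂ} (hz : ‖z‖ = 1) (hw : ‖w‖ = 1) (hre : z.re = w.re) :
    z = w ∨ z = (starRingEnd ℂ) w := by
  have h1 := Complex.sq_norm z
  have h2 := Complex.sq_norm w
  rw [hz, Complex.normSq_apply] at h1
  rw [hw, Complex.normSq_apply] at h2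
  have h3 : (z.im - w.im) * (z.im + w.im) = 0 := by rw [hre] at h1; linarith
  rcases mul_eq_zero.1 h3 with h | h
  · left; exact Complex.ext hre (by linarith)
  · right; exact Complex.ext hre (by rw [Complex.conj_im]; linarith)

/-- The map with the same first component and values in the upper half-circle. -/
noncomputable def upperFold (m : ℝ → ℂ) (t : ℝ) : ℂ := ⟨(m t).re, |(m t).im|⟩

theorem MemH1locCircle.upperFold (hm : MemH1locCircle m) :
    MemH1locCircle (upperFold m) ∧ energy h (upperFold m) ≤ energy h m := by
  refine hm.fold (continuous_complex_mk (Complex.continuous_re.comp hm.continuous)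
    (Complex.continuous_im.comp hm.continuous).abs) fun t => ?_
  rcases le_total 0 (m t).im with h | h
  · left; exact Complex.ext rfl (abs_of_nonneg h)
  · right; exact Complex.ext rfl (by rw [Complex.conj_im]; exact abs_of_nonpos h)

/-! #### Translations -/

theorem localEnergy_comp_add (h : ℝ) (m : ℝ → ℂ) (τ : ℝ) :
    localEnergy h (fun t => m (t + τ)) = localEnergy h m := by
  simp only [localEnergy, localDensity, deriv_comp_add_const]
  exact lintegral_add_right_eq_self (fun t => ENNReal.ofReal (‖deriv m t‖ ^ 2 +
    2 * anisotropy h (m t))) τ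

theorem MemH1locCircle.comp_add (hm : MemH1locCircle m) (τ : ℝ) :
    MemH1locCircle (fun t => m (t + τ)) := by
  refine memH1locCircle_iff.2 ⟨fun t => hm.1 _, hm.locAC.comp_add_const τ, fun a b => ?_⟩
  have e1 := (measurePreserving_add_right (volume : Measure ℝ) τ).setLIntegral_comp_preimage_emb
    (MeasurableEquiv.addRight τ).measurableEmbedding
    (fun t => ENNReal.ofReal (‖deriv m t‖ ^ 2)) (Set.Icc (a + τ) (b + τ))
  have e2 : (fun x => x + τ) ⁻¹' Set.Icc (a + τ) (b + τ) = Set.Icc a b := by ext; simp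
  rw [e2] at e1
  simp only [deriv_comp_add_const]
  rw [e1]
  exact (memH1locCircle_iff.1 hm).2.2 _ _

theorem energy_comp_add (hm : LocAC m) (τ : ℝ) : energy h (fun t => m (t + τ)) = energy h m := by
  rw [energy_eq, energy_eq, localEnergy_comp_add, strayFieldDirichlet_comp_add hm.re]

/-! #### Reflections -/

theorem ae_ne_zero : ∀ᵐ t : ℝ, t ≠ 0 := by simp [ae_iff]

theorem norm_deriv_neg_of_even (he : ∀ t, m (-t) = m t) (t : ℝ) :
    ‖deriv m (-t)‖ = ‖deriv m t‖ := by
  have : (fun t => m (-t)) = m := funext he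
  have h := deriv_comp_neg (f := m) (x := t)
  rw [this] at h; rw [h, norm_neg]

theorem localEnergy_comp_neg (h : ℝ) (m : ℝ → ℂ) :
    localEnergy h (fun t => m (-t)) = localEnergy h m := by
  simp only [localEnergy, localDensity, deriv_comp_neg, norm_neg]
  exact lintegral_neg_eq_self (fun t => ENNReal.ofReal (‖deriv m t‖ ^ 2 + 2 * anisotropy h (m t)))

theorem localDensity_evenRight (h : ℝ) (m : ℝ → ℂ) {t : ℝ} (ht : t ≠ 0) :
    localDensity h (fun t => m |t|) t = localDensity h m |t| := by
  have hpos : ∀ {t : ℝ}, 0 < t → localDensity h (fun t => m |t|) t = localDensity h m |t| := by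
    intro t ht
    rw [localDensity, deriv_evenRight m ht, abs_of_pos ht]; rfl
  rcases lt_or_gt_of_ne ht with h | h
  · have := hpos (neg_pos.2 h)
    rw [abs_neg] at this
    rw [← this, localDensity, localDensity, norm_deriv_neg_of_even (fun t => by rw [abs_neg]),
      abs_neg]
  · exact hpos h

theorem localEnergy_symmetrize (hm : MemH1locCircle m) :
    localEnergy h (fun t => m (-|t|)) + localEnergy h (fun t => m |t|) = 2 * localEnergy h m := by
  have hmeas := (measurable_localDensity h hm.continuous).ennreal_ofReal
  have hL : ∀ {t : ℝ}, t ≠ 0 → localDensity h (fun t => m (-|t|)) t = localDensity h m (-|t|) := by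
    intro t ht
    rw [localDensity_evenRight h (fun t => m (-t)) ht, localDensity, localDensity, deriv_comp_neg,
      norm_neg]
  have key : localEnergy h (fun t => m (-|t|)) + localEnergy h (fun t => m |t|) =
      ∫⁻ t, (ENNReal.ofReal (localDensity h m t) + ENNReal.ofReal (localDensity h m (-t))) := by
    rw [localEnergy, localEnergy, ← lintegral_add_right _
      (measurable_localDensity h hm.locAC.evenRight.continuous).ennreal_ofReal]
    refine lintegral_congr_ae ?_
    filter_upwards [ae_ne_zero] with t ht
    rw [hL ht, localDensity_evenRight h m ht]
    rcases le_total 0 t with h | h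
    · rw [abs_of_nonneg h, add_comm]
    · rw [abs_of_nonpos h, neg_neg]
  rw [key, lintegral_add_left hmeas, lintegral_neg_eq_self
    (fun t => ENNReal.ofReal (localDensity h m t)), ← two_mul]; rfl

theorem energy_symmetrize (hm : MemH1locCircle m) :
    energy h (fun t => m (-|t|)) + energy h (fun t => m |t|) ≤ 2 * energy h m := by
  have h1 := localEnergy_symmetrize (h := h) hm
  have h2 := strayFieldDirichlet_symmetrize hm.locAC.re hm.locAC.evenRight.re hm.locAC.evenLeft.re
  calc energy h (fun t => m (-|t|)) + energy h (fun t => m |t|)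
      = 2⁻¹ * (localEnergy h (fun t => m (-|t|)) + localEnergy h (fun t => m |t|)) +
        2⁻¹ * (strayFieldDirichlet (fun t => (m (-|t|)).re) +
          strayFieldDirichlet (fun t => (m |t|).re)) := by
        rw [energy_eq, energy_eq]; ring
    _ ≤ 2⁻¹ * (2 * localEnergy h m) + 2⁻¹ * (2 * strayFieldDirichlet (fun t => (m t).re)) := by
        rw [h1]; gcongr
    _ = 2 * energy h m := by rw [energy_eq]; ring

/-- One of the two even reflections about the origin does not increase the energy. -/
theorem exists_even (hm : MemH1locCircle m) (hE : energy h m < ⊤) :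
    ∃ m', (m' = (fun t => m (-|t|)) ∨ m' = fun t => m |t|) ∧ MemH1locCircle m' ∧
      energy h m' ≤ energy h m := by
  have hs := energy_symmetrize (h := h) hm
  rcases le_total (energy h (fun t => m (-|t|))) (energy h (fun t => m |t|)) with hle | hle
  · have : energy h (fun t => m (-|t|)) ≤ energy h m := by
      refine (ENNReal.mul_le_mul_iff_right (a := 2) (by simp) (by simp)).1 (le_trans ?_ hs)
      rw [two_mul]; gcongr
    exact ⟨_, Or.inl rfl, memH1locCircle_of_localEnergy (fun t => hm.1 _) hm.locAC.evenLeft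
      (localEnergy_lt_top (this.trans_lt hE)), this⟩
  · have : energy h (fun t => m |t|) ≤ energy h m := by
      refine (ENNReal.mul_le_mul_iff_right (a := 2) (by simp) (by simp)).1 (le_trans ?_ hs)
      rw [two_mul]; gcongr
    exact ⟨_, Or.inr rfl, memH1locCircle_of_localEnergy (fun t => hm.1 _) hm.locAC.evenRight
      (localEnergy_lt_top (this.trans_lt hE)), this⟩

/-- For `h = 0` the potential is `m₁²/2`, which is even in `m`. This symmetry is needed for liftings
that start at `-π/2` instead of `π/2` modulo `2π`. -/
theorem MemH1locCircle.neg (hm : MemH1locCircle m) :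
    MemH1locCircle (fun t => - m t) ∧ energy 0 (fun t => - m t) ≤ energy 0 m := by
  have hd : ∀ t, deriv (fun t => - m t) t = - deriv m t := fun t => deriv.neg
  refine ⟨memH1locCircle_iff.2 ⟨fun t => by rw [norm_neg, hm.1], hm.locAC.neg, fun a b => ?_⟩, ?_⟩
  · simp only [hd, norm_neg]; exact (memH1locCircle_iff.1 hm).2.2 a b
  · rw [energy_eq, energy_eq]
    gcongr
    · refine le_of_eq (lintegral_congr fun t => ?_)
      simp [localDensity, hd, anisotropy, wellLevel]
    · exact strayFieldDirichlet_neg_le hm.locAC.re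

/-! #### Behaviour at infinity -/

/-- With `g = m₁ - k`, both `g²` and its derivative `2gg'` are integrable. Hence `g²` has a limit at
infinity, and integrability forces this limit to be zero. -/
theorem tendsto_re_atTop (hm : ∀ t, ‖m t‖ = 1) (hAC : LocAC m) (hE : localEnergy h m < ⊤) :
    Tendsto (fun t => (m t).re) atTop (𝓝 (wellLevel h)) := by
  obtain ⟨g, hg⟩ : ∃ g : ℝ → ℝ, g = fun t => (m t).re - wellLevel h := ⟨_, rfl⟩
  have hgAC : LocAC g := hg ▸ hAC.re.sub_const _
  have hg2 : Integrable fun t => g t ^ 2 := hg ▸ integrable_sq_re_sub hm hAC.continuous hE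
  have hg2AC : LocAC fun t => g t * g t := fun a b => (hgAC a b).fun_mul (hgAC a b)
  have hd : ∀ᵐ t, ‖deriv (fun t => g t * g t) t‖ ≤ g t ^ 2 + ‖deriv m t‖ ^ 2 := by
    filter_upwards [hAC.ae_hasDerivAt] with t ht
    have h1 : HasDerivAt g (deriv m t).re t := hg ▸ ht.re'.sub_const _
    rw [(h1.fun_mul h1).deriv, Real.norm_eq_abs]
    have h2 := Complex.abs_re_le_norm (deriv m t)
    have h3 := abs_mul (deriv m t).re (g t)
    have h4 := abs_add_le ((deriv m t).re * g t) (g t * (deriv m t).re)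
    rw [abs_mul, abs_mul] at h4
    nlinarith [sq_nonneg (|g t| - ‖deriv m t‖), abs_nonneg (g t), abs_nonneg (deriv m t).re,
      sq_abs (g t)]
  have hdI : Integrable (deriv fun t => g t * g t) :=
    (hg2.add (integrable_norm_deriv_sq hm hAC.continuous hE)).mono'
      (measurable_deriv _).aestronglyMeasurable hd
  have hlim : Tendsto (fun t => g t * g t) atTop (𝓝
      (g 0 * g 0 + ∫ t in Set.Ioi (0 : ℝ), deriv (fun t => g t * g t) t)) := by
    have h1 := (intervalIntegral_tendsto_integral_Ioi 0 hdI.integrableOn tendsto_id).const_add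
      (g 0 * g 0)
    refine h1.congr fun t => ?_
    rw [(hg2AC 0 _).integral_deriv_eq_sub]; simp
  have hzero := IntegrableAtFilter.eq_zero_of_tendsto (μ := volume) (f := fun t => g t * g t)
    (l := atTop) (a := g 0 * g 0 + ∫ t in Set.Ioi (0 : ℝ), deriv (fun t => g t * g t) t) ?_ ?_ hlim
  · rw [hzero] at hlim
    have h2 := (Real.continuous_sqrt.tendsto _).comp hlim
    rw [Real.sqrt_zero] at h2
    have h3 : Tendsto g atTop (𝓝 0) := by
      rw [tendsto_zero_iff_abs_tendsto_zero]
      refine h2.congr fun t => ?_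
      simp [Real.sqrt_mul_self_eq_abs]
    have h4 := h3.add_const (wellLevel h)
    rw [zero_add, hg] at h4
    simpa using h4
  · exact ⟨Set.univ, univ_mem, by simpa [sq] using hg2⟩
  · intro s hs
    obtain ⟨a, ha⟩ := mem_atTop_sets.1 hs
    refine top_le_iff.1 (le_trans ?_ (measure_mono (show Set.Ici a ⊆ s from fun b hb => ha b hb)))
    rw [Real.volume_Ici]

theorem tendsto_re_atBot (hm : ∀ t, ‖m t‖ = 1) (hAC : LocAC m) (hE : localEnergy h m < ⊤) :
    Tendsto (fun t => (m t).re) atBot (𝓝 (wellLevel h)) := by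
  have := (tendsto_re_atTop (h := h) (m := fun t => m (-t)) (fun t => hm _) hAC.comp_neg
    (by rwa [localEnergy_comp_neg])).comp tendsto_neg_atBot_atTop
  refine this.congr fun t => ?_
  simp

/-! #### Profiles -/

/-- The energies of finitely many profiles that separate from one another are recovered in the
limit. -/
theorem sum_energy_le {ι : Type*} (J : Finset ι) {m : ℕ → ℝ → ℂ}
    (hm : ∀ n, MemH1locCircle (m n)) {x : ℕ → ι → ℝ} {μ : ι → ℝ → ℂ}
    (hμ : ∀ j ∈ J, LocAC (μ j))
    (hlim : ∀ j ∈ J, ∀ t, Tendsto (fun n => m n (t + x n j)) atTop (𝓝 (μ j t)))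
    (hsep : ∀ i ∈ J, ∀ j ∈ J, i ≠ j → Tendsto (fun n => |x n i - x n j|) atTop atTop)
    {L₀ N₀ : ℝ≥0∞} (hL : Tendsto (fun n => localEnergy h (m n)) atTop (𝓝 L₀))
    (hN : Tendsto (fun n => strayFieldDirichlet (fun t => (m n t).re)) atTop (𝓝 N₀)) :
    ∑ j ∈ J, energy h (μ j) ≤ 2⁻¹ * L₀ + 2⁻¹ * N₀ := by
  simp_rw [energy_eq]
  rw [Finset.sum_add_distrib, ← Finset.mul_sum, ← Finset.mul_sum]
  gcongr
  · exact sum_localEnergy_le J hm hμ hlim hsep hL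
  · refine sum_strayFieldDirichlet_le J (fun n => (hm n).locAC.re) (M := 1) (fun n t => ?_)
      (fun j hj => (hμ j hj).re) (fun j hj t => ?_) hsep hN
    · rw [← (hm n).1 t]; exact Complex.abs_re_le_norm _
    · exact (Complex.continuous_re.tendsto _).comp (hlim j hj t)

end

/-! ### Gluing two maps -/

/-- The point of the unit circle with angle `x`. -/
noncomputable def circlePoint (x : ℝ) : ℂ := ⟨Real.cos x, Real.sin x⟩

theorem norm_circlePoint (x : ℝ) : ‖circlePoint x‖ = 1 := by
  rw [← sq_eq_sq₀ (norm_nonneg _) zero_le_one, Complex.sq_norm, Complex.normSq_apply]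
  simp only [circlePoint]
  nlinarith [Real.sin_sq_add_cos_sq x]

theorem continuous_circlePoint : Continuous circlePoint :=
  continuous_complex_mk Real.continuous_cos Real.continuous_sin

theorem abs_cos_sub_cos_le (x y : ℝ) : |Real.cos x - Real.cos y| ≤ |x - y| := by
  have := Convex.norm_image_sub_le_of_norm_deriv_le (f := Real.cos) (C := 1) (s := Set.univ)
    (x := y) (y := x) (fun _ _ => Real.differentiable_cos _)
    (fun z _ => by rw [Real.deriv_cos, norm_neg]; exact Real.abs_sin_le_one z) convex_univ
    trivial trivial
  simpa using this

theorem norm_circlePoint_sub_le (x y : ℝ) : ‖circlePoint x - circlePoint y‖ ≤ 2 * |x - y| := by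
  refine (Complex.norm_le_abs_re_add_abs_im _).trans ?_
  have h1 := abs_cos_sub_cos_le x y
  have h2 := abs_cos_sub_cos_le (Real.pi / 2 - x) (Real.pi / 2 - y)
  rw [Real.cos_pi_div_two_sub, Real.cos_pi_div_two_sub,
    show Real.pi / 2 - x - (Real.pi / 2 - y) = -(x - y) by ring, abs_neg] at h2
  simp only [circlePoint, Complex.sub_re, Complex.sub_im]
  linarith

theorem circlePoint_arccos {z : ℂ} (hz : ‖z‖ = 1) (him : 0 ≤ z.im) :
    circlePoint (Real.arccos z.re) = z := by
  have h1 := Complex.abs_re_le_norm z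
  rw [hz, abs_le] at h1
  have h2 := Complex.sq_norm z
  rw [hz, Complex.normSq_apply] at h2
  apply Complex.ext
  · exact Real.cos_arccos h1.1 h1.2
  · change Real.sin (Real.arccos z.re) = z.im
    rw [Real.sin_arccos, show 1 - z.re ^ 2 = z.im ^ 2 by nlinarith, Real.sqrt_sq him]

theorem tendsto_setIntegral_of_eventually_notMem {f : ℝ → ℝ} (hf : Integrable f)
    {s : ℝ → Set ℝ} (hs : ∀ T, MeasurableSet (s T)) (h : ∀ t, ∀ᶠ T in atTop, t ∉ s T) :
    Tendsto (fun T => ∫ t in s T, f t) atTop (𝓝 0) := by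
  have h1 := tendsto_integral_filter_of_dominated_convergence (μ := volume) (l := atTop)
    (F := fun T => (s T).indicator f) (f := fun _ => (0 : ℝ)) (fun t => ‖f t‖)
    (Eventually.of_forall fun T => (hf.indicator (hs T)).aestronglyMeasurable)
    (Eventually.of_forall fun T => Eventually.of_forall fun t => norm_indicator_le_norm_self _ _)
    hf.norm (Eventually.of_forall fun t => tendsto_nhds_of_eventually_eq
      ((h t).mono fun T hT => Set.indicator_of_notMem hT f))
  simpa [integral_indicator (hs _)] using h1

/-- The angle on the interval `[-1, 1]` that connects `θ₁` to `θ₂`. -/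
noncomputable def linkAngle (θ₁ θ₂ t : ℝ) : ℝ := θ₁ + (θ₂ - θ₁) * ((t + 1) / 2)

/-- Two maps placed at distance `2 T` from each other, and connected on `[-1, 1]`. -/
noncomputable def linkMap (m₁ m₂ : ℝ → ℂ) (T t : ℝ) : ℂ :=
  if t ≤ -1 then m₁ (t + T) else if t < 1 then
    circlePoint (linkAngle (Real.arccos (m₁ (-1 + T)).re) (Real.arccos (m₂ (1 + -T)).re) t)
  else m₂ (t + -T)

section Link

variable {h : ℝ} {m₁ m₂ : ℝ → ℂ}

theorem linkMap_left {T t : ℝ} (ht : t ≤ -1) : linkMap m₁ m₂ T t = m₁ (t + T) := if_pos ht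

theorem linkMap_right {T t : ℝ} (ht : 1 ≤ t) : linkMap m₁ m₂ T t = m₂ (t + -T) := by
  rw [linkMap, if_neg (by linarith), if_neg (by linarith)]

theorem linkMap_mid (h1 : ∀ t, ‖m₁ t‖ = 1) (h2 : ∀ t, ‖m₂ t‖ = 1) (i1 : ∀ t, 0 ≤ (m₁ t).im)
    (i2 : ∀ t, 0 ≤ (m₂ t).im) {T t : ℝ} (ht : -1 ≤ t) (ht' : t ≤ 1) : linkMap m₁ m₂ T t =
      circlePoint (linkAngle (Real.arccos (m₁ (-1 + T)).re) (Real.arccos (m₂ (1 + -T)).re) t) := by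
  rcases ht.eq_or_lt with rfl | h
  · rw [linkMap_left le_rfl, linkAngle]
    simp only [neg_add_cancel, zero_div, mul_zero, add_zero]
    rw [circlePoint_arccos (h1 _) (i1 _)]
  rcases ht'.eq_or_lt with rfl | h'
  · rw [linkMap_right le_rfl, linkAngle]
    rw [show (1 + 1 : ℝ) / 2 = 1 by norm_num, mul_one, add_sub_cancel,
      circlePoint_arccos (h2 _) (i2 _)]
  · rw [linkMap, if_neg (by linarith), if_pos h']

theorem abs_linkAngle_sub_le (θ₁ θ₂ α : ℝ) {t : ℝ} (ht : -1 ≤ t) (ht' : t ≤ 1) :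
    |linkAngle θ₁ θ₂ t - α| ≤ |θ₁ - α| + |θ₂ - α| := by
  have : linkAngle θ₁ θ₂ t - α = ((1 - t) / 2) * (θ₁ - α) + ((t + 1) / 2) * (θ₂ - α) := by
    rw [linkAngle]; ring
  rw [this]
  refine (abs_add_le _ _).trans ?_
  rw [abs_mul, abs_mul, abs_of_nonneg (show 0 ≤ (1 - t) / 2 by linarith),
    abs_of_nonneg (show 0 ≤ (t + 1) / 2 by linarith)]
  nlinarith [abs_nonneg (θ₁ - α), abs_nonneg (θ₂ - α)]

/-- The distance of the connecting angles from `α`. -/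
noncomputable def linkGap (h : ℝ) (m₁ m₂ : ℝ → ℂ) (T : ℝ) : ℝ :=
  |Real.arccos (m₁ (-1 + T)).re - wellAngle h| + |Real.arccos (m₂ (1 + -T)).re - wellAngle h|

theorem linkGap_nonneg (h : ℝ) (m₁ m₂ : ℝ → ℂ) (T : ℝ) : 0 ≤ linkGap h m₁ m₂ T := by
  unfold linkGap; positivity

theorem norm_linkMap_sub_mid (h1 : ∀ t, ‖m₁ t‖ = 1) (h2 : ∀ t, ‖m₂ t‖ = 1)
    (i1 : ∀ t, 0 ≤ (m₁ t).im) (i2 : ∀ t, 0 ≤ (m₂ t).im) {T a b : ℝ} (ha : -1 ≤ a) (ha' : a ≤ 1)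
    (hb : -1 ≤ b) (hb' : b ≤ 1) :
    ‖linkMap m₁ m₂ T b - linkMap m₁ m₂ T a‖ ≤ linkGap h m₁ m₂ T * |b - a| := by
  rw [linkMap_mid h1 h2 i1 i2 ha ha', linkMap_mid h1 h2 i1 i2 hb hb']
  refine (norm_circlePoint_sub_le _ _).trans ?_
  rw [linkAngle, linkAngle]
  set θ₁ := Real.arccos (m₁ (-1 + T)).re with hθ₁
  set θ₂ := Real.arccos (m₂ (1 + -T)).re with hθ₂
  have h3 : |θ₂ - θ₁| ≤ linkGap h m₁ m₂ T := by
    rw [linkGap, ← hθ₁, ← hθ₂, add_comm, show θ₂ - θ₁ = (θ₂ - wellAngle h) - (θ₁ - wellAngle h) by ring]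
    exact abs_sub _ _
  -- The factor `1/2`, due to the length of `[-1, 1]`, cancels the constant `2` of
  -- `norm_circlePoint_sub_le`.
  have h4 : θ₁ + (θ₂ - θ₁) * ((b + 1) / 2) - (θ₁ + (θ₂ - θ₁) * ((a + 1) / 2)) =
      (θ₂ - θ₁) * (b - a) / 2 := by ring
  rw [h4, abs_div, abs_mul, abs_two]
  have := mul_le_mul_of_nonneg_right h3 (abs_nonneg (b - a))
  linarith

theorem locAC_linkMap (a1 : LocAC m₁) (a2 : LocAC m₂) (h1 : ∀ t, ‖m₁ t‖ = 1)
    (h2 : ∀ t, ‖m₂ t‖ = 1) (i1 : ∀ t, 0 ≤ (m₁ t).im) (i2 : ∀ t, 0 ≤ (m₂ t).im) (T : ℝ) :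
    LocAC (linkMap m₁ m₂ T) := by
  have b1 := a1.comp_add_const T
  have b2 := a2.comp_add_const (-T)
  have l1 := locallyIntegrable_norm b1.locallyIntegrable_deriv_complex
  have l2 := locallyIntegrable_norm b2.locallyIntegrable_deriv_complex
  -- The parameter of `linkGap` only fixes a reference angle, and the Lipschitz bound holds for any
  -- choice; `0` is arbitrary.
  obtain ⟨ρ, hρ⟩ : ∃ ρ, ρ = linkGap 0 m₁ m₂ T := ⟨_, rfl⟩
  have hρ0 : 0 ≤ ρ := hρ ▸ linkGap_nonneg _ _ _ _
  have hl : LocallyIntegrable fun t => ‖deriv (fun t => m₁ (t + T)) t‖ +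
      ‖deriv (fun t => m₂ (t + -T)) t‖ + ρ := (l1.add l2).add (locallyIntegrable_const ρ)
  have hI := locallyIntegrable_iff_intervalIntegrable.1 hl
  -- Freezing the map to the left of `-1` leaves only the junction at `1`; the junction at `-1` is
  -- treated afterwards.
  have hmr : ∀ a b, a ≤ b → ‖linkMap m₁ m₂ T (max b (-1)) - linkMap m₁ m₂ T (max a (-1))‖ ≤
      ∫ t in a..b, (‖deriv (fun t => m₁ (t + T)) t‖ + ‖deriv (fun t => m₂ (t + -T)) t‖ + ρ) := by
    refine bound_of_split hl 1 (f := fun t => linkMap m₁ m₂ T (max t (-1)))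
      (fun a b hab hb => ?_) (fun a b ha hab => ?_)
    · have h3 : ‖linkMap m₁ m₂ T (max b (-1)) - linkMap m₁ m₂ T (max a (-1))‖ ≤ ρ * (b - a) := by
        have h4 := norm_linkMap_sub_mid (h := 0) (T := T) h1 h2 i1 i2 (a := max a (-1))
          (b := max b (-1)) (le_max_right _ _) (max_le (hab.trans hb) (by norm_num))
          (le_max_right _ _) (max_le hb (by norm_num))
        rw [← hρ] at h4
        refine h4.trans (mul_le_mul_of_nonneg_left ?_ hρ0)
        rw [abs_of_nonneg (sub_nonneg.2 (max_le_max_right _ hab))]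
        rcases le_total a (-1) with h5 | h5
        · rcases le_total b (-1) with h6 | h6
          · rw [max_eq_right h5, max_eq_right h6]; linarith
          · rw [max_eq_right h5, max_eq_left h6]; linarith
        · rw [max_eq_left h5, max_eq_left (h5.trans hab)]
      refine h3.trans ?_
      have h5 : ∫ _ in a..b, ρ = ρ * (b - a) := by
        rw [intervalIntegral.integral_const, smul_eq_mul, mul_comm]
      rw [← h5]
      refine intervalIntegral.integral_mono_on hab intervalIntegrable_const (hI a b) fun t _ => ?_
      have := norm_nonneg (deriv (fun t => m₂ (t + -T)) t)
      have := norm_nonneg (deriv (fun t => m₁ (t + T)) t)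
      linarith
    · rw [max_eq_left (by linarith), max_eq_left (by linarith), linkMap_right ha,
        linkMap_right (ha.trans hab)]
      refine (b2.norm_sub_le hab).trans (intervalIntegral.integral_mono_on hab
        (locallyIntegrable_iff_intervalIntegrable.1 l2 a b) (hI a b) fun t _ => ?_)
      linarith [norm_nonneg (deriv (fun t => m₁ (t + T)) t)]
  refine locAC_of_bound hl (bound_of_split hl (-1) (fun a b hab hb => ?_) fun a b ha hab => ?_)
  · rw [linkMap_left hb, linkMap_left (hab.trans hb)]
    refine (b1.norm_sub_le hab).trans (intervalIntegral.integral_mono_on hab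
      (locallyIntegrable_iff_intervalIntegrable.1 l1 a b) (hI a b) fun t _ => ?_)
    linarith [norm_nonneg (deriv (fun t => m₂ (t + -T)) t)]
  · have hh := hmr a b hab
    rwa [max_eq_left (ha.trans hab), max_eq_left ha] at hh

theorem sq_add_norm_deriv_sq_le {m : ℝ → ℂ} (hm : ∀ t, ‖m t‖ = 1) (t : ℝ) :
    ((m t).re - wellLevel h) ^ 2 + ‖deriv m t‖ ^ 2 ≤ localDensity h m t := by
  have := half_sq_le_anisotropy h (hm t)
  rw [localDensity]; linarith

/-- The size of the local energy density on the connecting interval. -/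
noncomputable def linkCost (h : ℝ) (m₁ m₂ : ℝ → ℂ) (T : ℝ) : ℝ :=
  2 * linkGap h m₁ m₂ T ^ 2 + 2 * |h - wellLevel h| * linkGap h m₁ m₂ T

theorem linkCost_nonneg (h : ℝ) (m₁ m₂ : ℝ → ℂ) (T : ℝ) : 0 ≤ linkCost h m₁ m₂ T := by
  have := linkGap_nonneg h m₁ m₂ T
  unfold linkCost; positivity

theorem linkMap_eventuallyEq_left {T t : ℝ} (ht : t < -1) :
    linkMap m₁ m₂ T =ᶠ[𝓝 t] fun t => m₁ (t + T) := by
  filter_upwards [gt_mem_nhds ht] with s hs using linkMap_left (le_of_lt hs)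

theorem linkMap_eventuallyEq_right {T t : ℝ} (ht : 1 < t) :
    linkMap m₁ m₂ T =ᶠ[𝓝 t] fun t => m₂ (t + -T) := by
  filter_upwards [lt_mem_nhds ht] with s hs using linkMap_right (le_of_lt hs)

theorem linkMap_mid_estimates (h0 : 0 ≤ h) (h1 : ∀ t, ‖m₁ t‖ = 1) (h2 : ∀ t, ‖m₂ t‖ = 1)
    (i1 : ∀ t, 0 ≤ (m₁ t).im) (i2 : ∀ t, 0 ≤ (m₂ t).im) {T t : ℝ} (ht : -1 < t) (ht' : t < 1) :
    ‖deriv (linkMap m₁ m₂ T) t‖ ^ 2 ≤ linkGap h m₁ m₂ T ^ 2 ∧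
      ((linkMap m₁ m₂ T t).re - wellLevel h) ^ 2 ≤ linkGap h m₁ m₂ T ^ 2 ∧
      localDensity h (linkMap m₁ m₂ T) t ≤ linkCost h m₁ m₂ T := by
  have hρ := linkGap_nonneg h m₁ m₂ T
  have e1 : ‖deriv (linkMap m₁ m₂ T) t‖ ^ 2 ≤ linkGap h m₁ m₂ T ^ 2 := by
    refine pow_le_pow_left₀ (norm_nonneg _) (norm_deriv_le_of_lip' hρ ?_) 2
    filter_upwards [lt_mem_nhds ht, gt_mem_nhds ht'] with s hs hs'
    exact norm_linkMap_sub_mid h1 h2 i1 i2 ht.le ht'.le hs.le hs'.le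
  have hk : Real.cos (wellAngle h) = wellLevel h :=
    Real.cos_arccos (by linarith [wellLevel_nonneg h0]) (wellLevel_le_one h)
  have e2 : |(linkMap m₁ m₂ T t).re - wellLevel h| ≤ linkGap h m₁ m₂ T := by
    rw [linkMap_mid h1 h2 i1 i2 ht.le ht'.le]
    simp only [circlePoint]
    nth_rw 1 [← hk]
    exact (abs_cos_sub_cos_le _ _).trans (abs_linkAngle_sub_le _ _ _ ht.le ht'.le)
  have e3 : ((linkMap m₁ m₂ T t).re - wellLevel h) ^ 2 ≤ linkGap h m₁ m₂ T ^ 2 :=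
    sq_le_sq' (abs_le.1 e2).1 (abs_le.1 e2).2
  refine ⟨e1, e3, ?_⟩
  have e4 : (h - wellLevel h) * (wellLevel h - (linkMap m₁ m₂ T t).re) ≤
      |h - wellLevel h| * linkGap h m₁ m₂ T := by
    refine (le_abs_self _).trans ?_
    rw [abs_mul, abs_sub_comm (wellLevel h)]
    exact mul_le_mul_of_nonneg_left e2 (abs_nonneg _)
  have e5 : 2 * anisotropy h (linkMap m₁ m₂ T t) = ((linkMap m₁ m₂ T t).re - wellLevel h) ^ 2 +
      2 * ((h - wellLevel h) * (wellLevel h - (linkMap m₁ m₂ T t).re)) := by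
    rw [anisotropy]; ring
  rw [localDensity, linkCost, e5]
  linarith

theorem ae_ne (c : ℝ) : ∀ᵐ t : ℝ, t ≠ c := by simp [ae_iff]

theorem localEnergy_linkMap_le (h0 : 0 ≤ h) (c1 : Continuous m₁) (c2 : Continuous m₂)
    (h1 : ∀ t, ‖m₁ t‖ = 1) (h2 : ∀ t, ‖m₂ t‖ = 1)
    (i1 : ∀ t, 0 ≤ (m₁ t).im) (i2 : ∀ t, 0 ≤ (m₂ t).im) (T : ℝ) :
    localEnergy h (linkMap m₁ m₂ T) ≤ localEnergy h m₁ + localEnergy h m₂ +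
      ENNReal.ofReal (2 * linkCost h m₁ m₂ T) := by
  have hm1 : Measurable fun t => ENNReal.ofReal (localDensity h (fun t => m₁ (t + T)) t) :=
    (measurable_localDensity h (c1.comp (by fun_prop))).ennreal_ofReal
  have hm2 : Measurable fun t => ENNReal.ofReal (localDensity h (fun t => m₂ (t + -T)) t) :=
    (measurable_localDensity h (c2.comp (by fun_prop))).ennreal_ofReal
  have hI : ∫⁻ t : ℝ, (Set.Icc (-1) 1).indicator
      (fun _ => ENNReal.ofReal (linkCost h m₁ m₂ T)) t = ENNReal.ofReal (2 * linkCost h m₁ m₂ T) := by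
    rw [lintegral_indicator measurableSet_Icc, lintegral_const, Measure.restrict_apply_univ,
      Real.volume_Icc, ← ENNReal.ofReal_mul (linkCost_nonneg _ _ _ _)]
    congr 1; ring
  rw [← localEnergy_comp_add h m₁ T, ← localEnergy_comp_add h m₂ (-T), ← hI]
  simp only [localEnergy]
  rw [← lintegral_add_right _ hm2,
    ← lintegral_add_right _ (measurable_const.indicator measurableSet_Icc)]
  refine lintegral_mono_ae ?_
  filter_upwards [ae_ne 1, ae_ne (-1)] with t ht ht'
  rcases lt_or_gt_of_ne ht' with h3 | h3
  · have e := linkMap_eventuallyEq_left (m₁ := m₁) (m₂ := m₂) (T := T) h3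
    rw [localDensity, e.deriv_eq, e.self_of_nhds, add_assoc]
    exact le_self_add
  rcases lt_or_gt_of_ne ht with h4 | h4
  · rw [Set.indicator_of_mem (show t ∈ Set.Icc (-1 : ℝ) 1 from ⟨h3.le, h4.le⟩)]
    exact (ENNReal.ofReal_le_ofReal (linkMap_mid_estimates h0 h1 h2 i1 i2 h3 h4).2.2).trans le_add_self
  · have e := linkMap_eventuallyEq_right (m₁ := m₁) (m₂ := m₂) (T := T) h4
    rw [localDensity, e.deriv_eq, e.self_of_nhds, add_right_comm]
    exact le_add_self

/-- The difference between the superposition of the profiles and the connected profile. -/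
noncomputable def linkError (h : ℝ) (m₁ m₂ : ℝ → ℂ) (T t : ℝ) : ℝ :=
  (m₁ (t + T)).re + (m₂ (t + -T)).re - wellLevel h - (linkMap m₁ m₂ T t).re

/-- A bound for the squared `H¹` norm of `linkError`. -/
noncomputable def linkErrorBound (h : ℝ) (m₁ m₂ : ℝ → ℂ) (T : ℝ) : ℝ :=
  3 * ((∫ t in Set.Ioi (T - 1), localDensity h m₁ t) + (∫ t in Set.Iio (1 - T), localDensity h m₂ t) +
    2 * linkCost h m₁ m₂ T)

/-- To the left of `-1` the connected map is the first profile, so the error is the tail of the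
second one, and vice versa to the right of `1`. In between the error is a sum of three terms close
to zero, whence the factor `3`. -/
theorem linkError_estimate (h0 : 0 ≤ h) (a1 : LocAC m₁) (a2 : LocAC m₂) (h1 : ∀ t, ‖m₁ t‖ = 1)
    (h2 : ∀ t, ‖m₂ t‖ = 1) (i1 : ∀ t, 0 ≤ (m₁ t).im) (i2 : ∀ t, 0 ≤ (m₂ t).im) (T : ℝ) :
    ∀ᵐ t, linkError h m₁ m₂ T t ^ 2 + deriv (linkError h m₁ m₂ T) t ^ 2 ≤
      3 * ((Set.Ioi (T - 1)).indicator (localDensity h m₁) (t + T) +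
        (Set.Iio (1 - T)).indicator (localDensity h m₂) (t + -T) +
        (Set.Icc (-1) 1).indicator (fun _ => linkCost h m₁ m₂ T) t) := by
  have b1 := a1.comp_add_const T
  have b2 := a2.comp_add_const (-T)
  have b3 := locAC_linkMap a1 a2 h1 h2 i1 i2 T
  filter_upwards [b1.ae_hasDerivAt, b2.ae_hasDerivAt, b3.ae_hasDerivAt, ae_ne 1, ae_ne (-1)]
    with t d1 d2 d3 ht ht'
  have hd : deriv (linkError h m₁ m₂ T) t = (deriv (fun t => m₁ (t + T)) t).re +
      (deriv (fun t => m₂ (t + -T)) t).re - (deriv (linkMap m₁ m₂ T) t).re :=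
    (((d1.re'.add d2.re').sub_const (wellLevel h)).sub d3.re').deriv
  have n1 : 0 ≤ (Set.Ioi (T - 1)).indicator (localDensity h m₁) (t + T) :=
    Set.indicator_nonneg (fun s _ => localDensity_nonneg h1 s) _
  have n2 : 0 ≤ (Set.Iio (1 - T)).indicator (localDensity h m₂) (t + -T) :=
    Set.indicator_nonneg (fun s _ => localDensity_nonneg h2 s) _
  have n3 : 0 ≤ (Set.Icc (-1) 1).indicator (fun _ => linkCost h m₁ m₂ T) t :=
    Set.indicator_nonneg (fun s _ => linkCost_nonneg _ _ _ _) _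
  have s1 := sq_add_norm_deriv_sq_le (h := h) h1 (t + T)
  have s2 := sq_add_norm_deriv_sq_le (h := h) h2 (t + -T)
  have r1 : ∀ z : ℂ, z.re ^ 2 ≤ ‖z‖ ^ 2 := fun z => by
    rw [← sq_abs]; exact pow_le_pow_left₀ (abs_nonneg _) (Complex.abs_re_le_norm z) 2
  have q1 := r1 (deriv m₁ (t + T))
  have q2 := r1 (deriv m₂ (t + -T))
  rw [deriv_comp_add_const, deriv_comp_add_const] at hd
  rcases lt_or_gt_of_ne ht' with h3 | h3
  · have e := linkMap_eventuallyEq_left (m₁ := m₁) (m₂ := m₂) (T := T) h3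
    rw [e.deriv_eq, deriv_comp_add_const] at hd
    have e2 : linkError h m₁ m₂ T t = (m₂ (t + -T)).re - wellLevel h := by
      rw [linkError, e.self_of_nhds]; ring
    rw [hd, e2, Set.indicator_of_mem (show t + -T ∈ Set.Iio (1 - T) by
      rw [Set.mem_Iio]; linarith)]
    nlinarith
  rcases lt_or_gt_of_ne ht with h4 | h4
  · obtain ⟨m1, m2, -⟩ := linkMap_mid_estimates (T := T) h0 h1 h2 i1 i2 h3 h4
    have q3 := (r1 (deriv (linkMap m₁ m₂ T) t)).trans m1
    rw [hd, Set.indicator_of_mem (show t + -T ∈ Set.Iio (1 - T) by rw [Set.mem_Iio]; linarith),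
      Set.indicator_of_mem (show t + T ∈ Set.Ioi (T - 1) by rw [Set.mem_Ioi]; linarith),
      Set.indicator_of_mem (show t ∈ Set.Icc (-1) 1 from ⟨h3.le, h4.le⟩)]
    have e2 : linkError h m₁ m₂ T t = ((m₁ (t + T)).re - wellLevel h) +
      ((m₂ (t + -T)).re - wellLevel h) - ((linkMap m₁ m₂ T t).re - wellLevel h) := by
      rw [linkError]; ring
    have hc : 2 * linkGap h m₁ m₂ T ^ 2 ≤ linkCost h m₁ m₂ T := by
      have := linkGap_nonneg h m₁ m₂ T
      rw [linkCost]; have : 0 ≤ 2 * |h - wellLevel h| * linkGap h m₁ m₂ T := by positivity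
      linarith
    have hsq : ∀ x y z : ℝ, (x + y - z) ^ 2 ≤ 3 * (x ^ 2 + y ^ 2 + z ^ 2) := fun x y z => by
      nlinarith [sq_nonneg (x - y), sq_nonneg (x + z), sq_nonneg (y + z)]
    rw [e2]
    have p1 := hsq ((m₁ (t + T)).re - wellLevel h) ((m₂ (t + -T)).re - wellLevel h)
      ((linkMap m₁ m₂ T t).re - wellLevel h)
    have p2 := hsq (deriv m₁ (t + T)).re (deriv m₂ (t + -T)).re (deriv (linkMap m₁ m₂ T) t).re
    linarith
  · have e := linkMap_eventuallyEq_right (m₁ := m₁) (m₂ := m₂) (T := T) h4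
    rw [e.deriv_eq, deriv_comp_add_const] at hd
    have e2 : linkError h m₁ m₂ T t = (m₁ (t + T)).re - wellLevel h := by
      rw [linkError, e.self_of_nhds]; ring
    rw [hd, e2, Set.indicator_of_mem (show t + T ∈ Set.Ioi (T - 1) by
      rw [Set.mem_Ioi]; linarith)]
    nlinarith

theorem strayFieldDirichlet_linkError_le (h0 : 0 ≤ h) (a1 : LocAC m₁) (a2 : LocAC m₂)
    (h1 : ∀ t, ‖m₁ t‖ = 1) (h2 : ∀ t, ‖m₂ t‖ = 1) (i1 : ∀ t, 0 ≤ (m₁ t).im)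
    (i2 : ∀ t, 0 ≤ (m₂ t).im) (I1 : Integrable (localDensity h m₁))
    (I2 : Integrable (localDensity h m₂)) (T : ℝ) :
    LocAC (linkError h m₁ m₂ T) ∧ strayFieldDirichlet (linkError h m₁ m₂ T) ≤
      ENNReal.ofReal (2⁻¹ * linkErrorBound h m₁ m₂ T) := by
  have hAC : LocAC (linkError h m₁ m₂ T) :=
    (((a1.comp_add_const T).re.add (a2.comp_add_const (-T)).re).sub_const _).sub
      (locAC_linkMap a1 a2 h1 h2 i1 i2 T).re
  have est := linkError_estimate h0 a1 a2 h1 h2 i1 i2 T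
  have J1 : Integrable fun t => (Set.Ioi (T - 1)).indicator (localDensity h m₁) (t + T) :=
    (I1.indicator measurableSet_Ioi).comp_add_right T
  have J2 : Integrable fun t => (Set.Iio (1 - T)).indicator (localDensity h m₂) (t + -T) :=
    (I2.indicator measurableSet_Iio).comp_add_right (-T)
  have J3 : Integrable ((Set.Icc (-1 : ℝ) 1).indicator (fun _ => linkCost h m₁ m₂ T)) :=
    (integrable_indicator_iff measurableSet_Icc).2 (integrableOn_const (by simp))
  have J := ((J1.add J2).add J3).const_mul 3
  have K1 : Integrable fun t => linkError h m₁ m₂ T t ^ 2 := by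
    refine J.mono' (hAC.continuous.pow 2).aestronglyMeasurable ?_
    filter_upwards [est] with t ht
    rw [Real.norm_of_nonneg (sq_nonneg _)]
    exact le_trans (le_add_of_nonneg_right (sq_nonneg _)) ht
  have K2 : Integrable fun t => deriv (linkError h m₁ m₂ T) t ^ 2 := by
    refine J.mono' ((measurable_deriv _).pow_const 2).aestronglyMeasurable ?_
    filter_upwards [est] with t ht
    rw [Real.norm_of_nonneg (sq_nonneg _)]
    exact le_trans (le_add_of_nonneg_left (sq_nonneg _)) ht
  refine ⟨hAC, (strayFieldDirichlet_le_sobolev hAC K1 K2).trans (ENNReal.ofReal_le_ofReal ?_)⟩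
  refine mul_le_mul_of_nonneg_left ((integral_mono_ae (K1.add K2) J est).trans (le_of_eq ?_))
    (by norm_num)
  have J12 : Integrable fun t => (Set.Ioi (T - 1)).indicator (localDensity h m₁) (t + T) +
    (Set.Iio (1 - T)).indicator (localDensity h m₂) (t + -T) := J1.add J2
  simp only [Pi.add_apply]
  rw [integral_const_mul, integral_add J12 J3, integral_add J1 J2,
    integral_add_right_eq_self (fun t => (Set.Ioi (T - 1)).indicator (localDensity h m₁) t) T,
    integral_add_right_eq_self (fun t => (Set.Iio (1 - T)).indicator (localDensity h m₂) t) (-T),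
    integral_indicator measurableSet_Ioi, integral_indicator measurableSet_Iio,
    integral_indicator measurableSet_Icc, setIntegral_const]
  rw [linkErrorBound]
  simp
  norm_num

theorem tendsto_linkGap (e1 : Tendsto (fun t => (m₁ t).re) atTop (𝓝 (wellLevel h)))
    (e2 : Tendsto (fun t => (m₂ t).re) atBot (𝓝 (wellLevel h))) :
    Tendsto (linkGap h m₁ m₂) atTop (𝓝 0) := by
  have t1 := ((Real.continuous_arccos.tendsto _).comp (e1.comp
    (tendsto_atTop_add_const_left atTop (-1) tendsto_id))).sub_const (wellAngle h)
  have t2 := ((Real.continuous_arccos.tendsto _).comp (e2.comp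
    (tendsto_atBot_add_const_left atTop 1 tendsto_neg_atTop_atBot))).sub_const (wellAngle h)
  have t3 := t1.abs.add t2.abs
  rw [show Real.arccos (wellLevel h) = wellAngle h from rfl, sub_self, abs_zero, add_zero] at t3
  exact t3

theorem tendsto_linkCost (hg : Tendsto (linkGap h m₁ m₂) atTop (𝓝 0)) :
    Tendsto (linkCost h m₁ m₂) atTop (𝓝 0) := by
  have := ((hg.pow 2).const_mul 2).add (hg.const_mul (2 * |h - wellLevel h|))
  show Tendsto (fun T => linkCost h m₁ m₂ T) atTop (𝓝 0)
  simpa [linkCost] using this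

theorem tendsto_linkErrorBound (hg : Tendsto (linkGap h m₁ m₂) atTop (𝓝 0))
    (I1 : Integrable (localDensity h m₁)) (I2 : Integrable (localDensity h m₂)) :
    Tendsto (linkErrorBound h m₁ m₂) atTop (𝓝 0) := by
  have t1 := tendsto_setIntegral_of_eventually_notMem I1 (s := fun T => Set.Ioi (T - 1))
    (fun _ => measurableSet_Ioi) fun t => by
      filter_upwards [eventually_ge_atTop (t + 1)] with T hT
      rw [Set.mem_Ioi]; linarith
  have t2 := tendsto_setIntegral_of_eventually_notMem I2 (s := fun T => Set.Iio (1 - T))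
    (fun _ => measurableSet_Iio) fun t => by
      filter_upwards [eventually_ge_atTop (1 - t)] with T hT
      rw [Set.mem_Iio]; linarith
  have := ((t1.add t2).add ((tendsto_linkCost hg).const_mul 2)).const_mul 3
  show Tendsto (fun T => linkErrorBound h m₁ m₂ T) atTop (𝓝 0)
  simpa [linkErrorBound] using this

theorem im_linkMap_nonneg (h1 : ∀ t, ‖m₁ t‖ = 1) (h2 : ∀ t, ‖m₂ t‖ = 1)
    (i1 : ∀ t, 0 ≤ (m₁ t).im) (i2 : ∀ t, 0 ≤ (m₂ t).im) (T t : ℝ) :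
    0 ≤ (linkMap m₁ m₂ T t).im := by
  rcases le_total t (-1) with h3 | h3
  · rw [linkMap_left h3]; exact i1 _
  rcases le_total t 1 with h4 | h4
  · rw [linkMap_mid h1 h2 i1 i2 h3 h4]
    set θ₁ := Real.arccos (m₁ (-1 + T)).re with hθ₁
    set θ₂ := Real.arccos (m₂ (1 + -T)).re with hθ₂
    have b1 : 0 ≤ θ₁ := Real.arccos_nonneg _
    have b2 : θ₁ ≤ Real.pi := Real.arccos_le_pi _
    have b3 : 0 ≤ θ₂ := Real.arccos_nonneg _
    have b4 : θ₂ ≤ Real.pi := Real.arccos_le_pi _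
    refine Real.sin_nonneg_of_nonneg_of_le_pi ?_ ?_ <;> rw [linkAngle] <;> nlinarith
  · rw [linkMap_right h4]; exact i2 _

theorem norm_linkMap (h1 : ∀ t, ‖m₁ t‖ = 1) (h2 : ∀ t, ‖m₂ t‖ = 1) (T t : ℝ) :
    ‖linkMap m₁ m₂ T t‖ = 1 := by
  rw [linkMap]
  split_ifs
  · exact h1 _
  · exact norm_circlePoint _
  · exact h2 _

/-- Two maps of finite energy with values in the upper half-circle can be placed next to one
another at arbitrarily small additional energy. -/
theorem energy_linkMap_le (h0 : 0 ≤ h) (hm₁ : MemH1locCircle m₁) (hm₂ : MemH1locCircle m₂)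
    (i1 : ∀ t, 0 ≤ (m₁ t).im) (i2 : ∀ t, 0 ≤ (m₂ t).im) (E1 : energy h m₁ < ⊤)
    (E2 : energy h m₂ < ⊤) {δ : ℝ} (hδ : 0 < δ) :
    ∀ᶠ T in atTop, MemH1locCircle (linkMap m₁ m₂ T) ∧
      energy h (linkMap m₁ m₂ T) ≤ energy h m₁ + energy h m₂ + ENNReal.ofReal δ := by
  have a1 := hm₁.locAC
  have a2 := hm₂.locAC
  have L1 := localEnergy_lt_top E1
  have L2 := localEnergy_lt_top E2
  have I1 := integrable_localDensity hm₁.1 hm₁.continuous L1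
  have I2 := integrable_localDensity hm₂.1 hm₂.continuous L2
  have hg := tendsto_linkGap (tendsto_re_atTop hm₁.1 a1 L1) (tendsto_re_atBot hm₂.1 a2 L2)
  have N1 := (strayField_lt_top E1).ne
  have N2 := (strayField_lt_top E2).ne
  obtain ⟨ε, hε, T₀, hT₀⟩ := exists_strayFieldDirichlet_superposition_le a1.re a2.re
    ENNReal.toReal_nonneg ENNReal.toReal_nonneg (ENNReal.ofReal_toReal N1).ge
    (ENNReal.ofReal_toReal N2).ge hδ
  -- The link has length `2`, so a cost of at most `δ / 2` adds at most `δ` to the local energy. The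
  -- threshold `2 * ε ^ 2` compensates the factor `2⁻¹` of the Sobolev bound. Both parts of the
  -- energy then grow by at most `δ` and enter with weight `1/2`.
  filter_upwards [eventually_ge_atTop T₀,
    (tendsto_linkCost hg).eventually (ge_mem_nhds (show (0 : ℝ) < δ / 2 by positivity)),
    (tendsto_linkErrorBound hg I1 I2).eventually (ge_mem_nhds (show (0 : ℝ) < 2 * ε ^ 2 by
      positivity))] with T hT hc he
  obtain ⟨heAC, heN⟩ := strayFieldDirichlet_linkError_le h0 a1 a2 hm₁.1 hm₂.1 i1 i2 I1 I2 T
  have hAC := locAC_linkMap a1 a2 hm₁.1 hm₂.1 i1 i2 T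
  have hN := hT₀ T hT (fun t => (linkMap m₁ m₂ T t).re) (linkError h m₁ m₂ T) (wellLevel h) hAC.re
    heAC (fun t => by rw [linkError]; ring)
    (heN.trans (ENNReal.ofReal_le_ofReal (by linarith)))
  have hL := localEnergy_linkMap_le h0 hm₁.continuous hm₂.continuous hm₁.1 hm₂.1 i1 i2 T
  refine ⟨memH1locCircle_of_localEnergy (h := h) (norm_linkMap hm₁.1 hm₂.1 T) hAC
    (hL.trans_lt (ENNReal.add_lt_top.2 ⟨ENNReal.add_lt_top.2 ⟨L1, L2⟩, ENNReal.ofReal_lt_top⟩)), ?_⟩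
  rw [ENNReal.ofReal_add (add_nonneg ENNReal.toReal_nonneg ENNReal.toReal_nonneg) hδ.le,
    ENNReal.ofReal_add ENNReal.toReal_nonneg ENNReal.toReal_nonneg, ENNReal.ofReal_toReal N1,
    ENNReal.ofReal_toReal N2] at hN
  have hL' := hL.trans (add_le_add_right (ENNReal.ofReal_le_ofReal
    (show 2 * linkCost h m₁ m₂ T ≤ δ by linarith)) _)
  rw [energy_eq, energy_eq, energy_eq]
  calc _ ≤ 2⁻¹ * (localEnergy h m₁ + localEnergy h m₂ + ENNReal.ofReal δ) +
        2⁻¹ * (strayFieldDirichlet (fun t => (m₁ t).re) + strayFieldDirichlet (fun t => (m₂ t).re) +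
          ENNReal.ofReal δ) := by gcongr
    _ = 2⁻¹ * localEnergy h m₁ + 2⁻¹ * strayFieldDirichlet (fun t => (m₁ t).re) +
        (2⁻¹ * localEnergy h m₂ + 2⁻¹ * strayFieldDirichlet (fun t => (m₂ t).re)) +
        (2⁻¹ + 2⁻¹) * ENNReal.ofReal δ := by ring
    _ = _ := by rw [ENNReal.inv_two_add_inv_two, one_mul]

end Link

/-! ### Maps into the upper half-circle that alternate between `1` and `-1` -/

/-- The maps of finite energy into the upper half-circle that take the values `(-1) ^ j`, for
`x < j ≤ y`, at successive points. -/
def alternating (h : ℝ) (x y : ℕ) : Set (ℝ → ℂ) :=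
  {m | MemH1locCircle m ∧ (∀ t, 0 ≤ (m t).im) ∧ energy h m < ⊤ ∧
    ∃ t : ℕ → ℝ, (∀ j, x < j → j < y → t j < t (j + 1)) ∧
      ∀ j, x < j → j ≤ y → (m (t j)).re = (-1) ^ j}

/-- The infimum of the energy over `alternating h x y`. -/
noncomputable def alternatingEnergy (h : ℝ) (x y : ℕ) : ℝ≥0∞ :=
  ⨅ m ∈ alternating h x y, energy h m

/-- The angle at infinity of a map after its `q`-th passage through `(-1) ^ q`. -/
noncomputable def phaseLimit (h : ℝ) (q : ℕ) : ℝ :=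
  q * Real.pi + Real.arccos ((-1) ^ q * wellLevel h)

/-- The winding number of a map that unfolds an element of `alternating h x y`. -/
noncomputable def alternatingDegree (h : ℝ) (x y : ℕ) : ℝ :=
  (phaseLimit h y - phaseLimit h x) / (2 * Real.pi)

theorem phaseLimit_even (h : ℝ) (i : ℕ) :
    phaseLimit h (2 * i) = 2 * Real.pi * i + wellAngle h := by
  rw [phaseLimit, pow_mul, neg_one_sq, one_pow, one_mul, wellAngle]
  push_cast; ring

theorem phaseLimit_odd (h : ℝ) (i : ℕ) :
    phaseLimit h (2 * i + 1) = 2 * Real.pi * (i + 1) - wellAngle h := by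
  rw [phaseLimit, pow_succ, pow_mul, neg_one_sq, one_pow, one_mul, neg_one_mul, Real.arccos_neg,
    wellAngle]
  push_cast; ring

/-- The angle in `[q π, (q + 1) π]` with cosine `f t`. -/
noncomputable def phaseBranch (f : ℝ → ℝ) (q : ℕ) (t : ℝ) : ℝ :=
  q * Real.pi + Real.arccos ((-1) ^ q * f t)

theorem neg_one_pow_mul_self (q : ℕ) : ((-1 : ℝ)) ^ q * (-1) ^ q = 1 := by
  rw [← mul_pow]; simp

theorem cos_phaseBranch {f : ℝ → ℝ} {t : ℝ} (hf : |f t| ≤ 1) (q : ℕ) :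
    Real.cos (phaseBranch f q t) = f t := by
  have h1 : |(-1) ^ q * f t| ≤ 1 := by rwa [abs_mul, abs_pow, abs_neg, abs_one, one_pow, one_mul]
  rw [phaseBranch, add_comm, Real.cos_add_nat_mul_pi, Real.cos_arccos (abs_le.1 h1).1
    (abs_le.1 h1).2, ← mul_assoc, neg_one_pow_mul_self, one_mul]

theorem continuous_phaseBranch {f : ℝ → ℝ} (hf : Continuous f) (q : ℕ) :
    Continuous (phaseBranch f q) :=
  continuous_const.add (Real.continuous_arccos.comp (continuous_const.mul hf))

/-- Consecutive branches meet at the angle `(q + 1) π`. -/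
theorem phaseBranch_eq_succ {f : ℝ → ℝ} {q : ℕ} {t : ℝ} (ht : f t = (-1) ^ (q + 1)) :
    phaseBranch f q t = phaseBranch f (q + 1) t := by
  rw [phaseBranch, phaseBranch, ht, neg_one_pow_mul_self, pow_succ, ← mul_assoc,
    neg_one_pow_mul_self, one_mul, Real.arccos_neg_one, Real.arccos_one]
  push_cast; ring

/-- The phase moves to the next branch at each passage, where the two branches agree. So it starts
on branch `x` and ends on branch `y`. The premise `x < y` covers the case without passages, in which
`t y` has no meaning. -/
theorem exists_phase {f : ℝ → ℝ} (hf : Continuous f) (h1 : ∀ t, |f t| ≤ 1) {t : ℕ → ℝ} {x : ℕ} :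
    ∀ y, x ≤ y → (∀ j, x < j → j < y → t j < t (j + 1)) →
      (∀ j, x < j → j ≤ y → f (t j) = (-1) ^ j) →
      ∃ φ : ℝ → ℝ, Continuous φ ∧ (∀ s, Real.cos (φ s) = f s) ∧
        φ =ᶠ[atBot] phaseBranch f x ∧ ∀ s, (x < y → t y ≤ s) → φ s = phaseBranch f y s := by
  intro y hxy
  induction y, hxy using Nat.le_induction with
  | base =>
    intro _ _
    exact ⟨phaseBranch f x, continuous_phaseBranch hf x, fun s => cos_phaseBranch (h1 s) x,
      EventuallyEq.rfl, fun _ _ => rfl⟩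
  | succ y hxy ih =>
    intro hlt hval
    obtain ⟨φ, hφ, hcos, hbot, htop⟩ := ih (fun j hj hj' => hlt j hj (by omega))
      fun j hj hj' => hval j hj (by omega)
    have hglue : φ (t (y + 1)) = phaseBranch f (y + 1) (t (y + 1)) := by
      rw [htop _ fun hy => (hlt y hy (by omega)).le,
        phaseBranch_eq_succ (hval (y + 1) (by omega) le_rfl)]
    refine ⟨fun s => if s ≤ t (y + 1) then φ s else phaseBranch f (y + 1) s,
      hφ.if_le (continuous_phaseBranch hf _) continuous_id continuous_const
        fun s hs => by rw [hs, hglue], fun s => ?_, ?_, fun s hs => ?_⟩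
    · dsimp only
      split_ifs
      · exact hcos s
      · exact cos_phaseBranch (h1 s) _
    · filter_upwards [hbot, eventually_le_atBot (t (y + 1))] with s hs hs'
      rw [if_pos hs', hs]
    · have hs' := hs (by omega)
      dsimp only
      rcases hs'.eq_or_lt with rfl | h3
      · rw [if_pos le_rfl, hglue]
      · rw [if_neg (not_le.2 h3)]

theorem tendsto_phaseBranch {h : ℝ} {f : ℝ → ℝ} {l : Filter ℝ}
    (hf : Tendsto f l (𝓝 (wellLevel h))) (q : ℕ) :
    Tendsto (phaseBranch f q) l (𝓝 (phaseLimit h q)) :=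
  ((Real.continuous_arccos.tendsto _).comp (hf.const_mul _)).const_add _

/-- The unfolded map has the same first component, so it agrees with `m` up to conjugation at each
point and `MemH1locCircle.fold` applies. Its phase has the limits `phaseLimit h x` and `phaseLimit h
y`. -/
theorem exists_admissible_of_alternating {h : ℝ} {x y : ℕ} (hxy : x ≤ y) {m : ℝ → ℂ}
    (hm : m ∈ alternating h x y) :
    ∃ m' ∈ admissible h (alternatingDegree h x y), energy h m' ≤ energy h m := by
  obtain ⟨hm, -, hE, t, hlt, hval⟩ := hm
  have hb : ∀ s, |(m s).re| ≤ 1 := fun s => (Complex.abs_re_le_norm _).trans (hm.1 s).le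
  obtain ⟨φ, hφ, hcos, hbot, htop⟩ := exists_phase hm.locAC.re.continuous hb y hxy hlt hval
  have hL := localEnergy_lt_top hE
  obtain ⟨h1, h2⟩ := hm.fold (h := h) (continuous_circlePoint.comp hφ) fun s =>
    eq_or_eq_conj (norm_circlePoint (φ s)) (hm.1 s) (hcos s)
  refine ⟨_, ⟨h1, h2.trans_lt hE, φ, phaseLimit h x, phaseLimit h y, hφ, fun _ => rfl, ?_, ?_, rfl⟩,
    h2⟩
  · exact (tendsto_phaseBranch (tendsto_re_atBot hm.1 hm.locAC hL) x).congr' hbot.symm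
  · refine (tendsto_phaseBranch (tendsto_re_atTop hm.1 hm.locAC hL) y).congr' ?_
    filter_upwards [eventually_ge_atTop (t y)] with s hs using (htop s fun _ => hs).symm

theorem minEnergy_le_alternatingEnergy (h : ℝ) {x y : ℕ} (hxy : x ≤ y) :
    minEnergy h (alternatingDegree h x y) ≤ alternatingEnergy h x y := by
  refine le_iInf₂ fun m hm => ?_
  obtain ⟨m', hm', hle⟩ := exists_admissible_of_alternating hxy hm
  exact (iInf₂_le m' hm').trans hle

/-- Near-optimal maps for both ranges are placed side by side by `linkMap`; their passages follow
one another. -/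
theorem alternatingEnergy_le_add {h : ℝ} (h0 : 0 ≤ h) {x y z : ℕ} :
    alternatingEnergy h x z ≤ alternatingEnergy h x y + alternatingEnergy h y z := by
  have key : ∀ m₁ ∈ alternating h x y, ∀ m₂ ∈ alternating h y z,
      alternatingEnergy h x z ≤ energy h m₁ + energy h m₂ := by
    rintro m₁ ⟨hm₁, i1, E1, t₁, lt1, v1⟩ m₂ ⟨hm₂, i2, E2, t₂, lt2, v2⟩
    refine ENNReal.le_of_forall_pos_le_add fun δ hδ _ => ?_
    -- For such `T` the shifted passages of `m₁` lie to the left of the link, and those of `m₂` to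
    -- its right.
    have hfin : ∀ᶠ T in atTop, ∀ j ∈ Finset.range (y + z + 1), t₁ j + 1 ≤ T ∧ 1 - t₂ j ≤ T :=
      (Filter.eventually_all_finset _).2 fun j _ =>
        (eventually_ge_atTop _).and (eventually_ge_atTop _)
    obtain ⟨T, hT, hm, hle⟩ :=
      (hfin.and (energy_linkMap_le h0 hm₁ hm₂ i1 i2 E1 E2 (NNReal.coe_pos.2 hδ))).exists
    have l1 : ∀ j ≤ y, t₁ j - T ≤ -1 := fun j hj => by
      linarith [(hT j (Finset.mem_range.2 (by omega))).1]
    have l2 : ∀ j ≤ z, 1 ≤ t₂ j + T := fun j hj => by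
      linarith [(hT j (Finset.mem_range.2 (by omega))).2]
    rw [ENNReal.ofReal_coe_nnreal] at hle
    refine (iInf₂_le (linkMap m₁ m₂ T) ⟨hm, im_linkMap_nonneg hm₁.1 hm₂.1 i1 i2 T,
      hle.trans_lt (by simp [E1, E2]), fun j => if j ≤ y then t₁ j - T else t₂ j + T,
      fun j hj hj' => ?_, fun j hj hj' => ?_⟩).trans hle
    · dsimp only
      split_ifs with h3 h4 h4
      · linarith [lt1 j hj (by omega)]
      · linarith [l1 j h3, l2 (j + 1) (by omega)]
      · omega
      · linarith [lt2 j (by omega) hj']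
    · dsimp only
      split_ifs with h3
      · rw [linkMap_left (l1 j h3), sub_add_cancel, v1 j hj h3]
      · rw [linkMap_right (l2 j hj'), add_neg_cancel_right, v2 j (by omega) hj']
  simp only [alternatingEnergy] at key ⊢
  rw [ENNReal.iInf_add]
  refine le_iInf fun m₁ => ?_
  rw [ENNReal.iInf_add]
  refine le_iInf fun hm₁ => ?_
  rw [ENNReal.add_iInf]
  refine le_iInf fun m₂ => ?_
  rw [ENNReal.add_iInf]
  exact le_iInf fun hm₂ => key m₁ hm₁ m₂ hm₂

/-! ### The passages of a map of given winding number -/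

/-- The supremum of `{φ ≤ c}` is such a point. Taking last passages makes the times for increasing
levels increase, as `exists_passages` needs. -/
theorem exists_last_passage {φ : ℝ → ℝ} (hφ : Continuous φ) {a b c : ℝ}
    (ha : Tendsto φ atBot (𝓝 a)) (hb : Tendsto φ atTop (𝓝 b)) (hac : a < c) (hcb : c < b) :
    ∃ s, φ s = c ∧ ∀ t, s < t → c < φ t := by
  obtain ⟨B, hB⟩ := eventually_atTop.1 (hb.eventually (lt_mem_nhds hcb))
  obtain ⟨A, hA⟩ := (ha.eventually (gt_mem_nhds hac)).exists
  have hbdd : BddAbove {t | φ t ≤ c} := ⟨B, fun t ht => le_of_not_ge fun h => (hB t h).not_ge ht⟩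
  have hmem : sSup {t | φ t ≤ c} ∈ {t | φ t ≤ c} :=
    (isClosed_le hφ continuous_const).csSup_mem ⟨A, hA.le⟩ hbdd
  have hgt : ∀ t, sSup {t | φ t ≤ c} < t → c < φ t := fun t ht =>
    lt_of_not_ge fun h => ht.not_ge (le_csSup hbdd h)
  refine ⟨_, le_antisymm hmem ?_, hgt⟩
  exact ge_of_tendsto ((hφ.tendsto _).mono_left nhdsWithin_le_nhds : Tendsto φ (𝓝[>] _) _)
    (eventually_nhdsWithin_of_forall fun t ht => (hgt t ht).le)

theorem exists_passages {φ : ℝ → ℝ} (hφ : Continuous φ) {a b : ℝ} (ha : Tendsto φ atBot (𝓝 a))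
    (hb : Tendsto φ atTop (𝓝 b)) {c : ℕ → ℝ} (hc : StrictMono c) {y : ℕ} (hac : a < c 1)
    (hcb : c y < b) :
    ∃ t : ℕ → ℝ, (∀ j, 0 < j → j < y → t j < t (j + 1)) ∧ ∀ j, 0 < j → j ≤ y → φ (t j) = c j := by
  have hex : ∀ j, ∃ s, 0 < j → j ≤ y → φ s = c j ∧ ∀ t, s < t → c j < φ t := fun j => by
    by_cases hj : 0 < j ∧ j ≤ y
    · obtain ⟨s, hs⟩ := exists_last_passage hφ ha hb (hac.trans_le (hc.monotone hj.1))
        ((hc.monotone hj.2).trans_lt hcb)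
      exact ⟨s, fun _ _ => hs⟩
    · exact ⟨0, fun h1 h2 => (hj ⟨h1, h2⟩).elim⟩
  choose t ht using hex
  refine ⟨t, fun j hj hj' => ?_, fun j hj hj' => (ht j hj hj').1⟩
  obtain ⟨e1, l1⟩ := ht j hj hj'.le
  obtain ⟨e2, l2⟩ := ht (j + 1) (by omega) hj'
  have hlt := hc (Nat.lt_succ_self j)
  rcases lt_trichotomy (t j) (t (j + 1)) with h | h | h
  · exact h
  · rw [h] at e1; rw [Nat.succ_eq_add_one] at hlt; linarith
  · have := l2 _ h; rw [Nat.succ_eq_add_one] at hlt; linarith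

theorem upperFold_mem_alternating {h : ℝ} {m : ℝ → ℂ} (hm : MemH1locCircle m)
    (hE : energy h m < ⊤) {y : ℕ} {t : ℕ → ℝ} (hlt : ∀ j, 0 < j → j < y → t j < t (j + 1))
    (hval : ∀ j, 0 < j → j ≤ y → (m (t j)).re = (-1) ^ j) :
    upperFold m ∈ alternating h 0 y ∧ energy h (upperFold m) ≤ energy h m := by
  obtain ⟨h1, h2⟩ := hm.upperFold (h := h)
  exact ⟨⟨h1, fun s => abs_nonneg _, h2.trans_lt hE, t, hlt, hval⟩, h2⟩

theorem cos_wellAngle {h : ℝ} (h0 : 0 ≤ h) : Real.cos (wellAngle h) = wellLevel h :=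
  Real.cos_arccos (by linarith [wellLevel_nonneg h0]) (wellLevel_le_one h)

theorem wellAngle_le {h : ℝ} (h0 : 0 ≤ h) : wellAngle h ≤ Real.pi / 2 :=
  Real.arccos_le_pi_div_two.2 (wellLevel_nonneg h0)

/-- The potential forces `cos a = cos b = k`, so `a` is `α` or `-α` modulo `2π`, while `b = a + 2πℓ
- 2α`. In the first case exactly `2ℓ - 1` multiples of `π` lie strictly between `a` and `b`,
starting with an odd one, and folding gives the claim. In the second case the condition at `b`
leaves only `k = 0` and `k = 1`. -/
theorem exists_alternating_of_admissible {h : ℝ} (h0 : 0 ≤ h) {ℓ : ℕ} (hℓ : 1 ≤ ℓ) {m : ℝ → ℂ}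
    (hm : m ∈ admissible h (ℓ - wellAngle h / Real.pi)) :
    ∃ m' ∈ alternating h 0 (2 * ℓ - 1), energy h m' ≤ energy h m := by
  obtain ⟨hm, hE, φ, a, b, hφ, hlift, ha, hb, hd⟩ := hm
  have hπ := Real.pi_pos
  have hre : (fun t => (m t).re) = fun t => Real.cos (φ t) := funext fun t => by rw [hlift]
  have hL := localEnergy_lt_top hE
  have hr1 := tendsto_re_atBot hm.1 hm.locAC hL
  have hr2 := tendsto_re_atTop hm.1 hm.locAC hL
  rw [hre] at hr1 hr2
  have ca : Real.cos (wellAngle h) = Real.cos a := by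
    rw [cos_wellAngle h0]
    exact tendsto_nhds_unique hr1 ((Real.continuous_cos.tendsto a).comp ha)
  have cb : Real.cos b = Real.cos (wellAngle h) := by
    rw [cos_wellAngle h0]
    exact tendsto_nhds_unique ((Real.continuous_cos.tendsto b).comp hb) hr2
  have hba : b = a + 2 * Real.pi * ℓ - 2 * wellAngle h := by
    field_simp at hd
    linarith
  have hα0 : 0 ≤ wellAngle h := Real.arccos_nonneg _
  have hα := wellAngle_le h0
  have hy : ((2 * ℓ - 1 : ℕ) : ℝ) = 2 * ℓ - 1 := by
    rw [Nat.cast_sub (by omega)]; push_cast; ring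
  obtain ⟨i, hi⟩ := Real.cos_eq_cos_iff.1 ca
  have hfirst : a = 2 * i * Real.pi + wellAngle h →
      ∃ m' ∈ alternating h 0 (2 * ℓ - 1), energy h m' ≤ energy h m := by
    intro hi
    obtain ⟨t, hlt, hval⟩ := exists_passages (c := fun j : ℕ => j * Real.pi + i * (2 * Real.pi))
      (y := 2 * ℓ - 1) hφ ha hb
      (fun j l hjl => by
        have : (j : ℝ) < l := Nat.cast_lt.2 hjl
        dsimp only; nlinarith)
      (by push_cast; nlinarith) (by rw [hy]; nlinarith)
    refine ⟨_, upperFold_mem_alternating hm hE hlt fun j hj hj' => ?_⟩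
    rw [congrFun hre (t j), hval j hj hj', Real.cos_add_int_mul_two_pi]
    simpa using Real.cos_add_nat_mul_pi 0 j
  rcases hi with hi | hi
  · exact hfirst hi
  -- If `a = -α` modulo `2π`, then `b = -3α`. The triple-angle formula turns `cos 3α = cos α` into
  -- `4k(k - 1)(k + 1) = 0`.
  have c3 : Real.cos (3 * wellAngle h) = wellLevel h := by
    rw [← cos_wellAngle h0, ← cb, hba, hi, ← Real.cos_neg (_ - _),
      show -(2 * (i : ℝ) * Real.pi - wellAngle h + 2 * Real.pi * ℓ - 2 * wellAngle h) =
        3 * wellAngle h + ((-(i + ℓ) : ℤ) : ℝ) * (2 * Real.pi) by push_cast; ring,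
      Real.cos_add_int_mul_two_pi]
  rw [Real.cos_three_mul, cos_wellAngle h0] at c3
  have hk0 := wellLevel_nonneg h0
  have hk : wellLevel h = 0 ∨ wellLevel h = 1 := by
    have : wellLevel h * ((wellLevel h - 1) * (4 * (wellLevel h + 1))) = 0 := by linear_combination c3
    rcases mul_eq_zero.1 this with h3 | h3
    · exact Or.inl h3
    · rcases mul_eq_zero.1 h3 with h4 | h4
      · exact Or.inr (by linarith)
      · linarith
  rcases hk with hk | hk
  · have hh : h = 0 := by
      rcases min_choice h 1 with h3 | h3
      · rw [wellLevel, h3] at hk; exact hk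
      · rw [wellLevel, h3] at hk; norm_num at hk
    have hα' : wellAngle h = Real.pi / 2 := by rw [wellAngle, hk, Real.arccos_zero]
    subst hh
    obtain ⟨n1, n2⟩ := hm.neg
    -- Here the first multiple of `π` above `a = -π/2` (modulo `2π`) is an even one. The levels are
    -- shifted by `-π`, and the wrong sign is corrected by passing to `-m`.
    obtain ⟨t, hlt, hval⟩ := exists_passages
      (c := fun j : ℕ => j * Real.pi + (i * (2 * Real.pi) - Real.pi))
      (y := 2 * ℓ - 1) hφ ha hb
      (fun j l hjl => by
        have : (j : ℝ) < l := Nat.cast_lt.2 hjl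
        dsimp only; nlinarith)
      (by push_cast; nlinarith) (by rw [hy]; nlinarith)
    obtain ⟨r1, r2⟩ := upperFold_mem_alternating n1 (n2.trans_lt hE) hlt fun j hj hj' => by
      have : (m (t j)).re = Real.cos (φ (t j)) := congrFun hre (t j)
      rw [Complex.neg_re, this, hval j hj hj', add_comm, Real.cos_add_nat_mul_pi, Real.cos_sub_pi]
      have h5 := Real.cos_add_int_mul_two_pi 0 i
      rw [zero_add, Real.cos_zero] at h5
      rw [h5]; ring
    exact ⟨_, r1, r2.trans n2⟩
  · have hα' : wellAngle h = 0 := by rw [wellAngle, hk, Real.arccos_one]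
    exact hfirst (by rw [hi, hα']; ring)

/-- Passages that are symmetric about the origin can be achieved without increasing the energy. -/
theorem exists_symmetric_passages {h : ℝ} {ℓ : ℕ} (hℓ : 1 ≤ ℓ) {m : ℝ → ℂ}
    (hm : m ∈ alternating h 0 (2 * ℓ - 1)) :
    ∃ (m' : ℝ → ℂ) (t : ℕ → ℝ), MemH1locCircle m' ∧ (∀ s, 0 ≤ (m' s).im) ∧
      energy h m' ≤ energy h m ∧
      (∀ j, 0 < j → j < 2 * ℓ - 1 → t j < t (j + 1)) ∧
      (∀ j, 0 < j → j ≤ 2 * ℓ - 1 → (m' (t j)).re = (-1) ^ j) ∧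
      ∀ j, 0 < j → j ≤ 2 * ℓ - 1 → t (2 * ℓ - j) = - t j := by
  obtain ⟨hm, him, hE, t, hlt, hval⟩ := hm
  have hmono : ∀ i j, 0 < i → i ≤ j → j ≤ 2 * ℓ - 1 → t i ≤ t j := fun i j hi hij => by
    induction j, hij using Nat.le_induction with
    | base => exact fun _ => le_rfl
    | succ j hij ih => exact fun hj => (ih (by omega)).trans (hlt j (by omega) (by omega)).le
  -- The index `ℓ` is the fixed point of `j ↦ 2ℓ - j`, so the map is centred at the middle passage
  -- before it is reflected.
  have hE' := energy_comp_add (h := h) hm.locAC (t ℓ)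
  obtain ⟨m', hm', h1, h2⟩ := exists_even (h := h) (hm.comp_add (t ℓ)) (hE'.trans_lt hE)
  rw [hE'] at h2
  -- Since `2ℓ - j` and `j` have the same parity, mirrored passages take the required values. The
  -- half that is reflected keeps its own passages, and the other ones are their mirror images.
  have hpar : ∀ j, 0 < j → j ≤ 2 * ℓ - 1 → ((-1 : ℝ)) ^ (2 * ℓ - j) = (-1) ^ j := fun j hj hj' => by
    rw [← mul_left_inj' (pow_ne_zero j (show (-1 : ℝ) ≠ 0 by norm_num)), ← pow_add,
      Nat.sub_add_cancel (by omega), neg_one_pow_mul_self, pow_mul, neg_one_sq, one_pow]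
  rcases hm' with rfl | rfl
  · refine ⟨_, fun j => if j ≤ ℓ then t j - t ℓ else t ℓ - t (2 * ℓ - j), h1, fun s => him _, h2,
      fun j hj hj' => ?_, fun j hj hj' => ?_, fun j hj hj' => ?_⟩
    · dsimp only
      split_ifs with h3 h4 h4
      · linarith [hlt j hj hj']
      · have := hlt (2 * ℓ - (j + 1)) (by omega) (by omega)
        have e : 2 * ℓ - (j + 1) + 1 = ℓ := by omega
        have e' : j = ℓ := by omega
        rw [e] at this; rw [e'] at this ⊢; linarith
      · omega
      · have := hlt (2 * ℓ - (j + 1)) (by omega) (by omega)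
        rw [show 2 * ℓ - (j + 1) + 1 = 2 * ℓ - j by omega] at this
        linarith
    · dsimp only
      split_ifs with h3
      · have := hmono j ℓ hj h3 (by omega)
        rw [abs_of_nonpos (by linarith), neg_neg, sub_add_cancel, hval j hj hj']
      · have := hmono (2 * ℓ - j) ℓ (by omega) (by omega) (by omega)
        rw [abs_of_nonneg (by linarith), neg_sub, sub_add_cancel, hval _ (by omega) (by omega),
          hpar j hj hj']
    · dsimp only
      split_ifs with h3 h4 h4
      · have : j = ℓ := by omega
        subst this
        rw [show 2 * j - j = j by omega]; ring
      · ring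
      · rw [show 2 * ℓ - (2 * ℓ - j) = j by omega]; ring
      · omega
  · refine ⟨_, fun j => if ℓ ≤ j then t j - t ℓ else t ℓ - t (2 * ℓ - j), h1, fun s => him _, h2,
      fun j hj hj' => ?_, fun j hj hj' => ?_, fun j hj hj' => ?_⟩
    · dsimp only
      split_ifs with h3 h4 h4
      · linarith [hlt j hj hj']
      · omega
      · have := hmono ℓ (2 * ℓ - j) (by omega) (by omega) (by omega)
        have h5 := hlt (2 * ℓ - (j + 1)) (by omega) (by omega)
        rw [show 2 * ℓ - (j + 1) + 1 = 2 * ℓ - j by omega] at h5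
        have e : 2 * ℓ - (j + 1) = ℓ := by omega
        have e' : j + 1 = ℓ := by omega
        rw [e] at h5; rw [e']; linarith
      · have := hlt (2 * ℓ - (j + 1)) (by omega) (by omega)
        rw [show 2 * ℓ - (j + 1) + 1 = 2 * ℓ - j by omega] at this
        linarith
    · dsimp only
      split_ifs with h3
      · have := hmono ℓ j (by omega) h3 (by omega)
        rw [abs_of_nonneg (by linarith), sub_add_cancel, hval j hj hj']
      · have := hmono ℓ (2 * ℓ - j) (by omega) (by omega) (by omega)
        rw [abs_of_nonpos (by linarith), neg_sub, sub_add_cancel, hval _ (by omega) (by omega),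
          hpar j hj hj']
    · dsimp only
      split_ifs with h3 h4 h4
      · have : j = ℓ := by omega
        subst this
        rw [show 2 * j - j = j by omega]; ring
      · ring
      · rw [show 2 * ℓ - (2 * ℓ - j) = j by omega]; ring
      · omega

/-! ### A map of finite energy -/

theorem strayFieldDirichlet_sub_const (f : ℝ → ℝ) (c : ℝ) :
    strayFieldDirichlet (fun t => f t - c) = strayFieldDirichlet f := by
  simp only [strayFieldDirichlet, IsStrayField, deriv_sub_const]

/-- The angle of a map that passes once through `-1`. -/
noncomputable def tentAngle (h t : ℝ) : ℝ :=
  wellAngle h + (Real.pi - wellAngle h) * max 0 (1 - |t|)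

/-- The angle rises linearly from `α` to `π` and returns. This provides finiteness of the infimum
for `ℓ = 1`, where there is no strict inequality to provide it. -/
theorem alternating_zero_one_nonempty {h : ℝ} (h0 : 0 ≤ h) : (alternating h 0 1).Nonempty := by
  have hπ := Real.pi_pos
  have hα0 : 0 ≤ wellAngle h := Real.arccos_nonneg _
  have hα := wellAngle_le h0
  set m : ℝ → ℂ := fun t => circlePoint (tentAngle h t) with hmdef
  have hn : ∀ t, ‖m t‖ = 1 := fun t => norm_circlePoint _
  have hlip : ∀ a b, ‖m b - m a‖ ≤ 2 * Real.pi * |b - a| := fun a b => by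
    refine (norm_circlePoint_sub_le _ _).trans ?_
    rw [mul_assoc]
    refine mul_le_mul_of_nonneg_left ?_ zero_le_two
    rw [tentAngle, tentAngle, add_sub_add_left_eq_sub, ← mul_sub, abs_mul,
      abs_of_nonneg (by linarith : 0 ≤ Real.pi - wellAngle h)]
    refine mul_le_mul (by linarith) ?_ (abs_nonneg _) hπ.le
    have h1 := abs_max_sub_max_le_abs (1 - |b|) (1 - |a|) 0
    rw [max_comm _ (0 : ℝ), max_comm _ (0 : ℝ)] at h1
    refine h1.trans ?_
    rw [sub_sub_sub_cancel_left, abs_sub_comm b a]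
    exact abs_abs_sub_abs_le_abs_sub a b
  have hAC : LocAC m := locAC_of_bound (G := fun _ => 2 * Real.pi) (locallyIntegrable_const _)
    fun a b hab => by
      have := hlip a b
      rw [abs_of_nonneg (sub_nonneg.2 hab)] at this
      rw [intervalIntegral.integral_const, smul_eq_mul, mul_comm]; exact this
  have hout : ∀ t, 1 ≤ |t| → m t = circlePoint (wellAngle h) := fun t ht => by
    simp only [hmdef, tentAngle]
    rw [max_eq_left (by linarith), mul_zero, add_zero]
  have hL : localEnergy h m < ⊤ := by
    have hle : ∀ t, localDensity h m t ≤ (2 * Real.pi) ^ 2 + 2 * (2⁻¹ * (1 + 4 * h)) := fun t => by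
      have h1 : ‖deriv m t‖ ≤ 2 * Real.pi := norm_deriv_le_of_lip' (by positivity)
        (Eventually.of_forall fun s => hlip t s)
      have h2 := pow_le_pow_left₀ (norm_nonneg _) h1 2
      have h3 : |(m t).re| ≤ 1 := (Complex.abs_re_le_norm _).trans (hn t).le
      have h4 : (m t).re ^ 2 ≤ 1 := (sq_le_one_iff_abs_le_one _).2 h3
      rw [abs_le] at h3
      have h5 := wellLevel_le_one h
      rw [localDensity, anisotropy]
      nlinarith [sq_nonneg (wellLevel h)]
    have hzero : ∀ t, 1 < |t| → localDensity h m t = 0 := fun t ht => by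
      have hev : m =ᶠ[𝓝 t] fun _ => circlePoint (wellAngle h) := by
        filter_upwards [continuous_abs.continuousAt.eventually (lt_mem_nhds ht)] with s hs
          using hout s (le_of_lt hs)
      rw [localDensity, hev.deriv_eq, hev.self_of_nhds, deriv_const, anisotropy]
      simp only [circlePoint, cos_wellAngle h0, norm_zero]
      ring
    have hind : localEnergy h m ≤ ∫⁻ t, (Set.Icc (-1 : ℝ) 1).indicator
        (fun _ => ENNReal.ofReal ((2 * Real.pi) ^ 2 + 2 * (2⁻¹ * (1 + 4 * h)))) t := by
      refine lintegral_mono fun t => ?_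
      by_cases ht : t ∈ Set.Icc (-1 : ℝ) 1
      · rw [Set.indicator_of_mem ht]; exact ENNReal.ofReal_le_ofReal (hle t)
      · rw [hzero t (lt_of_not_ge fun h => ht (abs_le.1 h)), ENNReal.ofReal_zero]
        exact zero_le
    refine hind.trans_lt ?_
    rw [lintegral_indicator measurableSet_Icc, lintegral_const, Measure.restrict_apply_univ,
      Real.volume_Icc]
    exact ENNReal.mul_lt_top ENNReal.ofReal_lt_top ENNReal.ofReal_lt_top
  have hm := memH1locCircle_of_localEnergy hn hAC hL
  have hI := integrable_localDensity hn hAC.continuous hL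
  have hsq := fun t => sq_add_norm_deriv_sq_le (h := h) hn t
  have hN : strayFieldDirichlet (fun t => (m t).re) < ⊤ := by
    -- The stray field depends only on the derivative. After subtraction of `k` the first component
    -- is square integrable and the Sobolev bound applies.
    rw [← strayFieldDirichlet_sub_const _ (wellLevel h)]
    have hAC' : LocAC fun t => (m t).re - wellLevel h := hAC.re.sub_const _
    refine (strayFieldDirichlet_le_sobolev hAC' ?_ ?_).trans_lt ENNReal.ofReal_lt_top
    · refine hI.mono' (hAC'.continuous.pow 2).aestronglyMeasurable (Eventually.of_forall fun t => ?_)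
      rw [Real.norm_of_nonneg (sq_nonneg _)]
      linarith [hsq t, sq_nonneg ‖deriv m t‖]
    · refine hI.mono' ((measurable_deriv _).pow_const 2).aestronglyMeasurable ?_
      filter_upwards [hAC.ae_hasDerivAt] with t ht
      rw [Real.norm_of_nonneg (sq_nonneg _), (ht.re'.sub_const _).deriv, ← sq_abs]
      have := pow_le_pow_left₀ (abs_nonneg _) (Complex.abs_re_le_norm (deriv m t)) 2
      linarith [hsq t, sq_nonneg ((m t).re - wellLevel h)]
  refine ⟨m, hm, fun t => ?_, ?_, fun _ => 0, fun j h1 h2 => by omega, fun j h1 h2 => ?_⟩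
  · have h1 : max 0 (1 - |t|) ≤ 1 := max_le zero_le_one (by linarith [abs_nonneg t])
    have h2 : 0 ≤ max 0 (1 - |t|) := le_max_left _ _
    exact Real.sin_nonneg_of_nonneg_of_le_pi (by rw [tentAngle]; nlinarith)
      (by rw [tentAngle]; nlinarith)
  · rw [energy_eq]
    exact ENNReal.add_lt_top.2 ⟨ENNReal.mul_lt_top (by simp) hL, ENNReal.mul_lt_top (by simp) hN⟩
  · obtain rfl : j = 1 := by omega
    simp [hmdef, circlePoint, tentAngle]

/-! ### Compactness of sequences of bounded energy -/

theorem integral_norm_deriv_sq_le {h : ℝ} {m : ℝ → ℂ} (hm : MemH1locCircle m) {K : ℝ≥0∞}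
    (hK : K ≠ ⊤) (hE : energy h m ≤ K) :
    Integrable (fun t => ‖deriv m t‖ ^ 2) ∧ ∫ t, ‖deriv m t‖ ^ 2 ≤ (2 * K).toReal := by
  have hL : localEnergy h m ≤ 2 * K := by
    rw [← ENNReal.inv_mul_le_iff two_ne_zero ENNReal.ofNat_ne_top]
    exact (le_self_add.trans (energy_eq h m).ge).trans hE
  have h2K : 2 * K ≠ ⊤ := ENNReal.mul_ne_top ENNReal.ofNat_ne_top hK
  have hI := integrable_norm_deriv_sq hm.1 hm.continuous (hL.trans_lt h2K.lt_top)
  refine ⟨hI, ?_⟩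
  rw [integral_eq_lintegral_of_nonneg_ae (Eventually.of_forall fun t => sq_nonneg _)
    hI.aestronglyMeasurable]
  refine ENNReal.toReal_mono h2K (le_trans (lintegral_mono fun t => ?_) hL)
  exact ENNReal.ofReal_le_ofReal (norm_deriv_sq_le_localDensity hm.1 t)

/-- A common modulus of continuity. -/
def UniformlyEquicontinuous (m : ℕ → ℝ → ℂ) : Prop :=
  ∀ ε > 0, ∃ δ > 0, ∀ n a b, |b - a| < δ → ‖m n b - m n a‖ < ε

theorem uniformlyEquicontinuous_of_energy {m : ℕ → ℝ → ℂ} (hm : ∀ n, LocAC (m n))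
    (hI : ∀ n, Integrable (fun t => ‖deriv (m n) t‖ ^ 2)) {C : ℝ}
    (hC : ∀ n, ∫ t, ‖deriv (m n) t‖ ^ 2 ≤ C) : UniformlyEquicontinuous m := by
  intro ε hε
  have hC0 : 0 ≤ C := (integral_nonneg fun t => sq_nonneg _).trans (hC 0)
  have hr : 0 < ε / (2 * (C + 1)) := by positivity
  refine ⟨ε / (2 * (C + 1)) * (ε / 2), by positivity, fun n a b hab => ?_⟩
  refine ((hm n).norm_sub_le_of_energy (hI n) (hC n) hr a b).trans_lt ?_
  have h1 : ε / (2 * (C + 1)) * C ≤ ε / 2 := by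
    rw [div_mul_eq_mul_div, div_le_div_iff₀ (by positivity) zero_lt_two]; nlinarith
  have h2 : (ε / (2 * (C + 1)))⁻¹ * |b - a| < ε / 2 := by
    rw [inv_mul_lt_iff₀ hr]; exact hab
  linarith

/-- This is Arzelà–Ascoli by a diagonal argument. Values at rational points, gaps and energies
together live in a countable product of compact metrizable spaces, and equicontinuity extends the
convergence to all points. -/
theorem exists_subseq_tendsto {m : ℕ → ℝ → ℂ} (h1 : ∀ n s, ‖m n s‖ = 1)
    (hm : UniformlyEquicontinuous m) (t : ℕ → ℕ → ℝ) (L N : ℕ → ℝ≥0∞) :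
    ∃ (σ : ℕ → ℕ) (g : ℕ → ℝ → ℂ) (gap : ℕ → ℝ≥0∞) (L₀ N₀ : ℝ≥0∞), StrictMono σ ∧
      (∀ j s, Tendsto (fun n => m (σ n) (s + t (σ n) j)) atTop (𝓝 (g j s))) ∧
      (∀ j, Tendsto (fun n => ENNReal.ofReal (t (σ n) (j + 1) - t (σ n) j)) atTop (𝓝 (gap j))) ∧
      Tendsto (fun n => L (σ n)) atTop (𝓝 L₀) ∧ Tendsto (fun n => N (σ n)) atTop (𝓝 N₀) := by
  let X := (ℕ × ℚ → Metric.closedBall (0 : ℂ) 1) × (ℕ → ℝ≥0∞) × ℝ≥0∞ × ℝ≥0∞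
  let u : ℕ → X := fun n => (fun p => ⟨m n (p.2 + t n p.1), by simp [h1]⟩,
    fun j => ENNReal.ofReal (t n (j + 1) - t n j), L n, N n)
  obtain ⟨v, σ, hσ, hv⟩ := SeqCompactSpace.tendsto_subseq u
  have hcauchy : ∀ j s, CauchySeq fun n => m (σ n) (s + t (σ n) j) := by
    intro j s
    rw [Metric.cauchySeq_iff]
    intro ε hε
    obtain ⟨δ, hδ, hmδ⟩ := hm (ε / 3) (by positivity)
    obtain ⟨q, hq⟩ := exists_rat_near s hδ
    have hlim : Tendsto (fun n => m (σ n) (q + t (σ n) j)) atTop (𝓝 (v.1 (j, q))) :=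
      (continuous_subtype_val.tendsto _).comp
        ((continuous_apply (j, q)).tendsto _ |>.comp ((continuous_fst.tendsto v).comp hv))
    obtain ⟨M, hM⟩ := Metric.cauchySeq_iff.1 hlim.cauchySeq (ε / 3) (by positivity)
    refine ⟨M, fun a ha b hb => ?_⟩
    have e1 := hmδ (σ a) (q + t (σ a) j) (s + t (σ a) j) (by rwa [add_sub_add_right_eq_sub])
    have e2 := hmδ (σ b) (s + t (σ b) j) (q + t (σ b) j) (by
      rwa [add_sub_add_right_eq_sub, abs_sub_comm])
    have e3 := hM a ha b hb
    rw [← dist_eq_norm] at e1 e2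
    have e4 := dist_triangle4 (m (σ a) (s + t (σ a) j)) (m (σ a) (q + t (σ a) j))
      (m (σ b) (q + t (σ b) j)) (m (σ b) (s + t (σ b) j))
    linarith
  choose g hg using fun j s => cauchySeq_tendsto_of_complete (hcauchy j s)
  have hv2 := (continuous_snd.tendsto v).comp hv
  refine ⟨σ, g, v.2.1, v.2.2.1, v.2.2.2, hσ, hg, fun j => ?_, ?_, ?_⟩
  · exact ((continuous_apply j).tendsto _).comp ((continuous_fst.tendsto v.2).comp hv2)
  · exact (continuous_fst.tendsto v.2.2).comp ((continuous_snd.tendsto v.2).comp hv2)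
  · exact (continuous_snd.tendsto v.2.2).comp ((continuous_snd.tendsto v.2).comp hv2)

/-! ### Profiles -/

/-- The maps `m n` pass through `(-1) ^ j` at `t n j`, for `0 < j ≤ N`, the maps centred at these
points converge to the profiles `g j`, and the distances of successive points converge in
`[0, ∞]` to `gap j`. -/
structure HasProfiles (h : ℝ) (N : ℕ) (m : ℕ → ℝ → ℂ) (t : ℕ → ℕ → ℝ) (g : ℕ → ℝ → ℂ)
    (gap : ℕ → ℝ≥0∞) : Prop where
  norm_eq_one : ∀ n s, ‖m n s‖ = 1
  im_nonneg : ∀ n s, 0 ≤ (m n s).im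
  equicontinuous : UniformlyEquicontinuous m
  lt_succ : ∀ n j, 0 < j → j < N → t n j < t n (j + 1)
  passage : ∀ n j, 0 < j → j ≤ N → (m n (t n j)).re = (-1) ^ j
  tendsto_profile : ∀ j s, Tendsto (fun n => m n (s + t n j)) atTop (𝓝 (g j s))
  tendsto_gap : ∀ j, Tendsto (fun n => ENNReal.ofReal (t n (j + 1) - t n j)) atTop (𝓝 (gap j))
  locAC : ∀ j, LocAC (g j)
  energy_lt_top : ∀ j, energy h (g j) < ⊤

/-- The indices in `(x, y]` of the passages that start a new cluster. -/
noncomputable def clusterStarts (gap : ℕ → ℝ≥0∞) (x y : ℕ) : Finset ℕ :=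
  open Classical in (Finset.Ioc x y).filter fun j => j = x + 1 ∨ gap (j - 1) = ⊤

theorem mem_clusterStarts {gap : ℕ → ℝ≥0∞} {x y j : ℕ} :
    j ∈ clusterStarts gap x y ↔ (x < j ∧ j ≤ y) ∧ (j = x + 1 ∨ gap (j - 1) = ⊤) := by
  simp [clusterStarts]

/-- An infinite gap at `y` makes `y + 1` a start also within the larger range. -/
theorem sum_clusterStarts_add {gap : ℕ → ℝ≥0∞} {x y z : ℕ} (hxy : x < y) (hyz : y < z)
    (hy : gap y = ⊤) (f : ℕ → ℝ≥0∞) :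
    ∑ j ∈ clusterStarts gap x y, f j + ∑ j ∈ clusterStarts gap y z, f j =
      ∑ j ∈ clusterStarts gap x z, f j := by
  rw [← Finset.sum_union]
  · congr 1
    ext j
    simp only [Finset.mem_union, mem_clusterStarts]
    constructor
    · rintro (⟨h1, h2⟩ | ⟨h1, rfl | h2⟩)
      · exact ⟨⟨h1.1, by omega⟩, h2⟩
      · exact ⟨⟨by omega, h1.2⟩, Or.inr hy⟩
      · exact ⟨⟨by omega, h1.2⟩, Or.inr h2⟩
    · rintro ⟨h1, h2⟩
      rcases le_or_gt j y with h3 | h3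
      · exact Or.inl ⟨⟨h1.1, h3⟩, h2⟩
      · exact Or.inr ⟨⟨h3, h1.2⟩, Or.inr (h2.resolve_left (by omega))⟩
  · rw [Finset.disjoint_left]
    intro j h1 h2
    rw [mem_clusterStarts] at h1 h2
    omega

section Profiles

variable {h : ℝ} {N : ℕ} {m : ℕ → ℝ → ℂ} {t : ℕ → ℕ → ℝ} {g : ℕ → ℝ → ℂ} {gap : ℕ → ℝ≥0∞}

theorem HasProfiles.re_zero (H : HasProfiles h N m t g gap) {j : ℕ} (hj : 0 < j) (hj' : j ≤ N) :
    (g j 0).re = (-1) ^ j := by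
  have h1 := (Complex.continuous_re.tendsto _).comp (H.tendsto_profile j 0)
  refine tendsto_nhds_unique h1 (tendsto_const_nhds.congr fun n => ?_)
  simp [H.passage n j hj hj']

theorem HasProfiles.tendsto_sub (H : HasProfiles h N m t g gap) {j : ℕ} (hj : 0 < j) (hj' : j < N)
    (hgap : gap j ≠ ⊤) :
    Tendsto (fun n => t n (j + 1) - t n j) atTop (𝓝 (gap j).toReal) := by
  refine ((ENNReal.tendsto_toReal hgap).comp (H.tendsto_gap j)).congr fun n => ?_
  exact ENNReal.toReal_ofReal (sub_nonneg.2 (H.lt_succ n j hj hj').le)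

/-- If the distance of two centres converges, equicontinuity identifies the two limits up to a
translation. -/
theorem HasProfiles.succ_eq (H : HasProfiles h N m t g gap) {j : ℕ} (hj : 0 < j) (hj' : j < N)
    (hgap : gap j ≠ ⊤) (s : ℝ) : g (j + 1) s = g j (s + (gap j).toReal) := by
  refine tendsto_nhds_unique (H.tendsto_profile (j + 1) s) ?_
  have h1 := H.tendsto_profile j (s + (gap j).toReal)
  have h2 : Tendsto (fun n => m n (s + t n (j + 1)) - m n (s + (gap j).toReal + t n j)) atTop
      (𝓝 0) := by
    rw [Metric.tendsto_nhds]
    intro ε hε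
    obtain ⟨δ, hδ, hmδ⟩ := H.equicontinuous ε hε
    filter_upwards [Metric.tendsto_nhds.1 (H.tendsto_sub hj hj' hgap) δ hδ] with n hn
    rw [dist_zero_right]
    refine hmδ _ _ _ ?_
    rw [Real.dist_eq] at hn
    rwa [show s + t n (j + 1) - (s + (gap j).toReal + t n j) =
      t n (j + 1) - t n j - (gap j).toReal by ring]
  simpa using h2.add h1

/-- Without an infinite gap, all profiles of the group are translates of the first one, which thus
inherits all the passages. Their positions are the partial sums of the gaps. -/
theorem HasProfiles.mem_alternating (H : HasProfiles h N m t g gap) {x y : ℕ} (hy : y ≤ N)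
    (hgap : ∀ j, x < j → j < y → gap j ≠ ⊤) : g (x + 1) ∈ alternating h x y := by
  have hn : ∀ s, ‖g (x + 1) s‖ = 1 := fun s =>
    tendsto_nhds_unique (H.tendsto_profile (x + 1) s).norm
      (tendsto_const_nhds.congr fun n => (H.norm_eq_one n _).symm)
  have him : ∀ s, 0 ≤ (g (x + 1) s).im := fun s =>
    ge_of_tendsto' ((Complex.continuous_im.tendsto _).comp (H.tendsto_profile (x + 1) s))
      fun n => H.im_nonneg n _
  obtain ⟨p, hp0, hp⟩ : ∃ p : ℕ → ℝ, p (x + 1) = 0 ∧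
      ∀ j, x < j → p (j + 1) = p j + (gap j).toReal :=
    ⟨fun j => ∑ i ∈ Finset.Ico (x + 1) j, (gap i).toReal, by simp,
      fun j hj => Finset.sum_Ico_succ_top hj _⟩
  have hshift : ∀ j, x + 1 ≤ j → j ≤ y → ∀ s, g j s = g (x + 1) (s + p j) := by
    intro j hj
    induction j, hj using Nat.le_induction with
    | base => intro _ s; rw [hp0, add_zero]
    | succ j hj ih =>
      intro hjy s
      rw [H.succ_eq (by omega) (by omega) (hgap j hj hjy), ih (by omega), hp j hj]
      congr 1; ring
  have hval : ∀ j, x < j → j ≤ y → (g (x + 1) (p j)).re = (-1) ^ j := fun j hj hj' => by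
    rw [← H.re_zero (by omega) (hj'.trans hy), hshift j hj hj', zero_add]
  refine ⟨memH1locCircle_of_localEnergy hn (H.locAC _) (localEnergy_lt_top (H.energy_lt_top _)),
    him, H.energy_lt_top _, p, fun j hj hj' => ?_, hval⟩
  rw [hp j hj]
  -- A vanishing gap would make the first component equal to both `(-1) ^ j` and `(-1) ^ (j + 1)` at
  -- one point.
  refine lt_add_of_pos_right _ (lt_of_le_of_ne ENNReal.toReal_nonneg fun h0 => ?_)
  have e1 := hval (j + 1) (by omega) hj'
  rw [hp j hj, ← h0, add_zero, hval j hj hj'.le, pow_succ] at e1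
  have := neg_one_pow_mul_self j
  nlinarith

/-- The range is cut at infinite gaps by means of subadditivity, until each piece is carried by a
single profile. -/
theorem HasProfiles.alternatingEnergy_le (H : HasProfiles h N m t g gap) (h0 : 0 ≤ h) :
    ∀ {x y : ℕ}, x < y → y ≤ N →
      alternatingEnergy h x y ≤ ∑ j ∈ clusterStarts gap x y, energy h (g j) := by
  suffices ∀ n x y : ℕ, y = x + n → x < y → y ≤ N →
      alternatingEnergy h x y ≤ ∑ j ∈ clusterStarts gap x y, energy h (g j) from
    fun {x y} hxy hy => this (y - x) x y (by omega) hxy hy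
  intro n
  induction n using Nat.strong_induction_on with
  | _ n ih =>
    intro x y hn hxy hy
    by_cases hz : ∃ z, x < z ∧ z < y ∧ gap z = ⊤
    · obtain ⟨z, hxz, hzy, hgz⟩ := hz
      rw [← sum_clusterStarts_add hxz hzy hgz]
      exact (alternatingEnergy_le_add h0).trans (add_le_add
        (ih (z - x) (by omega) x z (by omega) hxz (by omega))
        (ih (y - z) (by omega) z y (by omega) hzy hy))
    · push Not at hz
      refine (iInf₂_le _ (H.mem_alternating hy hz)).trans ?_
      exact Finset.single_le_sum (f := fun j => energy h (g j)) (fun _ _ => zero_le)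
        (mem_clusterStarts.2 ⟨⟨by omega, hxy⟩, Or.inl rfl⟩)

theorem HasProfiles.le_of_le (H : HasProfiles h N m t g gap) (n : ℕ) {i j : ℕ} (hi : 0 < i)
    (hij : i ≤ j) (hj : j ≤ N) : t n i ≤ t n j := by
  induction j, hij using Nat.le_induction with
  | base => rfl
  | succ j hij ih => exact (ih (by omega)).trans (H.lt_succ n j (by omega) hj).le

/-- The gap just before the later of two starts is infinite, and the earlier start lies before this
gap. -/
theorem HasProfiles.tendsto_abs_sub (H : HasProfiles h N m t g gap) :
    ∀ i ∈ clusterStarts gap 0 N, ∀ j ∈ clusterStarts gap 0 N, i ≠ j →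
      Tendsto (fun n => |t n i - t n j|) atTop atTop := by
  have key : ∀ i ∈ clusterStarts gap 0 N, ∀ j ∈ clusterStarts gap 0 N, i < j →
      Tendsto (fun n => |t n i - t n j|) atTop atTop := by
    intro i hi j hj hij
    rw [mem_clusterStarts] at hi hj
    have h1 := H.tendsto_gap (j - 1)
    rw [hj.2.resolve_left (by omega), ENNReal.tendsto_ofReal_nhds_top,
      Nat.sub_add_cancel (by omega)] at h1
    refine tendsto_atTop_mono (fun n => ?_) h1
    have := H.le_of_le n hi.1.1 (show i ≤ j - 1 by omega) (by omega)
    rw [abs_sub_comm]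
    exact le_trans (by linarith) (le_abs_self _)
  intro i hi j hj hij
  rcases lt_or_gt_of_ne hij with h1 | h1
  · exact key i hi j hj h1
  · simpa only [abs_sub_comm] using key j hj i hi h1

end Profiles

theorem exists_profiles {h : ℝ} {N : ℕ} {m : ℕ → ℝ → ℂ} {t : ℕ → ℕ → ℝ}
    (hm : ∀ n, MemH1locCircle (m n)) (him : ∀ n s, 0 ≤ (m n s).im) {K : ℝ≥0∞} (hK : K ≠ ⊤)
    {ε : ℕ → ℝ≥0∞} (hε : Tendsto ε atTop (𝓝 0)) (hε1 : ∀ n, ε n ≤ 1)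
    (hE : ∀ n, energy h (m n) ≤ K + ε n) (hlt : ∀ n j, 0 < j → j < N → t n j < t n (j + 1))
    (hval : ∀ n j, 0 < j → j ≤ N → (m n (t n j)).re = (-1) ^ j) :
    ∃ (σ : ℕ → ℕ) (g : ℕ → ℝ → ℂ) (gap : ℕ → ℝ≥0∞),
      HasProfiles h N (fun n => m (σ n)) (fun n => t (σ n)) g gap ∧
        ∑ j ∈ clusterStarts gap 0 N, energy h (g j) ≤ K := by
  have hK1 : K + 1 ≠ ⊤ := ENNReal.add_ne_top.2 ⟨hK, ENNReal.one_ne_top⟩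
  have hE1 := fun n => (hE n).trans (add_le_add_right (hε1 n) K)
  have hI := fun n => (integral_norm_deriv_sq_le (hm n) hK1 (hE1 n)).1
  have hC := fun n => (integral_norm_deriv_sq_le (hm n) hK1 (hE1 n)).2
  have heq := uniformlyEquicontinuous_of_energy (fun n => (hm n).locAC) hI hC
  obtain ⟨σ, g, gap, L₀, N₀, hσ, hg, hgap, hL, hN⟩ := exists_subseq_tendsto (fun n => (hm n).1) heq t
    (fun n => localEnergy h (m n)) (fun n => strayFieldDirichlet fun t => (m n t).re)
  have hAC : ∀ j, LocAC (g j) := fun j => by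
    refine locAC_of_tendsto (m := fun n s => m (σ n) (s + t (σ n) j)) (C := (2 * (K + 1)).toReal)
      (fun n => (hm _).locAC.comp_add_const _) (fun n => ?_) (fun n => ?_) (hg j)
    · simp only [deriv_comp_add_const]
      exact (hI (σ n)).comp_add_right _
    · simp only [deriv_comp_add_const]
      rw [integral_add_right_eq_self fun s => ‖deriv (m (σ n)) s‖ ^ 2]
      exact hC (σ n)
  have hlim : 2⁻¹ * L₀ + 2⁻¹ * N₀ ≤ K := by
    have h1 : Tendsto (fun n => energy h (m (σ n))) atTop (𝓝 (2⁻¹ * L₀ + 2⁻¹ * N₀)) := by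
      simp only [energy_eq]
      exact (ENNReal.Tendsto.const_mul hL (Or.inr (by simp))).add
        (ENNReal.Tendsto.const_mul hN (Or.inr (by simp)))
    have h2 : Tendsto (fun n => K + ε (σ n)) atTop (𝓝 (K + 0)) :=
      tendsto_const_nhds.add (hε.comp hσ.tendsto_atTop)
    rw [add_zero] at h2
    exact le_of_tendsto_of_tendsto' h1 h2 fun n => hE _
  -- The bound is used twice: for singletons, to see that each profile has finite energy, and for
  -- the starts of the clusters, whose centres separate.
  have hsum : ∀ J : Finset ℕ, (∀ i ∈ J, ∀ j ∈ J, i ≠ j →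
      Tendsto (fun n => |t (σ n) i - t (σ n) j|) atTop atTop) → ∑ j ∈ J, energy h (g j) ≤ K :=
    fun J hJ => (sum_energy_le J (fun n => hm (σ n)) (fun j _ => hAC j)
      (fun j _ => hg j) hJ hL hN).trans hlim
  have H : HasProfiles h N (fun n => m (σ n)) (fun n => t (σ n)) g gap :=
    { norm_eq_one := fun n => (hm _).1
      im_nonneg := fun n => him _
      equicontinuous := fun ε hε => (heq ε hε).imp fun δ hδ => ⟨hδ.1, fun n => hδ.2 _⟩
      lt_succ := fun n => hlt _
      passage := fun n => hval _
      tendsto_profile := hg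
      tendsto_gap := hgap
      locAC := hAC
      energy_lt_top := fun j => by
        have h1 := hsum {j} fun i hi k hk hik => by
          rw [Finset.mem_singleton] at hi hk
          exact (hik (hi.trans hk.symm)).elim
        rw [Finset.sum_singleton] at h1
        exact h1.trans_lt hK.lt_top }
  exact ⟨σ, g, gap, H, hsum _ H.tendsto_abs_sub⟩

/-! ### Winding numbers of the parts -/

theorem phaseLimit_zero (h : ℝ) : phaseLimit h 0 = wellAngle h := by
  simpa using phaseLimit_even h 0

theorem alternatingDegree_zero (h : ℝ) {ℓ : ℕ} (hℓ : 1 ≤ ℓ) :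
    alternatingDegree h 0 (2 * ℓ - 1) = ℓ - wellAngle h / Real.pi := by
  obtain ⟨i, rfl⟩ : ∃ i, ℓ = i + 1 := ⟨ℓ - 1, by omega⟩
  have := Real.pi_pos
  rw [alternatingDegree, show 2 * (i + 1) - 1 = 2 * i + 1 by omega, phaseLimit_odd,
    phaseLimit_zero]
  push_cast
  field_simp
  ring

/-- Cutting after `p` passages at either end gives outer parts of equal degree `d'`: this is `p/2`
for even `p` and `(p + 1)/2 - α/π` for odd `p`. The range `1 ≤ p ≤ ℓ - 1` stays within the winding
numbers of the hypothesis. -/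
theorem alternatingDegree_parts (h : ℝ) {ℓ p : ℕ} (hp : 1 ≤ p) (hpℓ : p + 1 ≤ ℓ) :
    alternatingDegree h 0 p ∈ smallerWindingNumbers h ℓ ∧
      alternatingDegree h (2 * ℓ - 1 - p) (2 * ℓ - 1) = alternatingDegree h 0 p ∧
      alternatingDegree h p (2 * ℓ - 1 - p) =
        ℓ - wellAngle h / Real.pi - 2 * alternatingDegree h 0 p := by
  have := Real.pi_pos
  obtain ⟨i, rfl⟩ : ∃ i, ℓ = i + 1 := ⟨ℓ - 1, by omega⟩
  have eN : phaseLimit h (2 * (i + 1) - 1) = 2 * Real.pi * (i + 1) - wellAngle h := by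
    rw [show 2 * (i + 1) - 1 = 2 * i + 1 by omega, phaseLimit_odd]
  rcases Nat.even_or_odd' p with ⟨q, rfl | rfl⟩
  · have e1 : phaseLimit h (2 * (i + 1) - 1 - 2 * q) = 2 * Real.pi * (i - q + 1) - wellAngle h := by
      rw [show 2 * (i + 1) - 1 - 2 * q = 2 * (i - q) + 1 by omega, phaseLimit_odd,
        Nat.cast_sub (by omega)]
    have e2 : alternatingDegree h 0 (2 * q) = q := by
      rw [alternatingDegree, phaseLimit_zero, phaseLimit_even]; field_simp; ring
    refine ⟨Or.inr ⟨q, by omega, by omega, e2⟩, ?_, ?_⟩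
    · rw [e2, alternatingDegree, eN, e1]; field_simp; ring
    · rw [e2, alternatingDegree, e1, phaseLimit_even]; push_cast; field_simp; ring
  · have e1 : phaseLimit h (2 * (i + 1) - 1 - (2 * q + 1)) = 2 * Real.pi * (i - q) + wellAngle h := by
      rw [show 2 * (i + 1) - 1 - (2 * q + 1) = 2 * (i - q) by omega, phaseLimit_even,
        Nat.cast_sub (by omega)]
    have e2 : alternatingDegree h 0 (2 * q + 1) = (q + 1 : ℕ) - wellAngle h / Real.pi := by
      rw [alternatingDegree, phaseLimit_zero, phaseLimit_odd]; push_cast; field_simp; ring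
    refine ⟨Or.inl ⟨q + 1, by omega, by omega, e2⟩, ?_, ?_⟩
    · rw [e2, alternatingDegree, eN, e1]; push_cast; field_simp; ring
    · rw [e2, alternatingDegree, e1, phaseLimit_odd]; push_cast; field_simp; ring

/-! ### Conclusion: splitting is excluded and the infimum is attained -/

theorem minEnergy_lt_top {h : ℝ} (h0 : 0 ≤ h) {ℓ : ℕ} (hℓ : 1 ≤ ℓ)
    (hstrict : ∀ d' ∈ smallerWindingNumbers h ℓ, minEnergy h (ℓ - wellAngle h / Real.pi) <
      2 * minEnergy h d' + minEnergy h (ℓ - wellAngle h / Real.pi - 2 * d')) :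
    minEnergy h (ℓ - wellAngle h / Real.pi) < ⊤ := by
  -- For `ℓ ≥ 2` the strict inequality for `d' = 1 - α/π` already says that the left side is finite.
  rcases hℓ.eq_or_lt with rfl | h2
  · obtain ⟨m, hm⟩ := alternating_zero_one_nonempty h0
    rw [← alternatingDegree_zero h le_rfl]
    exact ((minEnergy_le_alternatingEnergy h zero_le_one).trans (iInf₂_le m hm)).trans_lt hm.2.2.1
  · exact (hstrict _ (Or.inl ⟨1, le_rfl, by omega, rfl⟩)).trans_le le_top

/-- If splitting off two parts of equal winding number from both ends costs energy, then the
infimum of the energy in `admissible h (ℓ - α / π)` is attained. -/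
theorem exists_energy_eq_minEnergy {h : ℝ} (h_nonneg : 0 ≤ h) {ℓ : ℕ} (one_le_ℓ : 1 ≤ ℓ)
    (hstrict : ∀ d' ∈ smallerWindingNumbers h ℓ, minEnergy h (ℓ - wellAngle h / Real.pi) <
      2 * minEnergy h d' + minEnergy h (ℓ - wellAngle h / Real.pi - 2 * d')) :
    ∃ m ∈ admissible h (ℓ - wellAngle h / Real.pi),
      energy h m = minEnergy h (ℓ - wellAngle h / Real.pi) := by
  have hK := (minEnergy_lt_top h_nonneg one_le_ℓ hstrict).ne
  set d : ℝ := (ℓ : ℝ) - wellAngle h / Real.pi with hd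
  have hseq : ∀ n : ℕ, ∃ (m : ℝ → ℂ) (t : ℕ → ℝ), MemH1locCircle m ∧ (∀ s, 0 ≤ (m s).im) ∧
      energy h m ≤ minEnergy h d + ((n : ℝ≥0∞) + 1)⁻¹ ∧
      (∀ j, 0 < j → j < 2 * ℓ - 1 → t j < t (j + 1)) ∧
      (∀ j, 0 < j → j ≤ 2 * ℓ - 1 → (m (t j)).re = (-1) ^ j) ∧
      ∀ j, 0 < j → j ≤ 2 * ℓ - 1 → t (2 * ℓ - j) = - t j := fun n => by
    obtain ⟨m₀, hm₀, hlt⟩ : ∃ m ∈ admissible h d,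
        energy h m < minEnergy h d + ((n : ℝ≥0∞) + 1)⁻¹ := by
      have := ENNReal.lt_add_right hK (show ((n : ℝ≥0∞) + 1)⁻¹ ≠ 0 by simp)
      nth_rw 1 [minEnergy] at this
      simpa only [iInf_lt_iff, exists_prop] using this
    obtain ⟨m₁, hm₁, hle⟩ := exists_alternating_of_admissible h_nonneg one_le_ℓ hm₀
    obtain ⟨m, t, h1, h2, h3, h4⟩ := exists_symmetric_passages one_le_ℓ hm₁
    exact ⟨m, t, h1, h2, h3.trans (hle.trans hlt.le), h4⟩
  choose m t hm him hE hlt hval hsymm using hseq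
  have hε : Tendsto (fun n : ℕ => ((n : ℝ≥0∞) + 1)⁻¹) atTop (𝓝 0) := by
    have := (tendsto_add_atTop_iff_nat 1).2 ENNReal.tendsto_inv_nat_nhds_zero
    simpa using this
  obtain ⟨σ, g, gap, H, hsum⟩ := exists_profiles hm him hK hε
    (fun n => ENNReal.inv_le_one.2 le_add_self) hE hlt hval
  by_cases hgap : ∃ p, 1 ≤ p ∧ p < 2 * ℓ - 1 ∧ gap p = ⊤
  · exfalso
    obtain ⟨p, hp, hpℓ, htop⟩ := hgap
    -- The symmetry `t (2ℓ - j) = -t j` exchanges the gap after `p` with the gap after `2ℓ - 1 - p`.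
    have hrefl : gap (2 * ℓ - 1 - p) = ⊤ := by
      refine tendsto_nhds_unique (H.tendsto_gap (2 * ℓ - 1 - p)) (htop ▸ (H.tendsto_gap p).congr
        fun n => ?_)
      have e1 := hsymm (σ n) p hp hpℓ.le
      have e2 := hsymm (σ n) (p + 1) (by omega) (by omega)
      rw [show 2 * ℓ - 1 - p + 1 = 2 * ℓ - p by omega, e1,
        show 2 * ℓ - 1 - p = 2 * ℓ - (p + 1) by omega, e2]
      congr 1; ring
    -- One of `p` and `2ℓ - 1 - p` is at most `ℓ - 1`. As their sum is odd they differ, so the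
    -- middle group is never empty.
    obtain ⟨p, hp, hpℓ, htop, hrefl⟩ : ∃ p, 1 ≤ p ∧ p + 1 ≤ ℓ ∧ gap p = ⊤ ∧
        gap (2 * ℓ - 1 - p) = ⊤ := by
      rcases le_or_gt (p + 1) ℓ with h1 | h1
      · exact ⟨p, hp, h1, htop, hrefl⟩
      · exact ⟨2 * ℓ - 1 - p, by omega, by omega, hrefl, by
          rwa [show 2 * ℓ - 1 - (2 * ℓ - 1 - p) = p by omega]⟩
    obtain ⟨hmem, hlast, hmid⟩ := alternatingDegree_parts h hp hpℓ
    have b1 := (minEnergy_le_alternatingEnergy h (Nat.zero_le p)).trans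
      (H.alternatingEnergy_le h_nonneg (x := 0) (y := p) (by omega) (by omega))
    have b2 := (minEnergy_le_alternatingEnergy h (x := p) (y := 2 * ℓ - 1 - p) (by omega)).trans
      (H.alternatingEnergy_le h_nonneg (by omega) (by omega))
    have b3 := (minEnergy_le_alternatingEnergy h (x := 2 * ℓ - 1 - p) (y := 2 * ℓ - 1)
      (by omega)).trans (H.alternatingEnergy_le h_nonneg (by omega) (by omega))
    rw [hmid] at b2
    rw [hlast] at b3
    -- The clusters are distributed over the three groups of passages, and the total energy of each
    -- group bounds the infimum for its degree.
    refine (hstrict _ hmem).not_ge (le_trans ?_ hsum)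
    rw [← sum_clusterStarts_add (x := 0) (y := p) (by omega) (by omega) htop,
      ← sum_clusterStarts_add (x := p) (y := 2 * ℓ - 1 - p) (by omega) (by omega) hrefl, two_mul,
      add_assoc, add_comm (minEnergy h (alternatingDegree h 0 p)) (minEnergy h (d - _))]
    exact add_le_add b1 (add_le_add b2 b3)
  · push Not at hgap
    -- All gaps are finite, so the first profile carries all `2ℓ - 1` passages and its unfolding is
    -- the minimiser.
    have hmem := H.mem_alternating (x := 0) le_rfl fun j h1 h2 => hgap j h1 h2
    obtain ⟨m', hm', hle⟩ := exists_admissible_of_alternating (Nat.zero_le _) hmem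
    rw [alternatingDegree_zero h one_le_ℓ] at hm'
    refine ⟨m', hm', le_antisymm ?_ (iInf₂_le m' hm')⟩
    refine hle.trans (le_trans ?_ hsum)
    exact Finset.single_le_sum (f := fun j => energy h (g j)) (fun _ _ => zero_le)
      (mem_clusterStarts.2 ⟨⟨by omega, by omega⟩, Or.inl rfl⟩)

end Neel

theorem theorem5p1 (h : ℝ) (h_nonneg : 0 ≤ h) (h_ne_one : h ≠ 1)
    (ℓ : ℕ) (one_le_ℓ : 1 ≤ ℓ)
    (d : ℝ) (hd : d = (ℓ : ℝ) - Neel.wellAngle h / Real.pi)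
    (hstrict : ∀ d' ∈ Neel.smallerWindingNumbers h ℓ,
      Neel.minEnergy h d < 2 * Neel.minEnergy h d' + Neel.minEnergy h (d - 2 * d')) :
    ∃ m ∈ Neel.admissible h d, Neel.energy h m = Neel.minEnergy h d := by
  subst hd
  exact Neel.exists_energy_eq_minEnergy h_nonneg one_le_ℓ hstrict
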